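/- **Lemma 4.1 (Caccioppoli-type inequality for the minimal graph equation).** Let $M$ be a Riemannian manifold of dimension $n\ge 2$ (for instance a Cartan–Hadamard manifold), and let $o\in M$. Let $\Psi\colon[0,\infty)\to[0,\infty)$ be a homeomorphism that is smooth on $(0,\infty)$, and let $U\subset M$ be open and relatively compact. Let $\eta\ge 0$ be a locally Lipschitz function on $U\setminus\{o\}$. Let $\theta,u\in L^\infty(U)\cap W^{1,2}(U)$ be continuous functions such that $u\in C^2(U)$ is a solution of the minimal graph equation in $U$, that is, $$\int_U\frac{\langle\nabla u,\nabla\varphi\rangle}{\sqrt{1+|\nabla u|^2}}=0\qquad\text{for every }\varphi\in C_0^\infty(U).$$ Put $W=\sqrt{1+|\nabla u|^2}$ and $h=|u-\theta|/\nu$, where $\nu>0$ is a constant, and suppose that $\eta^2\,\Psi(h)\,W\in W_0^{1,2}(U)$, where $W^{1,2}_0(U)$ is the closure of $C_0^\infty(U)$ in $W^{1,2}(U)$. Then $$\int_U\eta^2\,\Psi'(h)\,|\nabla u|^2\;\le\;4\int_U\eta^2\,\Psi'(h)\,|\nabla\theta|^2+8\nu^2\int_U\frac{\Psi^2}{\Psi'}(h)\,|\nabla\eta|^2+4\nu^2\int_U\eta^2\,\frac{\Psi^2}{\Psi'}(h)\,|\nabla\log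 W|^2 .$$ Here $\nabla\theta$ is the weak gradient of $\theta$, the gradient of $\eta$ exists almost everywhere, and the integrals are taken with respect to the Riemannian volume, with values in $[0,\infty]$. Conventions: $\Psi'(0)$ may be given any fixed value in $[0,\infty]$; $\frac{\Psi^2}{\Psi'}(t)=0$ for $t=0$ and $=\infty$ where $\Psi'(t)=0$, $t>0$; and $0\cdot\infty=0$. -/

import Mathlib

open Set Filter Topology MeasureTheory Bundle
open scoped Manifold ContDiff NNReal ENNReal

noncomputable section

namespace MinimalGraph

section Riemannian

variable (n : ℕ) {M : Type*} [EMetricSpace M] [ChartedSpace (EuclideanSpace ℝ (Fin n)) M]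
  [IsManifold (𝓡 n) ∞ M]
  [RiemannianBundle (fun x : M => TangentSpace (𝓡 n) x)]

instance finiteDimensional_tangentSpace (x : M) :
    FiniteDimensional ℝ (TangentSpace (𝓡 n) x) :=
  inferInstanceAs (FiniteDimensional ℝ (EuclideanSpace ℝ (Fin n)))

/-- The Riemannian gradient `∇f(x)`: the vector representing the differential of `f` at `x` through
the inner product of the tangent space. It is meaningful where `f` is differentiable. -/
def grad (f : M → ℝ) (x : M) : TangentSpace (𝓡 n) x :=
  haveI : CompleteSpace (TangentSpace (𝓡 n) x) := FiniteDimensional.complete ℝ _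
  (InnerProductSpace.toDual ℝ (TangentSpace (𝓡 n) x)).symm (mfderiv (𝓡 n) 𝓘(ℝ, ℝ) f x)

/-- The image of the constant coordinate vector `v` at the point `y` of the target of the chart
around `p`, a tangent vector of `M` at the point with coordinates `y`. -/
def coordVec (p : M) (v y : EuclideanSpace ℝ (Fin n)) :
    TangentSpace (𝓡 n) ((extChartAt (𝓡 n) p).symm y) :=
  mfderiv (𝓡 n) (𝓡 n) (extChartAt (𝓡 n) p).symm y v

/-- The matrix `g_{ij}` of the Riemannian metric in the chart around `p`, at the coordinates `y`. -/
def metricMatrix (p : M) (y : EuclideanSpace ℝ (Fin n)) : Matrix (Fin n) (Fin n) ℝ :=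
  Matrix.of fun i j =>
    inner ℝ (coordVec n p (EuclideanSpace.single i 1) y)
      (coordVec n p (EuclideanSpace.single j 1) y)

/-- The Riemannian volume of the domain of the chart around `p`, as a measure on `M`: the measure
`√(det g_{ij}) dy` on the target of the chart, transported to `M`. -/
def chartVolume [MeasurableSpace M] (p : M) : Measure M :=
  ((volume.restrict (extChartAt (𝓡 n) p).target).withDensity
    fun y => ENNReal.ofReal √(metricMatrix n p y).det).map (extChartAt (𝓡 n) p).symm

variable (M) in
/-- The Riemannian volume measure of `M`. The measures `chartVolume n p` agree on overlaps of chart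
domains, so that their supremum in the lattice of measures is the measure glued from them. -/
def riemannianVolume [MeasurableSpace M] : Measure M :=
  ⨆ p : M, chartVolume n p

/-- The part of the target of the chart around `p` that corresponds to points of `U`. -/
def chartImage (p : M) (U : Set M) : Set (EuclideanSpace ℝ (Fin n)) :=
  (extChartAt (𝓡 n) p).target ∩ (extChartAt (𝓡 n) p).symm ⁻¹' U

/-- `G` is the weak gradient of `f` in the open set `U`: in the coordinates of each chart, `f` and
the components of its weak differential `⟨G, ·⟩` are locally integrable, and integration by parts
against smooth compactly supported functions holds. -/
structure HasWeakGrad (U : Set M) (f : M → ℝ) (G : ∀ x : M, TangentSpace (𝓡 n) x) : Prop where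
  locallyIntegrable (p : M) :
    LocallyIntegrableOn (fun y => f ((extChartAt (𝓡 n) p).symm y)) (chartImage n p U)
  locallyIntegrable_grad (p : M) (v : EuclideanSpace ℝ (Fin n)) :
    LocallyIntegrableOn
      (fun y => (inner ℝ (G ((extChartAt (𝓡 n) p).symm y)) (coordVec n p v y) : ℝ))
      (chartImage n p U)
  integral_eq (p : M) (v : EuclideanSpace ℝ (Fin n)) (ψ : EuclideanSpace ℝ (Fin n) → ℝ)
    (hψ : ContDiff ℝ ∞ ψ) (hc : HasCompactSupport ψ) (hs : tsupport ψ ⊆ chartImage n p U) :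
    ∫ y, f ((extChartAt (𝓡 n) p).symm y) * fderiv ℝ ψ y v
      = - ∫ y, (inner ℝ (G ((extChartAt (𝓡 n) p).symm y)) (coordVec n p v y) : ℝ) * ψ y

/-- `f ∈ W^{1,2}(U)`, with weak gradient `G`. -/
structure HasW12Grad [MeasurableSpace M] (U : Set M) (f : M → ℝ)
    (G : ∀ x : M, TangentSpace (𝓡 n) x) : Prop where
  hasWeakGrad : HasWeakGrad n U f G
  memLp : MemLp f 2 ((riemannianVolume n M).restrict U)
  lintegral_grad_lt_top : ∫⁻ x in U, ‖G x‖ₑ ^ 2 ∂(riemannianVolume n M) < ⊤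

/-- `f ∈ W^{1,2}(U)`. -/
def MemW12 [MeasurableSpace M] (U : Set M) (f : M → ℝ) : Prop :=
  ∃ G : ∀ x : M, TangentSpace (𝓡 n) x, HasW12Grad n U f G

/-- `φ ∈ C_0^∞(U)`. -/
structure IsTestFunction (U : Set M) (φ : M → ℝ) : Prop where
  contMDiff : ContMDiff (𝓡 n) 𝓘(ℝ, ℝ) ∞ φ
  hasCompactSupport : HasCompactSupport φ
  tsupport_subset : tsupport φ ⊆ U

/-- `f ∈ W_0^{1,2}(U)`, the closure of `C_0^∞(U)` in `W^{1,2}(U)`. -/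
def MemW12Zero [MeasurableSpace M] (U : Set M) (f : M → ℝ) : Prop :=
  ∃ G : ∀ x : M, TangentSpace (𝓡 n) x, HasW12Grad n U f G ∧
    ∃ φ : ℕ → M → ℝ, (∀ k, IsTestFunction n U (φ k)) ∧
      Tendsto (fun k => ∫⁻ x in U, ‖φ k x - f x‖ₑ ^ 2 ∂(riemannianVolume n M)) atTop (𝓝 0) ∧
      Tendsto (fun k => ∫⁻ x in U, ‖grad n (φ k) x - G x‖ₑ ^ 2 ∂(riemannianVolume n M))
        atTop (𝓝 0)

/-- `W = √(1 + |∇u|²)`. -/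
def slope (u : M → ℝ) (x : M) : ℝ :=
  √(1 + ‖grad n u x‖ ^ 2)

/-- `u`, a function that is differentiable in the open set `U`, is a solution in `U` of the minimal
graph equation `div (∇u / √(1 + |∇u|²)) = 0`, tested against `C_0^∞(U)`. -/
def IsMinimalGraphSolution [MeasurableSpace M] (U : Set M) (u : M → ℝ) : Prop :=
  ∀ φ : M → ℝ, IsTestFunction n U φ →
    ∫ x in U, inner ℝ (grad n u x) (grad n φ x) / slope n u x ∂(riemannianVolume n M) = 0

end Riemannian

/-- A self-map of `[0,∞)`, read as a real function of a real variable. -/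
def onReal (Ψ : ℝ≥0 ≃ₜ ℝ≥0) (t : ℝ) : ℝ :=
  Ψ t.toNNReal

/-- The derivative `Ψ'(t)` for `t > 0`, as an element of `[0,∞]` (it is nonnegative, `Ψ` being
increasing); `Ψ'(0)`, on which nothing is assumed, has the prescribed value `d₀`. -/
def derivAt (Ψ : ℝ≥0 ≃ₜ ℝ≥0) (d₀ : ℝ≥0∞) (t : ℝ) : ℝ≥0∞ :=
  if t = 0 then d₀ else ENNReal.ofReal (deriv (onReal Ψ) t)

/-- The quotient `Ψ(t)² / Ψ'(t)` in `[0,∞]`; here `a / 0 = ∞` for `a > 0`, and the value at `t = 0`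
is `0` whatever `d₀` is. -/
def sqDivDeriv (Ψ : ℝ≥0 ≃ₜ ℝ≥0) (d₀ : ℝ≥0∞) (t : ℝ) : ℝ≥0∞ :=
  ENNReal.ofReal (onReal Ψ t) ^ 2 / derivAt Ψ d₀ t

end MinimalGraph

end

namespace MinimalGraph

set_option linter.unusedSectionVars false

section Mollify

variable {E : Type*} [NormedAddCommGroup E] [NormedSpace ℝ E] [FiniteDimensional ℝ E]
  [MeasurableSpace E] [BorelSpace E] {μ : Measure E} [μ.IsAddHaarMeasure]

/-- A smooth cutoff function, equal to `1` near a compact set, with compact support in a given open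
neighbourhood. -/
theorem exists_contDiff_cutoff {K Ω : Set E} (hK : IsCompact K) (hΩ : IsOpen Ω) (hKΩ : K ⊆ Ω) :
    ∃ χ : E → ℝ, ContDiff ℝ ∞ χ ∧ HasCompactSupport χ ∧ tsupport χ ⊆ Ω ∧
      (∀ᶠ y in 𝓝ˢ K, χ y = 1) := by
  obtain ⟨L, hL, hKL, hLΩ⟩ := exists_compact_between hK hΩ hKΩ
  obtain ⟨f, h1, h0, -⟩ := exists_contMDiffMap_one_nhds_of_subset_interior (n := (⊤ : ℕ∞)) 𝓘(ℝ, E)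
    hK.isClosed hKL
  have hs : tsupport f ⊆ L := closure_minimal
    (fun x hx => by by_contra h; exact hx (h0 x h)) hL.isClosed
  exact ⟨f, f.contMDiff.contDiff, hL.of_isClosed_subset (isClosed_tsupport _) hs, hs.trans hLΩ, h1⟩

/-- A standard sequence of bump functions whose supports shrink to `0`. -/
noncomputable def bumpSeq (E : Type*) [NormedAddCommGroup E] (k : ℕ) : ContDiffBump (0 : E) where
  rIn := 1 / ((k : ℝ) + 1)
  rOut := 2 / ((k : ℝ) + 1)
  rIn_pos := by positivity
  rIn_lt_rOut := by gcongr; norm_num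

theorem tendsto_bumpSeq_rOut : Tendsto (fun k => (bumpSeq E k).rOut) atTop (𝓝 0) := by
  have := (tendsto_one_div_add_atTop_nhds_zero_nat (𝕜 := ℝ)).const_mul 2
  simpa [bumpSeq, mul_one_div, div_eq_mul_inv] using this

variable (μ) in
/-- Mollification of a function on a finite-dimensional space. -/
noncomputable def mollify (k : ℕ) (f : E → ℝ) : E → ℝ :=
  convolution ((bumpSeq E k).normed μ) f (ContinuousLinearMap.lsmul ℝ ℝ) μ

theorem mollify_apply (k : ℕ) (f : E → ℝ) (x : E) :
    mollify μ k f x = ∫ t, f t * (bumpSeq E k).normed μ (x - t) ∂μ := by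
  rw [mollify, convolution_eq_swap]
  simp [mul_comm]

theorem contDiff_mollify (k : ℕ) {f : E → ℝ} (hf : LocallyIntegrable f μ) :
    ContDiff ℝ ∞ (mollify μ k f) :=
  (bumpSeq E k).hasCompactSupport_normed.contDiff_convolution_left _
    (bumpSeq E k).contDiff_normed hf

theorem integrable_mollify (k : ℕ) {f : E → ℝ} (hf : Integrable f μ) :
    Integrable (mollify μ k f) μ :=
  (bumpSeq E k).integrable_normed.integrable_convolution _ hf

theorem integral_norm_mollify_le (k : ℕ) {f : E → ℝ} (hf : Integrable f μ) :
    ∫ x, ‖mollify μ k f x‖ ∂μ ≤ ∫ x, ‖f x‖ ∂μ := by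
  have h1 : ∫ x, mollify μ k (fun y => ‖f y‖) x ∂μ = ∫ x, ‖f x‖ ∂μ := by
    rw [mollify, integral_convolution _ (bumpSeq E k).integrable_normed hf.norm]
    simp [(bumpSeq E k).integral_normed]
  rw [← h1]
  refine integral_mono (integrable_mollify k hf).norm (integrable_mollify k hf.norm) fun x => ?_
  simp only [mollify_apply]
  refine (norm_integral_le_integral_norm _).trans_eq ?_
  congr with t
  rw [norm_mul, Real.norm_of_nonneg ((bumpSeq E k).nonneg_normed _)]

theorem ae_tendsto_mollify {f : E → ℝ} (hf : LocallyIntegrable f μ) :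
    ∀ᵐ x ∂μ, Tendsto (fun k => mollify μ k f x) atTop (𝓝 (f x)) := by
  refine ContDiffBump.ae_convolution_tendsto_right_of_locallyIntegrable (K := 2)
    tendsto_bumpSeq_rOut (.of_forall fun k => ?_) hf
  simp [bumpSeq, div_eq_mul_inv]

/-- Scheffé's lemma. -/
theorem tendsto_integral_norm_sub_of_ae_tendsto {α : Type*} [MeasurableSpace α] {μ : Measure α}
    {F : ℕ → α → ℝ} {f : α → ℝ}
    (hF : ∀ k, Integrable (F k) μ) (hf : Integrable f μ)
    (hle : ∀ k, ∫ x, ‖F k x‖ ∂μ ≤ ∫ x, ‖f x‖ ∂μ)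
    (hae : ∀ᵐ x ∂μ, Tendsto (fun k => F k x) atTop (𝓝 (f x))) :
    Tendsto (fun k => ∫ x, ‖F k x - f x‖ ∂μ) atTop (𝓝 0) := by
  set H : ℕ → α → ℝ := fun k x => min (‖F k x‖ + ‖f x‖ - ‖F k x - f x‖) (2 * ‖f x‖) with hH
  have hmeas (k) : AEStronglyMeasurable (H k) μ :=
    (((hF k).norm.add hf.norm).sub ((hF k).sub hf).norm).aestronglyMeasurable.inf
      (hf.norm.const_mul 2).aestronglyMeasurable
  have hbd (k x) : ‖H k x‖ ≤ 2 * ‖f x‖ := by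
    have h0 : 0 ≤ H k x := le_min
      (by have := norm_sub_le (F k x) (f x); linarith) (by positivity)
    rw [Real.norm_of_nonneg h0]
    exact min_le_right _ _
  have hlim : Tendsto (fun k => ∫ x, H k x ∂μ) atTop (𝓝 (∫ x, 2 * ‖f x‖ ∂μ)) := by
    refine tendsto_integral_of_dominated_convergence (fun x => 2 * ‖f x‖) hmeas
      (hf.norm.const_mul 2) (fun k => .of_forall (hbd k)) ?_
    filter_upwards [hae] with x hx
    have h1 := ((hx.norm.add_const ‖f x‖).sub (hx.sub_const (f x)).norm).min
      (tendsto_const_nhds (x := 2 * ‖f x‖))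
    simpa [hH, two_mul] using h1
  have hHi (k) : Integrable (H k) μ :=
    (hf.norm.const_mul 2).mono' (hmeas k) (.of_forall (hbd k))
  refine squeeze_zero (fun k => integral_nonneg fun x => norm_nonneg _) (fun k => ?_)
    (by simpa only [sub_self] using (tendsto_const_nhds (x := ∫ x, 2 * ‖f x‖ ∂μ)).sub hlim)
  have h2 : ∫ x, H k x ∂μ ≤ ∫ x, (‖F k x‖ + ‖f x‖ - ‖F k x - f x‖) ∂μ :=
    integral_mono (hHi k) (((hF k).norm.add hf.norm).sub ((hF k).sub hf).norm)
      fun x => min_le_left _ _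
  rw [integral_sub (by exact (hF k).norm.add hf.norm) (by exact ((hF k).sub hf).norm),
    integral_add (hF k).norm hf.norm] at h2
  have h3 : ∫ x, 2 * ‖f x‖ ∂μ = 2 * ∫ x, ‖f x‖ ∂μ := integral_const_mul _ _
  have := hle k
  change _ ≤ ∫ x, 2 * ‖f x‖ ∂μ - ∫ x, H k x ∂μ
  linarith

theorem tendsto_integral_norm_mollify_sub {f : E → ℝ} (hf : Integrable f μ) :
    Tendsto (fun k => ∫ x, ‖mollify μ k f x - f x‖ ∂μ) atTop (𝓝 0) :=
  tendsto_integral_norm_sub_of_ae_tendsto (fun k => integrable_mollify k hf) hf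
    (fun k => integral_norm_mollify_le k hf) (ae_tendsto_mollify hf.locallyIntegrable)

theorem support_mollify_subset (k : ℕ) (f : E → ℝ) :
    Function.support (mollify μ k f) ⊆
      Metric.cthickening (bumpSeq E k).rOut (tsupport f) := by
  intro x hx
  obtain ⟨a, ha, b, hb, rfl⟩ := support_convolution_subset_swap _ hx
  rw [(bumpSeq E k).support_normed_eq, mem_ball_zero_iff] at hb
  refine Metric.mem_cthickening_of_dist_le _ a _ _ (subset_tsupport _ ha) ?_
  simpa using hb.le

theorem hasCompactSupport_mollify (k : ℕ) {f : E → ℝ} (hf : HasCompactSupport f) :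
    HasCompactSupport (mollify μ k f) :=
  hf.isCompact.cthickening.of_isClosed_subset (isClosed_tsupport _)
    (closure_minimal (support_mollify_subset k f) Metric.isClosed_cthickening)

theorem eventually_tsupport_mollify_subset {f : E → ℝ} (hf : HasCompactSupport f) {Ω : Set E}
    (hΩ : IsOpen Ω) (h : tsupport f ⊆ Ω) : ∀ᶠ k in atTop, tsupport (mollify μ k f) ⊆ Ω := by
  obtain ⟨δ, hδ, hδΩ⟩ := hf.isCompact.exists_cthickening_subset_open hΩ h
  filter_upwards [(tendsto_bumpSeq_rOut (E := E)).eventually (ge_mem_nhds hδ)] with k hk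
  exact (closure_minimal (support_mollify_subset k f) Metric.isClosed_cthickening).trans
    ((Metric.cthickening_mono hk _).trans hδΩ)

/-- `f` and `g` are locally integrable in `Ω`, and `g` is the weak derivative of `f` in the
direction `v`. -/
structure HasWeakDeriv (μ : Measure E) (Ω : Set E) (f g : E → ℝ) (v : E) : Prop where
  locallyIntegrableOn : LocallyIntegrableOn f Ω μ
  locallyIntegrableOn_deriv : LocallyIntegrableOn g Ω μ
  integral_eq (ψ : E → ℝ) (hψ : ContDiff ℝ ∞ ψ) (hc : HasCompactSupport ψ) (hs : tsupport ψ ⊆ Ω) :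
    ∫ y, f y * fderiv ℝ ψ y v ∂μ = - ∫ y, g y * ψ y ∂μ

variable {Ω : Set E} {f g : E → ℝ} {v : E}

theorem HasWeakDeriv.mono (h : HasWeakDeriv μ Ω f g v) {Ω' : Set E} (hs : Ω' ⊆ Ω) :
    HasWeakDeriv μ Ω' f g v :=
  ⟨h.1.mono_set hs, h.2.mono_set hs, fun ψ h1 h2 h3 => h.3 ψ h1 h2 (h3.trans hs)⟩

/-- Mollification commutes with weak differentiation. -/
theorem HasWeakDeriv.fderiv_mollify (h : HasWeakDeriv μ univ f g v) (k : ℕ) (x : E) :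
    fderiv ℝ (mollify μ k f) x v = mollify μ k g x := by
  have hf : LocallyIntegrable f μ := locallyIntegrableOn_univ.1 h.1
  set ρ := (bumpSeq E k).normed μ with hρ
  have hρs : ContDiff ℝ ∞ ρ := (bumpSeq E k).contDiff_normed
  have hρc : HasCompactSupport ρ := (bumpSeq E k).hasCompactSupport_normed
  have h1 : fderiv ℝ (mollify μ k f) x v = ∫ t, f t * fderiv ℝ ρ (x - t) v ∂μ := by
    rw [mollify, (hρc.hasFDerivAt_convolution_left _ (hρs.of_le (by simp)) hf x).fderiv,
      convolution_eq_swap]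
    rw [ContinuousLinearMap.integral_apply]
    · simp [mul_comm]
    · have := (hρc.fderiv ℝ).convolutionExists_left
        ((ContinuousLinearMap.lsmul ℝ ℝ : ℝ →L[ℝ] ℝ →L[ℝ] ℝ).precompL E)
        (hρs.continuous_fderiv (by simp)) hf x
      exact (convolutionExistsAt_iff_integrable_swap.1 this)
  have hd (t : E) : fderiv ℝ (fun t => ρ (x - t)) t v = - fderiv ℝ ρ (x - t) v := by
    have h2 : HasFDerivAt (fun t => ρ (x - t)) _ t :=
      ((hρs.differentiable (by simp) (x - t)).hasFDerivAt).comp t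
        ((hasFDerivAt_id t).const_sub x)
    rw [h2.fderiv]; simp
  have h3 := h.3 (fun t => ρ (x - t)) (hρs.comp (contDiff_const.sub contDiff_id))
    (hρc.comp_homeomorph (Homeomorph.subLeft x)) (subset_univ _)
  simp only [hd, mul_neg, integral_neg, neg_inj] at h3
  rw [h1, h3, mollify_apply]

/-- A function of compact support that is weakly differentiable in an open set containing the
support is weakly differentiable in the whole space. -/
theorem HasWeakDeriv.extend (hΩ : IsOpen Ω) (h : HasWeakDeriv μ Ω f g v) {K : Set E}
    (hK : IsCompact K) (hKΩ : K ⊆ Ω) (hf : ∀ y ∉ K, f y = 0) (hg : ∀ y ∉ K, g y = 0) :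
    HasWeakDeriv μ univ f g v := by
  have hi {w : E → ℝ} (hw : LocallyIntegrableOn w Ω μ) (hw0 : ∀ y ∉ K, w y = 0) :
      Integrable w μ := by
    have h1 := (hw.mono_set hKΩ).integrableOn_isCompact hK
    exact (integrableOn_iff_integrable_of_support_subset
      (fun y hy => by by_contra h2; exact hy (hw0 y h2))).1 h1
  refine ⟨(hi h.1 hf).locallyIntegrable.locallyIntegrableOn _,
    (hi h.2 hg).locallyIntegrable.locallyIntegrableOn _, fun ψ hψ hc _ => ?_⟩
  obtain ⟨χ, hχ, hχc, hχΩ, hχ1⟩ := exists_contDiff_cutoff hK hΩ hKΩ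
  have h1 := h.3 (fun y => χ y * ψ y) (hχ.mul hψ) hχc.mul_right
    ((tsupport_mul_subset_left).trans hχΩ)
  have e1 (y : E) : f y * fderiv ℝ (fun y => χ y * ψ y) y v = f y * fderiv ℝ ψ y v := by
    by_cases hy : y ∈ K
    · have : (fun y => χ y * ψ y) =ᶠ[𝓝 y] ψ := by
        filter_upwards [hχ1.filter_mono (nhds_le_nhdsSet hy)] with z hz
        simp [hz]
      rw [this.fderiv_eq]
    · simp [hf y hy]
  have e2 (y : E) : g y * (χ y * ψ y) = g y * ψ y := by
    by_cases hy : y ∈ K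
    · rw [(hχ1.filter_mono (nhds_le_nhdsSet hy)).self_of_nhds, one_mul]
    · simp [hg y hy]
  simpa only [e1, e2] using h1

end Mollify

theorem tendsto_integral_mul_of_tendsto_integral_norm_sub {α : Type*} [MeasurableSpace α]
    {μ : Measure α} {F : ℕ → α → ℝ} {f b : α → ℝ} (hF : ∀ k, Integrable (F k) μ)
    (hf : Integrable f μ) (h : Tendsto (fun k => ∫ x, ‖F k x - f x‖ ∂μ) atTop (𝓝 0))
    (hb : AEStronglyMeasurable b μ) {C : ℝ} (hC : ∀ x, ‖b x‖ ≤ C) :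
    Tendsto (fun k => ∫ x, F k x * b x ∂μ) atTop (𝓝 (∫ x, f x * b x ∂μ)) := by
  rw [tendsto_iff_norm_sub_tendsto_zero]
  refine squeeze_zero (fun k => norm_nonneg _) (fun k => ?_) (by simpa using h.mul_const C)
  have h1 (w : α → ℝ) (hw : Integrable w μ) : Integrable (fun x => w x * b x) μ :=
    hw.mul_bdd hb (.of_forall hC)
  rw [← integral_sub (h1 _ (hF k)) (h1 _ hf), ← integral_mul_const]
  refine (norm_integral_le_integral_norm _).trans ?_
  refine integral_mono ((h1 _ (hF k)).sub (h1 _ hf)).norm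
    (((hF k).sub hf).norm.mul_const C) fun x => ?_
  simp only [← sub_mul, norm_mul]
  exact mul_le_mul_of_nonneg_left (hC x) (norm_nonneg _)

section

variable {E : Type*} [NormedAddCommGroup E] [NormedSpace ℝ E] [FiniteDimensional ℝ E]
  [MeasurableSpace E] [BorelSpace E] {μ : Measure E} [μ.IsAddHaarMeasure]
  {Ω : Set E} {f g : E → ℝ} {v : E}

theorem HasWeakDeriv.integrable_mul (h : LocallyIntegrableOn f Ω μ) {b : E → ℝ}
    (hb : Continuous b) (hbc : HasCompactSupport b) (hbΩ : tsupport b ⊆ Ω) :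
    Integrable (fun y => f y * b y) μ := by
  have h1 := (h.mono_set hbΩ).integrableOn_isCompact hbc
  obtain ⟨C, hC⟩ := hb.bounded_above_of_compact_support hbc
  refine (integrableOn_iff_integrable_of_support_subset (s := tsupport b) fun y hy => ?_).1
    (h1.mul_bdd hb.aestronglyMeasurable (.of_forall hC))
  by_contra h2
  exact hy (by simp [image_eq_zero_of_notMem_tsupport h2])

theorem HasWeakDeriv.mul_contDiff (hΩ : IsOpen Ω) (h : HasWeakDeriv μ Ω f g v) {a : E → ℝ}
    (ha : ContDiff ℝ ∞ a) :
    HasWeakDeriv μ Ω (fun y => a y * f y) (fun y => a y * g y + fderiv ℝ a y v * f y) v := by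
  have ha' : Continuous fun y => fderiv ℝ a y v :=
    (ha.continuous_fderiv (by simp)).clm_apply continuous_const
  refine ⟨h.1.continuousOn_mul ha.continuous.continuousOn hΩ.isLocallyClosed,
    (h.2.continuousOn_mul ha.continuous.continuousOn hΩ.isLocallyClosed).add
      (h.1.continuousOn_mul ha'.continuousOn hΩ.isLocallyClosed), fun ψ hψ hc hs => ?_⟩
  have h1 := h.3 (fun y => a y * ψ y) (ha.mul hψ) hc.mul_left (tsupport_mul_subset_right.trans hs)
  have hd (y : E) : fderiv ℝ (fun y => a y * ψ y) y v
      = a y * fderiv ℝ ψ y v + fderiv ℝ a y v * ψ y := by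
    rw [fderiv_fun_mul (ha.differentiable (by simp) y) (hψ.differentiable (by simp) y)]
    simp [mul_comm]
  simp only [hd] at h1
  have hψ' : Continuous fun y => fderiv ℝ ψ y v :=
    (hψ.continuous_fderiv (by simp)).clm_apply continuous_const
  have i1 : Integrable (fun y => f y * (a y * fderiv ℝ ψ y v)) μ :=
    integrable_mul h.1 (ha.continuous.mul hψ') (hc.fderiv_apply ℝ v).mul_left
      (tsupport_mul_subset_right.trans ((tsupport_fderiv_apply_subset ℝ v).trans hs))
  have i2 : Integrable (fun y => f y * (fderiv ℝ a y v * ψ y)) μ :=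
    integrable_mul h.1 (ha'.mul hψ.continuous) hc.mul_left (tsupport_mul_subset_right.trans hs)
  have i3 : Integrable (fun y => g y * (a y * ψ y)) μ :=
    integrable_mul h.2 (ha.continuous.mul hψ.continuous) hc.mul_left
      (tsupport_mul_subset_right.trans hs)
  simp only [mul_add] at h1
  rw [integral_add i1 i2] at h1
  have e1 : ∫ y, a y * f y * fderiv ℝ ψ y v ∂μ = ∫ y, f y * (a y * fderiv ℝ ψ y v) ∂μ := by
    congr with y; ring
  have e2 : ∫ y, (a y * g y + fderiv ℝ a y v * f y) * ψ y ∂μ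
      = ∫ y, g y * (a y * ψ y) ∂μ + ∫ y, f y * (fderiv ℝ a y v * ψ y) ∂μ := by
    rw [← integral_add i3 i2]; congr with y; ring
  rw [e1, e2]; linarith

/-- Multiplying a weakly differentiable function by a cutoff gives a weakly differentiable function
on the whole space. -/
theorem HasWeakDeriv.mul_cutoff (hΩ : IsOpen Ω) (h : HasWeakDeriv μ Ω f g v) {χ : E → ℝ}
    (hχ : ContDiff ℝ ∞ χ) (hχc : HasCompactSupport χ) (hχΩ : tsupport χ ⊆ Ω) :
    HasWeakDeriv μ univ (fun y => χ y * f y) (fun y => χ y * g y + fderiv ℝ χ y v * f y) v := by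
  refine (h.mul_contDiff hΩ hχ).extend hΩ hχc hχΩ (fun y hy => ?_) (fun y hy => ?_)
  · simp [image_eq_zero_of_notMem_tsupport hy]
  · have := image_eq_zero_of_notMem_tsupport
      (fun h => hy (tsupport_fderiv_apply_subset ℝ v h) : y ∉ tsupport (fun y => fderiv ℝ χ y v))
    simp [image_eq_zero_of_notMem_tsupport hy, this]

theorem HasWeakDeriv.integrable_mul_cutoff (h : HasWeakDeriv μ Ω f g v) {χ : E → ℝ}
    (hχ : ContDiff ℝ ∞ χ) (hχc : HasCompactSupport χ) (hχΩ : tsupport χ ⊆ Ω) :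
    Integrable (fun y => χ y * f y) μ ∧
      Integrable (fun y => χ y * g y + fderiv ℝ χ y v * f y) μ := by
  have ha' : Continuous fun y => fderiv ℝ χ y v :=
    (hχ.continuous_fderiv (by simp)).clm_apply continuous_const
  refine ⟨?_, .add ?_ ?_⟩
  · simpa only [mul_comm] using integrable_mul h.1 hχ.continuous hχc hχΩ
  · simpa only [mul_comm] using integrable_mul h.2 hχ.continuous hχc hχΩ
  · simpa only [mul_comm] using integrable_mul h.1 ha' (hχc.fderiv_apply ℝ v)
      ((tsupport_fderiv_apply_subset ℝ v).trans hχΩ)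

/-- Weak derivatives may be tested against compactly supported Lipschitz functions. -/
theorem HasWeakDeriv.integral_lineDeriv_eq (hΩ : IsOpen Ω) (h : HasWeakDeriv μ Ω f g v) {b : E → ℝ}
    {D : ℝ≥0} (hb : LipschitzWith D b) (hbc : HasCompactSupport b) (hbΩ : tsupport b ⊆ Ω) :
    ∫ y, f y * lineDeriv ℝ b y v ∂μ = - ∫ y, g y * b y ∂μ := by
  obtain ⟨χ, hχ, hχc, hχΩ, hχ1⟩ := exists_contDiff_cutoff hbc hΩ hbΩ
  have hw := h.mul_cutoff hΩ hχ hχc hχΩ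
  obtain ⟨if1, ig1⟩ := h.integrable_mul_cutoff hχ hχc hχΩ
  set f₁ := fun y => χ y * f y with hf₁
  set g₁ := fun y => χ y * g y + fderiv ℝ χ y v * f y with hg₁
  obtain ⟨C, hC⟩ := hb.continuous.bounded_above_of_compact_support hbc
  have l1 := tendsto_integral_mul_of_tendsto_integral_norm_sub
    (fun k => integrable_mollify k if1) if1 (tendsto_integral_norm_mollify_sub if1)
    (hb.memLp_lineDeriv (μ := μ) v).1 (fun x => norm_lineDeriv_le_of_lipschitz ℝ hb)
  have l2 := tendsto_integral_mul_of_tendsto_integral_norm_sub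
    (fun k => integrable_mollify k ig1) ig1 (tendsto_integral_norm_mollify_sub ig1)
    hb.continuous.aestronglyMeasurable hC
  have key (k : ℕ) : ∫ y, mollify μ k f₁ y * lineDeriv ℝ b y v ∂μ
      = - ∫ y, mollify μ k g₁ y * b y ∂μ := by
    have hsm := contDiff_mollify k if1.locallyIntegrable
    have hcs : HasCompactSupport f₁ := hχc.mul_right
    obtain ⟨D', hD'⟩ := (hsm.of_le (m := 1) (by simp)).lipschitzWith_of_hasCompactSupport
      (hasCompactSupport_mollify (μ := μ) k hcs) one_ne_zero
    have h1 := hD'.integral_lineDeriv_mul_eq (μ := μ) hb hbc v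
    have h2 (y : E) : lineDeriv ℝ (mollify μ k f₁) y v = mollify μ k g₁ y := by
      rw [← hw.fderiv_mollify, (hsm.differentiable (by simp) y).lineDeriv_eq_fderiv]
    simp only [h2, lineDeriv_neg, neg_mul, integral_neg] at h1
    rw [h1, neg_neg]
    simp only [mul_comm]
  have := tendsto_nhds_unique l1 (by simpa only [key] using l2.neg)
  have e1 (y : E) : f₁ y * lineDeriv ℝ b y v = f y * lineDeriv ℝ b y v := by
    by_cases hy : y ∈ tsupport b
    · simp [hf₁, (hχ1.filter_mono (nhds_le_nhdsSet hy)).self_of_nhds]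
    · have : b =ᶠ[𝓝 y] fun _ => 0 := notMem_tsupport_iff_eventuallyEq.1 hy
      have h3 : lineDeriv ℝ b y v = 0 := by rw [this.lineDeriv_eq]; simp [lineDeriv]
      rw [h3, mul_zero, mul_zero]
  have e2 (y : E) : g₁ y * b y = g y * b y := by
    by_cases hy : y ∈ tsupport b
    · have h3 := hχ1.filter_mono (nhds_le_nhdsSet hy)
      have h4 : fderiv ℝ χ y = 0 := by
        rw [Filter.EventuallyEq.fderiv_eq (f := fun _ => (1 : ℝ)) h3]; simp
      simp [hg₁, h3.self_of_nhds, h4]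
    · simp [image_eq_zero_of_notMem_tsupport hy]
  simpa only [e1, e2] using this

end

section

variable {E : Type*} [NormedAddCommGroup E] [NormedSpace ℝ E] [FiniteDimensional ℝ E]
  [MeasurableSpace E] [BorelSpace E] {μ : Measure E} [μ.IsAddHaarMeasure]
  {Ω : Set E} {f g : E → ℝ} {v : E}

theorem integrableAtFilter_congr {x : E} (h : IntegrableAtFilter f (𝓝[Ω] x) μ)
    (hfg : f =ᶠ[𝓝 x] g) : IntegrableAtFilter g (𝓝[Ω] x) μ := by
  obtain ⟨s, hs, h1⟩ := h
  obtain ⟨t, ht, hto, hxt⟩ := mem_nhds_iff.1 hfg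
  refine ⟨s ∩ t, inter_mem hs (mem_nhdsWithin_of_mem_nhds (hto.mem_nhds hxt)),
    (h1.mono_set inter_subset_left).congr ?_⟩
  filter_upwards [ae_restrict_of_ae_restrict_of_subset (inter_subset_right (s := s))
    (ae_restrict_mem hto.measurableSet)] with y hy using ht hy

/-- Weak differentiability may be checked near compact sets. -/
theorem hasWeakDeriv_of_locally
    (h : ∀ K ⊆ Ω, IsCompact K → ∃ f' g', HasWeakDeriv μ Ω f' g' v ∧
      ∀ᶠ y in 𝓝ˢ K, f y = f' y ∧ g y = g' y) : HasWeakDeriv μ Ω f g v := by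
  refine ⟨fun x hx => ?_, fun x hx => ?_, fun ψ hψ hc hs => ?_⟩
  · obtain ⟨f', g', h1, h2⟩ := h {x} (by simpa using hx) isCompact_singleton
    rw [nhdsSet_singleton] at h2
    exact integrableAtFilter_congr (h1.1 x hx) (h2.mono fun y hy => hy.1.symm)
  · obtain ⟨f', g', h1, h2⟩ := h {x} (by simpa using hx) isCompact_singleton
    rw [nhdsSet_singleton] at h2
    exact integrableAtFilter_congr (h1.2 x hx) (h2.mono fun y hy => hy.2.symm)
  · obtain ⟨f', g', h1, h2⟩ := h (tsupport ψ) hs hc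
    have e1 (y : E) : f y * fderiv ℝ ψ y v = f' y * fderiv ℝ ψ y v := by
      by_cases hy : y ∈ tsupport ψ
      · rw [(h2.filter_mono (nhds_le_nhdsSet hy)).self_of_nhds.1]
      · rw [Filter.EventuallyEq.fderiv_eq (notMem_tsupport_iff_eventuallyEq.1 hy)]
        simp
    have e2 (y : E) : g y * ψ y = g' y * ψ y := by
      by_cases hy : y ∈ tsupport ψ
      · rw [(h2.filter_mono (nhds_le_nhdsSet hy)).self_of_nhds.2]
      · simp [image_eq_zero_of_notMem_tsupport hy]
    simpa only [e1, e2] using h1.3 ψ hψ hc hs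

theorem HasWeakDeriv.add (h : HasWeakDeriv μ Ω f g v) {f' g' : E → ℝ}
    (h' : HasWeakDeriv μ Ω f' g' v) :
    HasWeakDeriv μ Ω (fun y => f y + f' y) (fun y => g y + g' y) v := by
  refine ⟨h.1.add h'.1, h.2.add h'.2, fun ψ hψ hc hs => ?_⟩
  have hψ' : Continuous fun y => fderiv ℝ ψ y v :=
    (hψ.continuous_fderiv (by simp)).clm_apply continuous_const
  have hs' := (tsupport_fderiv_apply_subset ℝ v).trans hs
  simp only [add_mul]
  rw [integral_add (integrable_mul h.1 hψ' (hc.fderiv_apply ℝ v) hs')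
    (integrable_mul h'.1 hψ' (hc.fderiv_apply ℝ v) hs'),
    integral_add (integrable_mul h.2 hψ.continuous hc hs)
    (integrable_mul h'.2 hψ.continuous hc hs), h.3 ψ hψ hc hs, h'.3 ψ hψ hc hs]
  ring

theorem HasWeakDeriv.const (c : ℝ) : HasWeakDeriv μ Ω (fun _ => c) (fun _ => 0) v := by
  refine ⟨(locallyIntegrable_const c).locallyIntegrableOn _,
    (locallyIntegrable_const 0).locallyIntegrableOn _, fun ψ hψ hc hs => ?_⟩
  have hψ' : Continuous fun y => fderiv ℝ ψ y v :=
    (hψ.continuous_fderiv (by simp)).clm_apply continuous_const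
  have := integral_mul_fderiv_eq_neg_fderiv_mul_of_integrable (μ := μ) (f := fun _ : E => c) (g := ψ)
    (v := v) (by simp)
    ((hψ'.integrable_of_hasCompactSupport (hc.fderiv_apply ℝ v)).const_mul c)
    ((hψ.continuous.integrable_of_hasCompactSupport hc).const_mul c)
    (fun x _ => differentiableAt_const c)
    (fun x _ => hψ.differentiable (by simp) x)
  simpa using this

theorem HasWeakDeriv.const_mul (hΩ : IsOpen Ω) (h : HasWeakDeriv μ Ω f g v) (c : ℝ) :
    HasWeakDeriv μ Ω (fun y => c * f y) (fun y => c * g y) v := by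
  simpa using h.mul_contDiff hΩ (contDiff_const (c := c))

/-- A product of Lipschitz functions, one of them compactly supported, is Lipschitz. -/
theorem exists_lipschitzWith_mul {a ψ : E → ℝ} {C D : ℝ≥0} (ha : LipschitzWith C a)
    (hψ : LipschitzWith D ψ) (hc : HasCompactSupport ψ) :
    ∃ D', LipschitzWith D' fun y => a y * ψ y := by
  obtain ⟨B, hB⟩ := hψ.continuous.bounded_above_of_compact_support hc
  obtain ⟨A, hA⟩ := hc.isCompact.exists_bound_of_continuousOn ha.continuous.continuousOn
  have hB0 : 0 ≤ B := (norm_nonneg _).trans (hB 0)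
  have key (x y : E) (hx : x ∈ tsupport ψ) :
      dist (a x * ψ x) (a y * ψ y) ≤ (A * D + B * C) * dist x y := by
    have h1 : a x * ψ x - a y * ψ y = a x * (ψ x - ψ y) + ψ y * (a x - a y) := by ring
    rw [Real.dist_eq, h1]
    refine (abs_add_le _ _).trans ?_
    rw [abs_mul, abs_mul, add_mul, mul_assoc, mul_assoc]
    have h2 := hψ.dist_le_mul x y
    have h3 := ha.dist_le_mul x y
    rw [Real.dist_eq] at h2 h3
    have h4 := hA x hx
    have h5 := hB y
    rw [Real.norm_eq_abs] at h4 h5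
    have := (abs_nonneg _).trans h4
    gcongr
  refine ⟨(|A| * D + B * C).toNNReal, LipschitzWith.of_dist_le_mul fun x y => ?_⟩
  have hle : (A * D + B * C) ≤ ((|A| * D + B * C).toNNReal : ℝ) := by
    refine le_trans ?_ (Real.le_coe_toNNReal _)
    gcongr
    exact le_abs_self A
  by_cases hx : x ∈ tsupport ψ
  · exact (key x y hx).trans (by gcongr)
  by_cases hy : y ∈ tsupport ψ
  · rw [dist_comm, dist_comm x]
    exact (key y x hy).trans (by gcongr)
  · simp only [image_eq_zero_of_notMem_tsupport hx, image_eq_zero_of_notMem_tsupport hy, mul_zero,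
      dist_self]
    positivity

theorem exists_lipschitzWith_eqOn_nhdsSet {a : E → ℝ} (hΩ : IsOpen Ω)
    (ha : LocallyLipschitzOn Ω a) {K : Set E} (hK : IsCompact K) (hKΩ : K ⊆ Ω) :
    ∃ (C : ℝ≥0) (a' : E → ℝ), LipschitzWith C a' ∧ ∀ᶠ y in 𝓝ˢ K, a y = a' y := by
  obtain ⟨L, hL, hKL, hLΩ⟩ := exists_compact_between hK hΩ hKΩ
  obtain ⟨C, hC⟩ := (ha.mono hLΩ).exists_lipschitzOnWith_of_compact hL
  obtain ⟨a', ha', heq⟩ := hC.extend_real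
  exact ⟨C, a', ha', mem_of_superset (subset_interior_iff_mem_nhdsSet.1 hKL) fun y hy => heq hy⟩

theorem HasWeakDeriv.mul_lipschitzWith (hΩ : IsOpen Ω) (h : HasWeakDeriv μ Ω f g v) {a : E → ℝ}
    {C : ℝ≥0} (ha : LipschitzWith C a) :
    HasWeakDeriv μ Ω (fun y => a y * f y) (fun y => a y * g y + lineDeriv ℝ a y v * f y) v := by
  have hbd (y) : ‖lineDeriv ℝ a y v‖ ≤ C * ‖v‖ := norm_lineDeriv_le_of_lipschitz ℝ ha
  have hme : AEStronglyMeasurable (fun y => lineDeriv ℝ a y v) μ := (ha.memLp_lineDeriv v).1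
  refine ⟨h.1.continuousOn_mul ha.continuous.continuousOn hΩ.isLocallyClosed,
    (h.2.continuousOn_mul ha.continuous.continuousOn hΩ.isLocallyClosed).add
      (fun x hx => ?_), fun ψ hψ hc hs => ?_⟩
  · obtain ⟨s, hs, his⟩ := h.1 x hx
    exact ⟨s, hs, his.bdd_mul hme.restrict (.of_forall hbd)⟩
  obtain ⟨D, hD⟩ := (hψ.of_le (m := 1) (by simp)).lipschitzWith_of_hasCompactSupport hc one_ne_zero
  obtain ⟨D', hD'⟩ := exists_lipschitzWith_mul ha hD hc
  have h1 := h.integral_lineDeriv_eq hΩ hD' hc.mul_left (tsupport_mul_subset_right.trans hs)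
  have hd : ∀ᵐ y ∂μ, lineDeriv ℝ (fun y => a y * ψ y) y v
      = a y * fderiv ℝ ψ y v + lineDeriv ℝ a y v * ψ y := by
    filter_upwards [ha.ae_lineDifferentiableAt (μ := μ) v] with y hy
    have h2 := hy.hasLineDerivAt
    have h3 := ((hψ.differentiable (by simp) y).hasFDerivAt).hasLineDerivAt v
    have h4 : HasLineDerivAt ℝ (fun y => a y * ψ y) _ y v := HasDerivAt.mul h2 h3
    rw [h4.lineDeriv]
    simp
    ring
  have hψ' : Continuous fun y => fderiv ℝ ψ y v :=
    (hψ.continuous_fderiv (by simp)).clm_apply continuous_const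
  have i1 : Integrable (fun y => f y * (a y * fderiv ℝ ψ y v)) μ :=
    integrable_mul h.1 (ha.continuous.mul hψ') (hc.fderiv_apply ℝ v).mul_left
      (tsupport_mul_subset_right.trans ((tsupport_fderiv_apply_subset ℝ v).trans hs))
  have i2 : Integrable (fun y => lineDeriv ℝ a y v * (f y * ψ y)) μ :=
    (integrable_mul h.1 hψ.continuous hc hs).bdd_mul hme (.of_forall hbd)
  have i3 : Integrable (fun y => g y * (a y * ψ y)) μ :=
    integrable_mul h.2 (ha.continuous.mul hψ.continuous) hc.mul_left
      (tsupport_mul_subset_right.trans hs)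
  have e0 : ∫ y, f y * lineDeriv ℝ (fun y => a y * ψ y) y v ∂μ
      = ∫ y, f y * (a y * fderiv ℝ ψ y v) ∂μ + ∫ y, lineDeriv ℝ a y v * (f y * ψ y) ∂μ := by
    rw [← integral_add i1 i2]
    refine integral_congr_ae ?_
    filter_upwards [hd] with y hy
    rw [hy]; ring
  have e1 : ∫ y, a y * f y * fderiv ℝ ψ y v ∂μ = ∫ y, f y * (a y * fderiv ℝ ψ y v) ∂μ := by
    congr with y; ring
  have e2 : ∫ y, (a y * g y + lineDeriv ℝ a y v * f y) * ψ y ∂μ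
      = ∫ y, g y * (a y * ψ y) ∂μ + ∫ y, lineDeriv ℝ a y v * (f y * ψ y) ∂μ := by
    rw [← integral_add i3 i2]; congr with y; ring
  rw [e1, e2]; linarith

/-- The product rule for a weakly differentiable and a locally Lipschitz function. -/
theorem HasWeakDeriv.mul_locallyLipschitzOn (hΩ : IsOpen Ω) (h : HasWeakDeriv μ Ω f g v)
    {a : E → ℝ} (ha : LocallyLipschitzOn Ω a) :
    HasWeakDeriv μ Ω (fun y => a y * f y) (fun y => a y * g y + lineDeriv ℝ a y v * f y) v := by
  refine hasWeakDeriv_of_locally fun K hK hKc => ?_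
  obtain ⟨C, a', ha', heq⟩ := exists_lipschitzWith_eqOn_nhdsSet hΩ ha hKc hK
  refine ⟨_, _, h.mul_lipschitzWith hΩ ha', ?_⟩
  obtain ⟨O, hO, hKO, hOe⟩ := eventually_nhdsSet_iff_exists.1 heq
  refine eventually_nhdsSet_iff_exists.2 ⟨O, hO, hKO, fun y hy => ?_⟩
  have h1 : a =ᶠ[𝓝 y] a' := mem_of_superset (hO.mem_nhds hy) hOe
  simp [h1.self_of_nhds, h1.lineDeriv_eq]

theorem HasWeakDeriv.of_locallyLipschitzOn (hΩ : IsOpen Ω) {a : E → ℝ}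
    (ha : LocallyLipschitzOn Ω a) : HasWeakDeriv μ Ω a (fun y => lineDeriv ℝ a y v) v := by
  simpa using (HasWeakDeriv.const (μ := μ) (Ω := Ω) (v := v) 1).mul_locallyLipschitzOn hΩ ha

/-- Rademacher's theorem for locally Lipschitz functions on an open set. -/
theorem ae_differentiableAt_of_locallyLipschitzOn (hΩ : IsOpen Ω) {a : E → ℝ}
    (ha : LocallyLipschitzOn Ω a) : ∀ᵐ y ∂μ, y ∈ Ω → DifferentiableAt ℝ a y := by
  have h1 (x : E) (hx : x ∈ Ω) : ∃ t ∈ 𝓝[Ω] x, μ {y ∈ t | ¬ DifferentiableAt ℝ a y} = 0 := by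
    obtain ⟨C, a', ha', heq⟩ := exists_lipschitzWith_eqOn_nhdsSet hΩ ha (K := {x})
      isCompact_singleton (by simpa using hx)
    rw [nhdsSet_singleton] at heq
    refine ⟨{y | a =ᶠ[𝓝 y] a'}, mem_nhdsWithin_of_mem_nhds (eventually_eventually_nhds.2 heq), ?_⟩
    refine measure_mono_null (fun y hy => ?_) ha'.ae_differentiableAt
    intro h2
    exact hy.2 (h2.congr_of_eventuallyEq hy.1)
  have h3 : μ (Ω ∩ {y | ¬ DifferentiableAt ℝ a y}) = 0 := by
    refine measure_null_of_locally_null _ fun x hx => ?_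
    obtain ⟨t, ht, h0⟩ := h1 x hx.1
    exact ⟨t ∩ (Ω ∩ {y | ¬ DifferentiableAt ℝ a y}),
      inter_mem (nhdsWithin_mono _ inter_subset_left ht) self_mem_nhdsWithin,
      measure_mono_null (show _ ⊆ {y ∈ t | ¬ DifferentiableAt ℝ a y} from
        fun y hy => ⟨hy.1, hy.2.2⟩) h0⟩
  refine measure_mono_null (fun y hy => ?_) h3
  simpa using hy

/-- Weak derivatives are unique. -/
theorem HasWeakDeriv.ae_eq (hΩ : IsOpen Ω) (h : HasWeakDeriv μ Ω f g v) {g' : E → ℝ}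
    (h' : HasWeakDeriv μ Ω f g' v) : ∀ᵐ y ∂μ, y ∈ Ω → g y = g' y := by
  have := hΩ.ae_eq_zero_of_integral_contDiff_smul_eq_zero (h.2.sub h'.2) fun ψ hψ hc hs => by
    have h1 := h.3 ψ hψ hc hs
    rw [h'.3 ψ hψ hc hs, neg_inj] at h1
    simp only [smul_eq_mul, Pi.sub_apply, mul_comm (ψ _), sub_mul]
    rw [integral_sub (integrable_mul h.2 hψ.continuous hc hs)
      (integrable_mul h'.2 hψ.continuous hc hs), h1, sub_self]
  filter_upwards [this] with y hy hyΩ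
  simpa [sub_eq_zero] using hy hyΩ

end

section

variable {E : Type*} [NormedAddCommGroup E] [NormedSpace ℝ E] [FiniteDimensional ℝ E]
  [MeasurableSpace E] [BorelSpace E] {μ : Measure E} [μ.IsAddHaarMeasure]
  {Ω : Set E} {f g : E → ℝ} {v : E}

theorem HasWeakDeriv.comp_of_zero (hΩ : IsOpen Ω) (h : HasWeakDeriv μ Ω f g v) {T κ : ℝ → ℝ}
    (hT : ∀ t, HasDerivAt T (κ t) t) (hκ : Continuous κ) {C : ℝ} (hC : ∀ t, ‖κ t‖ ≤ C)
    (hT0 : T 0 = 0) : HasWeakDeriv μ Ω (fun y => T (f y)) (fun y => κ (f y) * g y) v := by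
  have hTc : Continuous T := continuous_iff_continuousAt.2 fun t => (hT t).continuousAt
  have hC0 : 0 ≤ C := (norm_nonneg _).trans (hC 0)
  have hlip (s t : ℝ) : ‖T s - T t‖ ≤ C * ‖s - t‖ :=
    Convex.norm_image_sub_le_of_norm_hasDerivWithin_le (s := univ)
      (fun x _ => (hT x).hasDerivWithinAt) (fun x _ => hC x) convex_univ (mem_univ _) (mem_univ _)
  have hle (t : ℝ) : ‖T t‖ ≤ C * ‖t‖ := by simpa [hT0] using hlip t 0
  have hint {w : E → ℝ} (hw : Integrable w μ) : Integrable (fun y => T (w y)) μ :=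
    (hw.norm.const_mul C).mono' (hTc.comp_aestronglyMeasurable hw.1) (.of_forall fun y => hle _)
  refine ⟨fun x hx => ?_, fun x hx => ?_, fun ψ hψ hc hs => ?_⟩
  · obtain ⟨s, hs, h1⟩ := h.1 x hx
    exact ⟨s, hs, (h1.norm.const_mul C).mono' (hTc.comp_aestronglyMeasurable h1.1)
      (.of_forall fun y => hle _)⟩
  · obtain ⟨s, hs, h1⟩ := h.1 x hx
    obtain ⟨s', hs', h2⟩ := h.2 x hx
    refine ⟨s ∩ s', inter_mem hs hs', (h2.mono_set inter_subset_right).bdd_mul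
      (hκ.comp_aestronglyMeasurable (h1.mono_set inter_subset_left).1)
      (.of_forall fun y => hC _)⟩
  obtain ⟨χ, hχ, hχc, hχΩ, hχ1⟩ := exists_contDiff_cutoff hc hΩ hs
  have hw := h.mul_cutoff hΩ hχ hχc hχΩ
  obtain ⟨if1, ig1⟩ := h.integrable_mul_cutoff hχ hχc hχΩ
  set f₁ := fun y => χ y * f y with hf₁
  set g₁ := fun y => χ y * g y + fderiv ℝ χ y v * f y with hg₁
  have e1 (y : E) (hy : y ∈ tsupport ψ) : f₁ y = f y := by
    simp [hf₁, (hχ1.filter_mono (nhds_le_nhdsSet hy)).self_of_nhds]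
  have e2 (y : E) (hy : y ∈ tsupport ψ) : g₁ y = g y := by
    have h3 := hχ1.filter_mono (nhds_le_nhdsSet hy)
    have h4 : fderiv ℝ χ y = 0 := by
      rw [Filter.EventuallyEq.fderiv_eq (f := fun _ => (1 : ℝ)) h3]; simp
    simp [hg₁, h3.self_of_nhds, h4]
  have hψ' : Continuous fun y => fderiv ℝ ψ y v :=
    (hψ.continuous_fderiv (by simp)).clm_apply continuous_const
  have hψc' : HasCompactSupport fun y => fderiv ℝ ψ y v := hc.fderiv_apply ℝ v
  obtain ⟨A, hA⟩ := hψ'.bounded_above_of_compact_support hψc'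
  obtain ⟨B, hB⟩ := hψ.continuous.bounded_above_of_compact_support hc
  have hB0 : 0 ≤ B := (norm_nonneg _).trans (hB 0)
  have hm (k : ℕ) : Continuous (mollify μ k f₁) :=
    (contDiff_mollify k if1.locallyIntegrable).continuous
  have l1 : Tendsto (fun k => ∫ y, T (mollify μ k f₁ y) * fderiv ℝ ψ y v ∂μ) atTop
      (𝓝 (∫ y, T (f₁ y) * fderiv ℝ ψ y v ∂μ)) := by
    refine tendsto_integral_mul_of_tendsto_integral_norm_sub
      (fun k => hint (integrable_mollify k if1)) (hint if1) ?_ hψ'.aestronglyMeasurable hA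
    refine squeeze_zero (fun k => integral_nonneg fun y => norm_nonneg _) (fun k => ?_)
      (by simpa using (tendsto_integral_norm_mollify_sub if1).const_mul C)
    rw [← integral_const_mul]
    exact integral_mono ((hint (integrable_mollify k if1)).sub (hint if1)).norm
      (((integrable_mollify k if1).sub if1).norm.const_mul C) fun y => hlip _ _
  have l2 : Tendsto (fun k => ∫ y, mollify μ k g₁ y * (κ (mollify μ k f₁ y) * ψ y) ∂μ) atTop
      (𝓝 (∫ y, g₁ y * (κ (f₁ y) * ψ y) ∂μ)) := by
    have hb (k) (y) : ‖κ (mollify μ k f₁ y) * ψ y‖ ≤ C * B := by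
      rw [norm_mul]
      have := hC (mollify μ k f₁ y)
      have := hB y
      gcongr
    have hbm (k) : AEStronglyMeasurable (fun y => κ (mollify μ k f₁ y) * ψ y) μ :=
      ((hκ.comp (hm k)).mul hψ.continuous).aestronglyMeasurable
    have m1 : Tendsto (fun k => ∫ y, g₁ y * (κ (mollify μ k f₁ y) * ψ y) ∂μ) atTop
        (𝓝 (∫ y, g₁ y * (κ (f₁ y) * ψ y) ∂μ)) := by
      refine tendsto_integral_of_dominated_convergence (fun y => ‖g₁ y‖ * (C * B))
        (fun k => ig1.1.mul (hbm k)) (ig1.norm.mul_const _) (fun k => .of_forall fun y => ?_) ?_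
      · rw [norm_mul]
        gcongr
        exact hb k y
      · filter_upwards [ae_tendsto_mollify if1.locallyIntegrable] with y hy
        exact (((hκ.tendsto _).comp hy).mul_const _).const_mul _
    have m2 : Tendsto (fun k => ∫ y, (mollify μ k g₁ y - g₁ y) * (κ (mollify μ k f₁ y) * ψ y) ∂μ)
        atTop (𝓝 0) := by
      rw [tendsto_zero_iff_norm_tendsto_zero]
      refine squeeze_zero (fun k => norm_nonneg _) (fun k => ?_)
        (by simpa using (tendsto_integral_norm_mollify_sub ig1).mul_const (C * B))
      rw [← integral_mul_const]
      refine norm_integral_le_of_norm_le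
        (((integrable_mollify k ig1).sub ig1).norm.mul_const _) (.of_forall fun y => ?_)
      rw [norm_mul]
      exact mul_le_mul_of_nonneg_left (hb k y) (norm_nonneg _)
    have m3 := m1.add m2
    rw [add_zero] at m3
    refine m3.congr fun k => ?_
    have i2 : Integrable (fun y => (mollify μ k g₁ y - g₁ y) * (κ (mollify μ k f₁ y) * ψ y)) μ :=
      ((integrable_mollify k ig1).sub ig1).mul_bdd (hbm k) (.of_forall (hb k))
    rw [← integral_add (ig1.mul_bdd (hbm k) (.of_forall (hb k))) i2]
    congr with y; ring
  have key (k : ℕ) : ∫ y, T (mollify μ k f₁ y) * fderiv ℝ ψ y v ∂μ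
      = - ∫ y, mollify μ k g₁ y * (κ (mollify μ k f₁ y) * ψ y) ∂μ := by
    have hsm := contDiff_mollify k if1.locallyIntegrable
    have hgm := contDiff_mollify k ig1.locallyIntegrable
    have hd (y) : HasFDerivAt (fun y => T (mollify μ k f₁ y)) _ y :=
      (hT (mollify μ k f₁ y)).comp_hasFDerivAt y (hsm.differentiable (by simp) y).hasFDerivAt
    have hd' (y) : fderiv ℝ (fun y => T (mollify μ k f₁ y)) y v
        = mollify μ k g₁ y * κ (mollify μ k f₁ y) := by
      rw [(hd y).fderiv, ← hw.fderiv_mollify]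
      simp [mul_comm]
    have := integral_mul_fderiv_eq_neg_fderiv_mul_of_integrable (μ := μ)
      (f := fun y => T (mollify μ k f₁ y)) (g := ψ) (v := v)
      (by
        simp only [hd']
        exact ((hgm.continuous.mul (hκ.comp (hm k))).mul hψ.continuous).integrable_of_hasCompactSupport
          hc.mul_left)
      (((hTc.comp (hm k)).mul hψ').integrable_of_hasCompactSupport hψc'.mul_left)
      (((hTc.comp (hm k)).mul hψ.continuous).integrable_of_hasCompactSupport hc.mul_left)
      (fun y _ => (hd y).differentiableAt) (fun y _ => hψ.differentiable (by simp) y)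
    simpa only [hd', mul_assoc] using this
  have fin := tendsto_nhds_unique l1 (by simpa only [key] using l2.neg)
  have e3 (y : E) : T (f₁ y) * fderiv ℝ ψ y v = T (f y) * fderiv ℝ ψ y v := by
    by_cases hy : y ∈ tsupport ψ
    · rw [e1 y hy]
    · rw [Filter.EventuallyEq.fderiv_eq (notMem_tsupport_iff_eventuallyEq.1 hy)]
      simp
  have e4 (y : E) : g₁ y * (κ (f₁ y) * ψ y) = κ (f y) * g y * ψ y := by
    by_cases hy : y ∈ tsupport ψ
    · rw [e1 y hy, e2 y hy]; ring
    · simp [image_eq_zero_of_notMem_tsupport hy]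
  simpa only [e3, e4] using fin

/-- The chain rule for a weakly differentiable function and a function of class `C¹` with bounded
derivative. -/
theorem HasWeakDeriv.comp (hΩ : IsOpen Ω) (h : HasWeakDeriv μ Ω f g v) {T κ : ℝ → ℝ}
    (hT : ∀ t, HasDerivAt T (κ t) t) (hκ : Continuous κ) {C : ℝ} (hC : ∀ t, ‖κ t‖ ≤ C) :
    HasWeakDeriv μ Ω (fun y => T (f y)) (fun y => κ (f y) * g y) v := by
  have h1 := (h.comp_of_zero hΩ (fun t => (hT t).sub_const (T 0)) hκ hC (sub_self _)).add
    (HasWeakDeriv.const (T 0))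
  simpa using h1

/-- The weak derivative vanishes almost everywhere on the zero set of the function. -/
theorem HasWeakDeriv.ae_eq_zero (hΩ : IsOpen Ω) (h : HasWeakDeriv μ Ω f g v) :
    ∀ᵐ y ∂μ, y ∈ Ω → f y = 0 → g y = 0 := by
  classical
  set κ : ℕ → ℝ → ℝ := fun j t => 1 / (1 + (((j : ℝ) + 1) * t) ^ 2) with hκ
  have hκc (j) : Continuous (κ j) := by
    refine continuous_const.div (by fun_prop) fun t => ?_
    positivity
  have hκ1 (j t) : ‖κ j t‖ ≤ 1 := by
    rw [Real.norm_of_nonneg (by positivity)]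
    exact div_le_one_of_le₀ (by nlinarith [sq_nonneg (((j : ℝ) + 1) * t)]) (by positivity)
  have hT (j : ℕ) (t : ℝ) :
      HasDerivAt (fun t => 1 / ((j : ℝ) + 1) * Real.arctan (((j : ℝ) + 1) * t)) (κ j t) t := by
    have h1 := (((hasDerivAt_id t).const_mul ((j : ℝ) + 1)).arctan).const_mul (1 / ((j : ℝ) + 1))
    refine h1.congr_deriv ?_
    simp only [hκ, id]
    field_simp
  have hlim (t : ℝ) : Tendsto (fun j => κ j t) atTop (𝓝 (if t = 0 then 1 else 0)) := by
    split_ifs with ht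
    · simp [hκ, ht]
    · have h1 : Tendsto (fun j : ℕ => 1 + (((j : ℝ) + 1) * t) ^ 2) atTop atTop := by
        refine tendsto_atTop_add_const_left _ _ ?_
        simp only [mul_pow]
        refine Tendsto.atTop_mul_const (by positivity) ?_
        exact (tendsto_pow_atTop two_ne_zero).comp
          (tendsto_atTop_add_const_right _ _ tendsto_natCast_atTop_atTop)
      simp only [hκ, one_div]
      exact h1.inv_tendsto_atTop
  have hw : HasWeakDeriv μ Ω (fun _ => (0 : ℝ)) (fun y => (if f y = 0 then 1 else 0) * g y) v := by
    have hloc : LocallyIntegrableOn (fun y => (if f y = 0 then 1 else 0) * g y) Ω μ := by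
      intro x hx
      obtain ⟨s, hs, h1⟩ := h.1 x hx
      obtain ⟨s', hs', h2⟩ := h.2 x hx
      have h1' := (h1.mono_set (inter_subset_left (t := s'))).1
      have h2' := h2.mono_set (inter_subset_right (s := s))
      refine ⟨s ∩ s', inter_mem hs hs', h2'.bdd_mul (c := 1) ?_ (.of_forall fun y => ?_)⟩
      · exact aestronglyMeasurable_of_tendsto_ae atTop
          (fun j => (hκc j).comp_aestronglyMeasurable h1') (.of_forall fun y => hlim _)
      · split_ifs <;> simp
    refine ⟨(HasWeakDeriv.const (v := v) 0).1, hloc, fun ψ hψ hc hs => ?_⟩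
    have hψ' : Continuous fun y => fderiv ℝ ψ y v :=
      (hψ.continuous_fderiv (by simp)).clm_apply continuous_const
    have hψc' : HasCompactSupport fun y => fderiv ℝ ψ y v := hc.fderiv_apply ℝ v
    have hsΩ' := (tsupport_fderiv_apply_subset ℝ v).trans hs
    have hcw (j) := h.comp hΩ (hT j) (hκc j) (hκ1 j)
    have l1 : Tendsto (fun j : ℕ => ∫ y, 1 / ((j : ℝ) + 1) * Real.arctan (((j : ℝ) + 1) * f y)
        * fderiv ℝ ψ y v ∂μ) atTop (𝓝 (∫ y, 0 * fderiv ℝ ψ y v ∂μ)) := by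
      have hb (j : ℕ) (y) : ‖1 / ((j : ℝ) + 1) * Real.arctan (((j : ℝ) + 1) * f y)‖
          ≤ 1 / ((j : ℝ) + 1) * (Real.pi / 2) := by
        rw [norm_mul, Real.norm_of_nonneg (by positivity)]
        gcongr
        rw [Real.norm_eq_abs, abs_le]
        exact ⟨(Real.neg_pi_div_two_lt_arctan _).le, (Real.arctan_lt_pi_div_two _).le⟩
      have h0 : Tendsto (fun j : ℕ => 1 / ((j : ℝ) + 1) * (Real.pi / 2)) atTop (𝓝 0) := by
        simpa using tendsto_one_div_add_atTop_nhds_zero_nat.mul_const (Real.pi / 2)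
      refine tendsto_integral_of_dominated_convergence (fun y => (Real.pi / 2) * ‖fderiv ℝ ψ y v‖)
        (fun j => (integrable_mul (hcw j).1 hψ' hψc' hsΩ').1)
        ((hψ'.integrable_of_hasCompactSupport hψc').norm.const_mul _)
        (fun j => .of_forall fun y => ?_) (.of_forall fun y => ?_)
      · rw [norm_mul]
        gcongr
        refine (hb j y).trans ?_
        refine mul_le_of_le_one_left (by positivity) (div_le_one_of_le₀ ?_ (by positivity))
        linarith [(Nat.cast_nonneg j : (0 : ℝ) ≤ j)]
      · exact (squeeze_zero_norm (fun j => hb j y) h0).mul_const _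
    have l2 : Tendsto (fun j => ∫ y, κ j (f y) * g y * ψ y ∂μ) atTop
        (𝓝 (∫ y, (if f y = 0 then 1 else 0) * g y * ψ y ∂μ)) := by
      refine tendsto_integral_of_dominated_convergence (fun y => ‖g y * ψ y‖)
        (fun j => (integrable_mul (hcw j).2 hψ.continuous hc hs).1)
        (integrable_mul h.2 hψ.continuous hc hs).norm
        (fun j => .of_forall fun y => ?_) (.of_forall fun y => ?_)
      · rw [mul_assoc, norm_mul]
        exact mul_le_of_le_one_left (norm_nonneg _) (hκ1 _ _)
      · exact ((hlim _).mul_const _).mul_const _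
    refine tendsto_nhds_unique l1 ?_
    have hk (j) := (hcw j).3 ψ hψ hc hs
    simpa only [hk] using l2.neg
  filter_upwards [hw.ae_eq hΩ (HasWeakDeriv.const 0)] with y hy hyΩ hfy
  simpa [hfy] using hy hyΩ

/-- In dimension at least two, points are removable for bounded weakly differentiable functions. -/
theorem HasWeakDeriv.of_sdiff_singleton (hn : 2 ≤ Module.finrank ℝ E) {c : E}
    (h : HasWeakDeriv μ (Ω \ {c}) f g v) (hf : LocallyIntegrableOn f Ω μ)
    (hg : LocallyIntegrableOn g Ω μ) {C : ℝ} (hC : ∀ y ∈ Ω, ‖f y‖ ≤ C) :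
    HasWeakDeriv μ Ω f g v := by
  refine ⟨hf, hg, fun ψ hψ hc hs => ?_⟩
  have : Nontrivial E := Module.nontrivial_of_finrank_pos (R := ℝ) (by omega)
  have hψ' : Continuous fun y => fderiv ℝ ψ y v :=
    (hψ.continuous_fderiv (by simp)).clm_apply continuous_const
  have hψc' : HasCompactSupport fun y => fderiv ℝ ψ y v := hc.fderiv_apply ℝ v
  have hsΩ' := (tsupport_fderiv_apply_subset ℝ v).trans hs
  obtain ⟨B, hB⟩ := hψ.continuous.bounded_above_of_compact_support hc
  have hB0 : 0 ≤ B := (norm_nonneg _).trans (hB 0)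
  obtain ⟨β, hβ, hβc, hβ0, hβ1, hβz, hβe⟩ : ∃ β : E → ℝ, ContDiff ℝ ∞ β ∧ HasCompactSupport β ∧
      (∀ y, 0 ≤ β y) ∧ (∀ y, β y ≤ 1) ∧ (∀ y, 2 ≤ ‖y‖ → β y = 0) ∧ β =ᶠ[𝓝 0] fun _ => 1 := by
    let β : ContDiffBump (0 : E) := ⟨1, 2, one_pos, one_lt_two⟩
    exact ⟨β, β.contDiff, β.hasCompactSupport, fun _ => β.nonneg, fun _ => β.le_one,
      fun y hy => β.zero_of_le_dist (by simpa [dist_zero_right] using hy), β.eventuallyEq_one⟩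
  set χ : ℕ → E → ℝ := fun j y => β (((j : ℝ) + 1) • (y - c)) with hχ
  have hχs (j) : ContDiff ℝ ∞ (χ j) :=
    hβ.comp (contDiff_const.smul (contDiff_id.sub contDiff_const))
  have hχd (j y) : fderiv ℝ (χ j) y v
      = ((j : ℝ) + 1) * fderiv ℝ β (((j : ℝ) + 1) • (y - c)) v := by
    have h0 : HasFDerivAt (fun y : E => ((j : ℝ) + 1) • (y - c))
        (((j : ℝ) + 1) • ContinuousLinearMap.id ℝ E) y :=
      ((hasFDerivAt_id y).sub_const c).const_smul ((j : ℝ) + 1)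
    have h1 : HasFDerivAt (χ j) _ y :=
      (hβ.differentiable (by simp) (((j : ℝ) + 1) • (y - c))).hasFDerivAt.comp y h0
    rw [h1.fderiv]; simp
  have hχ01 (j y) : ‖1 - χ j y‖ ≤ 1 := by
    have h1 : 0 ≤ χ j y := hβ0 _
    have h2 : χ j y ≤ 1 := hβ1 _
    rw [Real.norm_of_nonneg (by linarith)]; linarith
  have hχlim {y : E} (hy : y ≠ c) : Tendsto (fun j => 1 - χ j y) atTop (𝓝 1) := by
    have h0 : 0 < ‖y - c‖ := norm_pos_iff.2 (sub_ne_zero.2 hy)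
    have h1 : Tendsto (fun j : ℕ => ((j : ℝ) + 1) * ‖y - c‖) atTop atTop :=
      (tendsto_atTop_add_const_right _ _ tendsto_natCast_atTop_atTop).atTop_mul_const h0
    refine tendsto_const_nhds.congr' ?_
    filter_upwards [h1.eventually_ge_atTop 2] with j hj
    have : χ j y = 0 := hβz _ (by
      rw [norm_smul, Real.norm_of_nonneg (by positivity)]; exact hj)
    rw [this, sub_zero]
  have hne : ∀ᵐ y ∂μ, y ≠ c := by simp [ae_iff, measure_singleton]
  have l1 : Tendsto (fun j => ∫ y, f y * fderiv ℝ ψ y v * (1 - χ j y) ∂μ) atTop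
      (𝓝 (∫ y, f y * fderiv ℝ ψ y v ∂μ)) := by
    have hi := integrable_mul hf hψ' hψc' hsΩ'
    refine tendsto_integral_of_dominated_convergence (fun y => ‖f y * fderiv ℝ ψ y v‖)
      (fun j => hi.1.mul (continuous_const.sub (hχs j).continuous).aestronglyMeasurable) hi.norm
      (fun j => .of_forall fun y => ?_) ?_
    · rw [norm_mul]; exact mul_le_of_le_one_right (norm_nonneg _) (hχ01 _ _)
    · filter_upwards [hne] with y hy
      simpa using (hχlim hy).const_mul (f y * fderiv ℝ ψ y v)
  have l2 : Tendsto (fun j => ∫ y, g y * ψ y * (1 - χ j y) ∂μ) atTop (𝓝 (∫ y, g y * ψ y ∂μ)) := by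
    have hi := integrable_mul hg hψ.continuous hc hs
    refine tendsto_integral_of_dominated_convergence (fun y => ‖g y * ψ y‖)
      (fun j => hi.1.mul (continuous_const.sub (hχs j).continuous).aestronglyMeasurable) hi.norm
      (fun j => .of_forall fun y => ?_) ?_
    · rw [norm_mul]; exact mul_le_of_le_one_right (norm_nonneg _) (hχ01 _ _)
    · filter_upwards [hne] with y hy
      simpa using (hχlim hy).const_mul (g y * ψ y)
  have hβ' : Continuous fun y => fderiv ℝ β y v :=
    (hβ.continuous_fderiv (by simp)).clm_apply continuous_const
  have hβi : Integrable (fun y => ‖fderiv ℝ β y v‖) μ :=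
    (hβ'.integrable_of_hasCompactSupport (hβc.fderiv_apply ℝ v)).norm
  have l3 : Tendsto (fun j => ∫ y, f y * (ψ y * fderiv ℝ (χ j) y v) ∂μ) atTop (𝓝 0) := by
    have hbd (j : ℕ) : ‖∫ y, f y * (ψ y * fderiv ℝ (χ j) y v) ∂μ‖
        ≤ (|C| * B) * (∫ y, ‖fderiv ℝ β y v‖ ∂μ) * (1 / ((j : ℝ) + 1)) := by
      have hj : (0 : ℝ) < (j : ℝ) + 1 := by positivity
      have hi1 : Integrable (fun y => ‖fderiv ℝ β (((j : ℝ) + 1) • (y - c)) v‖) μ :=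
        (hβi.comp_smul hj.ne').comp_sub_right c
      refine (norm_integral_le_of_norm_le
        (hi1.const_mul (|C| * B * ((j : ℝ) + 1))) (.of_forall fun y => ?_)).trans ?_
      · rw [hχd, norm_mul, norm_mul, norm_mul, Real.norm_of_nonneg hj.le]
        by_cases hy : y ∈ Ω
        · have h1 := hC y hy
          have h2 := hB y
          have h3 := h1.trans (le_abs_self C)
          calc _ ≤ |C| * (B * ((j + 1) * ‖fderiv ℝ β (((j : ℝ) + 1) • (y - c)) v‖)) := by gcongr
            _ = _ := by ring
        · have h0 : ψ y = 0 := image_eq_zero_of_notMem_tsupport fun h => hy (hs h)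
          simp only [h0, norm_zero, zero_mul, mul_zero]
          positivity
      · rw [integral_const_mul, integral_sub_right_eq_self
          (fun y => ‖fderiv ℝ β (((j : ℝ) + 1) • y) v‖) c,
          Measure.integral_comp_smul μ (fun y => ‖fderiv ℝ β y v‖), smul_eq_mul,
          abs_of_nonneg (show 0 ≤ (((j : ℝ) + 1) ^ Module.finrank ℝ E)⁻¹ by positivity)]
        have h1 : ((j : ℝ) + 1) ^ 2 ≤ ((j : ℝ) + 1) ^ Module.finrank ℝ E :=
          pow_le_pow_right₀ (by linarith [(Nat.cast_nonneg j : (0 : ℝ) ≤ j)]) hn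
        have h2 : ((j : ℝ) + 1) * (((j : ℝ) + 1) ^ Module.finrank ℝ E)⁻¹ ≤ 1 / ((j : ℝ) + 1) := by
          rw [← div_eq_mul_inv, div_le_div_iff₀ (by positivity) hj]
          linarith
        have h3 : 0 ≤ ∫ y, ‖fderiv ℝ β y v‖ ∂μ := integral_nonneg fun y => norm_nonneg _
        calc _ = (|C| * B * ∫ y, ‖fderiv ℝ β y v‖ ∂μ)
              * (((j : ℝ) + 1) * (((j : ℝ) + 1) ^ Module.finrank ℝ E)⁻¹) := by ring
          _ ≤ _ := by gcongr
    refine squeeze_zero_norm hbd ?_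
    simpa using tendsto_one_div_add_atTop_nhds_zero_nat.const_mul
      ((|C| * B) * (∫ y, ‖fderiv ℝ β y v‖ ∂μ))
  have key (j : ℕ) : ∫ y, f y * fderiv ℝ ψ y v * (1 - χ j y) ∂μ
      - ∫ y, f y * (ψ y * fderiv ℝ (χ j) y v) ∂μ = - ∫ y, g y * ψ y * (1 - χ j y) ∂μ := by
    have hj : (0 : ℝ) < (j : ℝ) + 1 := by positivity
    have hsub : ContDiff ℝ ∞ fun y => 1 - χ j y := contDiff_const.sub (hχs j)
    have hcK : c ∉ tsupport fun y => ψ y * (1 - χ j y) := by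
      rw [notMem_tsupport_iff_eventuallyEq]
      have h0 : Tendsto (fun y : E => ((j : ℝ) + 1) • (y - c)) (𝓝 c) (𝓝 0) :=
        Continuous.tendsto' (by fun_prop) _ _ (by simp)
      filter_upwards [h0.eventually hβe] with y hy
      simp [hχ, hy]
    have h1 := h.3 (fun y => ψ y * (1 - χ j y)) (hψ.mul hsub) hc.mul_right
      fun y hy => ⟨hs (tsupport_mul_subset_left hy), fun h => hcK (h ▸ hy)⟩
    have hd (y) : fderiv ℝ (fun y => ψ y * (1 - χ j y)) y v
        = fderiv ℝ ψ y v * (1 - χ j y) - ψ y * fderiv ℝ (χ j) y v := by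
      rw [fderiv_fun_mul (hψ.differentiable (by simp) y) (hsub.differentiable (by simp) y),
        fderiv_fun_sub (differentiableAt_const _) ((hχs j).differentiable (by simp) y)]
      simp
      ring
    have hχ' : Continuous fun y => fderiv ℝ (χ j) y v :=
      ((hχs j).continuous_fderiv (by simp)).clm_apply continuous_const
    rw [← integral_sub]
    · convert h1 using 1
      · congr with y; rw [hd]; ring
      · congr 2 with y; ring
    · simp only [mul_assoc]
      exact integrable_mul hf (hψ'.mul hsub.continuous) hψc'.mul_right
        (tsupport_mul_subset_left.trans hsΩ')
    · exact integrable_mul hf (hψ.continuous.mul hχ') hc.mul_right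
        (tsupport_mul_subset_left.trans hs)
  have := (l1.sub l3)
  simp only [key, sub_zero] at this
  exact tendsto_nhds_unique this l2.neg

/-- A weakly differentiable function that vanishes where `z < ε` may be multiplied by the sign of a
continuous function `w` that vanishes only where `z < ε`. -/
theorem HasWeakDeriv.sign_mul (hΩ : IsOpen Ω) (h : HasWeakDeriv μ Ω f g v) {w z : E → ℝ} {ε : ℝ}
    (hw : ContinuousOn w Ω) (hz : ContinuousOn z Ω) (hwz : ∀ y ∈ Ω, w y = 0 → z y < ε)
    (hf : ∀ y ∈ Ω, z y < ε → f y = 0) (hg : ∀ y ∈ Ω, z y < ε → g y = 0) :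
    HasWeakDeriv μ Ω (fun y => Real.sign (w y) * f y) (fun y => Real.sign (w y) * g y) v := by
  refine hasWeakDeriv_of_locally fun K hK hKc => ?_
  obtain ⟨L, hL, hKL, hLΩ⟩ := exists_compact_between hKc hΩ hK
  have hcpt (w' : E → ℝ) (hw' : ContinuousOn w' Ω) : IsCompact (L ∩ (z ⁻¹' Ici ε ∩ w' ⁻¹' Ici 0)) := by
    have h1 := (hz.mono hLΩ).preimage_isClosed_of_isClosed hL.isClosed (isClosed_Ici (a := ε))
    have h2 := (hw'.mono hLΩ).preimage_isClosed_of_isClosed hL.isClosed (isClosed_Ici (a := 0))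
    refine hL.of_isClosed_subset ?_ inter_subset_left
    convert h1.inter h2 using 1
    ext; simp; tauto
  have hopen (w' : E → ℝ) (hw' : ContinuousOn w' Ω) : IsOpen (Ω ∩ w' ⁻¹' Ioi 0) :=
    hw'.isOpen_inter_preimage hΩ isOpen_Ioi
  have hcut (w' : E → ℝ) (hw' : ContinuousOn w' Ω) (hwz' : ∀ y ∈ Ω, w' y = 0 → z y < ε) :=
    exists_contDiff_cutoff (hcpt w' hw') (hopen w' hw') fun y hy => ⟨hLΩ hy.1,
      lt_of_le_of_ne hy.2.2 fun h0 => (hwz' y (hLΩ hy.1) h0.symm).not_ge hy.2.1⟩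
  obtain ⟨χ₁, s1, -, t1, e1⟩ := hcut w hw hwz
  obtain ⟨χ₂, s2, -, t2, e2⟩ := hcut (fun y => - w y) hw.neg fun y hy h0 => hwz y hy (by simpa using h0)
  refine ⟨_, _, h.mul_contDiff hΩ (s1.sub s2), eventually_nhdsSet_iff_exists.2
    ⟨interior L, isOpen_interior, hKL, fun y hy => ?_⟩⟩
  have hyL := interior_subset hy
  by_cases hzy : z y < ε
  · simp [hf y (hLΩ hyL) hzy, hg y (hLΩ hyL) hzy]
  suffices (fun y => χ₁ y - χ₂ y) =ᶠ[𝓝 y] fun _ => Real.sign (w y) by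
    simp [this.fderiv_eq, this.self_of_nhds]
  rcases lt_trichotomy (w y) 0 with h0 | h0 | h0
  · have a2 := e2.filter_mono (nhds_le_nhdsSet
      (show y ∈ L ∩ (z ⁻¹' Ici ε ∩ (fun y => - w y) ⁻¹' Ici 0) from
        ⟨hyL, not_lt.1 hzy, by simpa using h0.le⟩))
    have a1 : χ₁ =ᶠ[𝓝 y] 0 := notMem_tsupport_iff_eventuallyEq.1
      fun h1 => absurd (t1 h1).2 (by simpa using h0.le)
    filter_upwards [a1, a2] with x h1 h2
    simp [h1, h2, Real.sign_of_neg h0]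
  · exact absurd (hwz y (hLΩ hyL) h0) hzy
  · have a1 := e1.filter_mono (nhds_le_nhdsSet
      (show y ∈ L ∩ (z ⁻¹' Ici ε ∩ w ⁻¹' Ici 0) from ⟨hyL, not_lt.1 hzy, h0.le⟩))
    have a2 : χ₂ =ᶠ[𝓝 y] 0 := notMem_tsupport_iff_eventuallyEq.1
      fun h1 => absurd (t2 h1).2 (by simpa using h0.le)
    filter_upwards [a1, a2] with x h1 h2
    simp [h1, h2, Real.sign_of_pos h0]

end

section

variable {n : ℕ} {M : Type*} [EMetricSpace M] [ChartedSpace (EuclideanSpace ℝ (Fin n)) M]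
  [IsManifold (𝓡 n) ∞ M]
  [RiemannianBundle (fun x : M => TangentSpace (𝓡 n) x)]
  {p : M} {y : EuclideanSpace ℝ (Fin n)}

theorem isOpen_chartImage (p : M) {U : Set M} (hU : IsOpen U) : IsOpen (chartImage n p U) :=
  (continuousOn_extChartAt_symm p).isOpen_inter_preimage (isOpen_extChartAt_target p) hU

theorem mdifferentiableAt_extChartAt_symm (hy : y ∈ (extChartAt (𝓡 n) p).target) :
    MDifferentiableAt (𝓡 n) (𝓡 n) (extChartAt (𝓡 n) p).symm y := by
  have := mdifferentiableWithinAt_extChartAt_symm (I := 𝓡 n) hy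
  simpa [mdifferentiableWithinAt_univ] using this

theorem isInvertible_mfderiv_extChartAt_symm (hy : y ∈ (extChartAt (𝓡 n) p).target) :
    (mfderiv (𝓡 n) (𝓡 n) (extChartAt (𝓡 n) p).symm y).IsInvertible := by
  have := isInvertible_mfderivWithin_extChartAt_symm (I := 𝓡 n) hy
  simpa [mfderivWithin_univ] using this

theorem coordVec_smul (p : M) (c : ℝ) (v y : EuclideanSpace ℝ (Fin n)) :
    coordVec n p (c • v) y = c • coordVec n p v y :=
  map_smul (mfderiv (𝓡 n) (𝓡 n) (extChartAt (𝓡 n) p).symm y) c v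

theorem coordVec_sum {ι : Type*} (p : M) (s : Finset ι) (a : ι → ℝ)
    (v : ι → EuclideanSpace ℝ (Fin n)) (y : EuclideanSpace ℝ (Fin n)) :
    coordVec n p (∑ i ∈ s, a i • v i) y = ∑ i ∈ s, a i • coordVec n p (v i) y := by
  have := map_sum (mfderiv (𝓡 n) (𝓡 n) (extChartAt (𝓡 n) p).symm y) (fun i => a i • v i) s
  refine this.trans (Finset.sum_congr rfl fun i _ => coordVec_smul p _ _ _)

theorem exists_eq_coordVec (hy : y ∈ (extChartAt (𝓡 n) p).target)
    (V : TangentSpace (𝓡 n) ((extChartAt (𝓡 n) p).symm y)) : ∃ v, coordVec n p v y = V := by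
  obtain ⟨e, he⟩ := isInvertible_mfderiv_extChartAt_symm hy
  refine ⟨e.symm V, ?_⟩
  change mfderiv (𝓡 n) (𝓡 n) (extChartAt (𝓡 n) p).symm y (e.symm V) = V
  rw [← he]
  exact e.apply_symm_apply V

theorem coordVec_eq_zero (hy : y ∈ (extChartAt (𝓡 n) p).target) {v : EuclideanSpace ℝ (Fin n)}
    (h : coordVec n p v y = 0) : v = 0 := by
  obtain ⟨e, he⟩ := isInvertible_mfderiv_extChartAt_symm hy
  rw [coordVec, ← he] at h
  exact e.map_eq_zero_iff.1 h

theorem eq_sum_single (v : EuclideanSpace ℝ (Fin n)) :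
    v = ∑ i, v i • EuclideanSpace.single i (1 : ℝ) := by
  ext j
  simp [Finset.sum_apply, Pi.single_apply]

theorem inner_coordVec (p : M) (v w y : EuclideanSpace ℝ (Fin n)) :
    inner ℝ (coordVec n p v y) (coordVec n p w y) = v ⬝ᵥ (metricMatrix n p y).mulVec w := by
  conv_lhs => rw [eq_sum_single v, eq_sum_single w, coordVec_sum, coordVec_sum]
  simp only [sum_inner, inner_sum, inner_smul_left, inner_smul_right, dotProduct, Matrix.mulVec,
    metricMatrix, Matrix.of_apply, Finset.mul_sum]
  rw [Finset.sum_comm]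
  refine Finset.sum_congr rfl fun i _ => Finset.sum_congr rfl fun j _ => ?_
  simp
  ring

theorem metricMatrix_posDef (hy : y ∈ (extChartAt (𝓡 n) p).target) :
    (metricMatrix n p y).PosDef := by
  refine Matrix.PosDef.of_dotProduct_mulVec_pos ?_ fun v hv => ?_
  · ext i j
    simp only [metricMatrix, Matrix.conjTranspose_apply, Matrix.of_apply, star_trivial]
    exact real_inner_comm _ _
  · have := inner_coordVec p (WithLp.toLp 2 v) (WithLp.toLp 2 v) y
    rw [star_trivial, ← this, real_inner_self_eq_norm_sq]
    have h0 : coordVec n p (WithLp.toLp 2 v) y ≠ 0 := fun h => hv (by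
      simpa using coordVec_eq_zero hy h)
    positivity

/-- The inner product of two tangent vectors in terms of their covariant components. -/
theorem inner_eq_sum (hy : y ∈ (extChartAt (𝓡 n) p).target)
    (V W : TangentSpace (𝓡 n) ((extChartAt (𝓡 n) p).symm y)) :
    inner ℝ V W = ∑ i, ∑ j, (metricMatrix n p y)⁻¹ i j
      * inner ℝ V (coordVec n p (EuclideanSpace.single i 1) y)
      * inner ℝ W (coordVec n p (EuclideanSpace.single j 1) y) := by
  obtain ⟨v, rfl⟩ := exists_eq_coordVec hy V
  obtain ⟨w, rfl⟩ := exists_eq_coordVec hy W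
  have hG := metricMatrix_posDef hy
  have hdet : IsUnit (metricMatrix n p y).det := hG.det_pos.ne'.isUnit
  have hsym : (metricMatrix n p y).transpose = metricMatrix n p y := by
    have := hG.isHermitian
    rwa [Matrix.IsHermitian, Matrix.conjTranspose_eq_transpose_of_trivial] at this
  have key (u : EuclideanSpace ℝ (Fin n)) (i : Fin n) :
      inner ℝ (coordVec n p u y) (coordVec n p (EuclideanSpace.single i 1) y)
        = (metricMatrix n p y).mulVec u i := by
    rw [real_inner_comm, inner_coordVec]
    simp [dotProduct]
  simp only [key]
  have h1 : ∑ i, ∑ j, (metricMatrix n p y)⁻¹ i j * (metricMatrix n p y).mulVec v i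
      * (metricMatrix n p y).mulVec w j = (metricMatrix n p y).mulVec v ⬝ᵥ
        ((metricMatrix n p y)⁻¹.mulVec ((metricMatrix n p y).mulVec w)) := by
    generalize (metricMatrix n p y).mulVec v = a
    generalize (metricMatrix n p y).mulVec w = b
    simp only [dotProduct, Matrix.mulVec, Finset.mul_sum]
    exact Finset.sum_congr rfl fun i _ => Finset.sum_congr rfl fun j _ => by ring
  rw [h1, Matrix.mulVec_mulVec, Matrix.nonsing_inv_mul _ hdet, Matrix.one_mulVec, inner_coordVec,
    Matrix.dotProduct_mulVec, ← Matrix.mulVec_transpose, hsym]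

variable [IsContMDiffRiemannianBundle (𝓡 n) ∞ (EuclideanSpace ℝ (Fin n))
      (fun x : M => TangentSpace (𝓡 n) x)]

theorem contMDiffOn_coordVec (p : M) (v : EuclideanSpace ℝ (Fin n)) :
    ContMDiffOn (𝓡 n) ((𝓡 n).prod (𝓡 n)) ∞
      (fun y => (⟨(extChartAt (𝓡 n) p).symm y, coordVec n p v y⟩ :
        TotalSpace (EuclideanSpace ℝ (Fin n)) (fun x : M => TangentSpace (𝓡 n) x)))
      (extChartAt (𝓡 n) p).target := by
  have ho := isOpen_extChartAt_target (I := 𝓡 n) p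
  have h1 := (contMDiffOn_extChartAt_symm (I := 𝓡 n) (n := ∞) p).contMDiffOn_tangentMapWithin
    (m := ∞) (by simp) ho.uniqueMDiffOn
  have h2 : ContMDiffOn (𝓡 n) ((𝓡 n).prod (𝓡 n)) ∞
      (fun y : EuclideanSpace ℝ (Fin n) => (⟨y, v⟩ : TangentBundle (𝓡 n) (EuclideanSpace ℝ (Fin n))))
      (extChartAt (𝓡 n) p).target := by
    exact contMDiffOn_vectorSpace_iff_contDiffOn.2 contDiffOn_const
  have h3 := h1.comp h2 fun y hy => hy
  refine h3.congr fun y hy => ?_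
  simp only [Function.comp, tangentMapWithin, mfderivWithin_of_isOpen ho hy]
  rfl

theorem contDiffOn_inner_coordVec (p : M) (v w : EuclideanSpace ℝ (Fin n)) :
    ContDiffOn ℝ ∞ (fun y => (inner ℝ (coordVec n p v y) (coordVec n p w y) : ℝ))
      (extChartAt (𝓡 n) p).target :=
  (ContMDiffOn.inner_bundle (contMDiffOn_coordVec p v) (contMDiffOn_coordVec p w)).contDiffOn

theorem contDiffOn_metricMatrix_det (p : M) :
    ContDiffOn ℝ ∞ (fun y => (metricMatrix n p y).det) (extChartAt (𝓡 n) p).target := by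
  simp only [Matrix.det_apply]
  refine ContDiffOn.sum fun σ _ => ContDiffOn.const_smul _ (contDiffOn_prod fun i _ => ?_)
  exact contDiffOn_inner_coordVec p _ _

theorem contDiffOn_metricMatrix_inv (p : M) (i j : Fin n) :
    ContDiffOn ℝ ∞ (fun y => (metricMatrix n p y)⁻¹ i j) (extChartAt (𝓡 n) p).target := by
  simp only [Matrix.inv_def, Matrix.smul_apply, Ring.inverse_eq_inv', smul_eq_mul,
    Matrix.adjugate_apply]
  refine ContDiffOn.mul ((contDiffOn_metricMatrix_det p).inv fun y hy =>
    (metricMatrix_posDef hy).det_pos.ne') ?_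
  simp only [Matrix.det_apply]
  refine ContDiffOn.sum fun σ _ => ContDiffOn.const_smul _ (contDiffOn_prod fun k _ => ?_)
  simp only [Matrix.updateRow_apply]
  split_ifs
  · exact contDiffOn_const
  · exact contDiffOn_inner_coordVec p _ _

end

section

variable {n : ℕ} {M : Type*} [EMetricSpace M] [ChartedSpace (EuclideanSpace ℝ (Fin n)) M]
  [IsManifold (𝓡 n) ∞ M]
  [RiemannianBundle (fun x : M => TangentSpace (𝓡 n) x)]
  {p q : M} {y : EuclideanSpace ℝ (Fin n)}

/-- The inner product of the tangent space at `x`, on the model space. -/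
noncomputable def innerAt (x : M) (v w : EuclideanSpace ℝ (Fin n)) : ℝ :=
  @inner ℝ (TangentSpace (𝓡 n) x) _ v w

theorem metricMatrix_apply (p : M) (y : EuclideanSpace ℝ (Fin n)) (i j : Fin n) :
    metricMatrix n p y i j = innerAt ((extChartAt (𝓡 n) p).symm y)
      (coordVec n p (EuclideanSpace.single i 1) y) (coordVec n p (EuclideanSpace.single j 1) y) :=
  rfl

theorem chart_symm_coordChange (hyq : (extChartAt (𝓡 n) p).symm y ∈ (extChartAt (𝓡 n) q).source) :
    (extChartAt (𝓡 n) q).symm (extChartAt (𝓡 n) q ((extChartAt (𝓡 n) p).symm y))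
      = (extChartAt (𝓡 n) p).symm y :=
  (extChartAt (𝓡 n) q).left_inv hyq

theorem differentiableAt_coordChange (hy : y ∈ (extChartAt (𝓡 n) p).target)
    (hyq : (extChartAt (𝓡 n) p).symm y ∈ (extChartAt (𝓡 n) q).source) :
    DifferentiableAt ℝ (fun z => extChartAt (𝓡 n) q ((extChartAt (𝓡 n) p).symm z)) y := by
  have h1 := (mdifferentiableAt_extChartAt (I := 𝓡 n) (x := q)
    (by rwa [extChartAt_source] at hyq)).comp y (mdifferentiableAt_extChartAt_symm hy)
  exact h1.differentiableAt

/-- The transformation law of the coordinate vectors. -/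
theorem coordVec_coordChange (hy : y ∈ (extChartAt (𝓡 n) p).target)
    (hyq : (extChartAt (𝓡 n) p).symm y ∈ (extChartAt (𝓡 n) q).source)
    (v : EuclideanSpace ℝ (Fin n)) :
    (coordVec n p v y : EuclideanSpace ℝ (Fin n)) = coordVec n q
      (fderiv ℝ (fun z => extChartAt (𝓡 n) q ((extChartAt (𝓡 n) p).symm z)) y v)
      (extChartAt (𝓡 n) q ((extChartAt (𝓡 n) p).symm y)) := by
  set τ := fun z => extChartAt (𝓡 n) q ((extChartAt (𝓡 n) p).symm z) with hτ
  have hτy : τ y ∈ (extChartAt (𝓡 n) q).target := (extChartAt (𝓡 n) q).map_source hyq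
  have hev : (extChartAt (𝓡 n) p).symm =ᶠ[𝓝 y] (extChartAt (𝓡 n) q).symm ∘ τ := by
    have h1 : (extChartAt (𝓡 n) p).target ∩ (extChartAt (𝓡 n) p).symm ⁻¹'
        (extChartAt (𝓡 n) q).source ∈ 𝓝 y :=
      (isOpen_chartImage p (isOpen_extChartAt_source (I := 𝓡 n) q)).mem_nhds ⟨hy, hyq⟩
    filter_upwards [h1] with z hz
    exact (chart_symm_coordChange hz.2).symm
  have hd : MDifferentiableAt (𝓡 n) (𝓡 n) τ y :=
    (differentiableAt_coordChange hy hyq).mdifferentiableAt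
  have h2 := hev.mfderiv_eq (I := 𝓡 n) (I' := 𝓡 n)
  rw [mfderiv_comp y (mdifferentiableAt_extChartAt_symm hτy) hd, mfderiv_eq_fderiv] at h2
  exact congrArg (fun L : EuclideanSpace ℝ (Fin n) →L[ℝ] EuclideanSpace ℝ (Fin n) => L v) h2

theorem metricMatrix_coordChange (hy : y ∈ (extChartAt (𝓡 n) p).target)
    (hyq : (extChartAt (𝓡 n) p).symm y ∈ (extChartAt (𝓡 n) q).source) :
    √(metricMatrix n p y).det
      = |(fderiv ℝ (fun z => extChartAt (𝓡 n) q ((extChartAt (𝓡 n) p).symm z)) y).det|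
        * √(metricMatrix n q (extChartAt (𝓡 n) q ((extChartAt (𝓡 n) p).symm y))).det := by
  set τ := fun z => extChartAt (𝓡 n) q ((extChartAt (𝓡 n) p).symm z) with hτ
  set b := (EuclideanSpace.basisFun (Fin n) ℝ).toBasis
  set J := LinearMap.toMatrix b b (fderiv ℝ τ y).toLinearMap with hJ
  have hJ' (i j) : J i j = fderiv ℝ τ y (EuclideanSpace.single j 1) i := by
    simp [hJ, LinearMap.toMatrix_apply, b]
  have hdet : J.det = (fderiv ℝ τ y).det := LinearMap.det_toMatrix _ _
  have key : metricMatrix n p y = J.transpose * metricMatrix n q (τ y) * J := by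
    ext i j
    have h0 : metricMatrix n p y i j
        = innerAt ((extChartAt (𝓡 n) q).symm (τ y))
            (coordVec n q (fderiv ℝ τ y (EuclideanSpace.single i 1)) (τ y))
            (coordVec n q (fderiv ℝ τ y (EuclideanSpace.single j 1)) (τ y)) := by
      rw [metricMatrix_apply, coordVec_coordChange hy hyq, coordVec_coordChange hy hyq,
        chart_symm_coordChange hyq]
    rw [h0]
    change inner ℝ (coordVec n q _ (τ y)) (coordVec n q _ (τ y)) = _
    rw [inner_coordVec, Matrix.mul_assoc, Matrix.mul_apply]
    simp only [dotProduct, Matrix.mulVec, Matrix.transpose_apply, Matrix.mul_apply, hJ']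
  rw [key, Matrix.det_mul, Matrix.det_mul, Matrix.det_transpose, hdet, ← Real.sqrt_sq_eq_abs,
    ← Real.sqrt_mul (sq_nonneg _)]
  congr 1; ring

variable [MeasurableSpace M] [BorelSpace M]

theorem measurableSet_chartImage (p : M) {A : Set M} (hA : MeasurableSet A) :
    MeasurableSet (chartImage n p A) := by
  have h := (continuousOn_iff_continuous_domRestrict.1
    (continuousOn_extChartAt_symm (I := 𝓡 n) p)).measurable hA
  have h2 := (isOpen_extChartAt_target (I := 𝓡 n) p).measurableSet.subtype_image h
  convert h2 using 1
  ext z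
  simp [chartImage, and_comm]

theorem measurableSet_source_inter_preimage (p : M) {A : Set (EuclideanSpace ℝ (Fin n))}
    (hA : MeasurableSet A) :
    MeasurableSet ((extChartAt (𝓡 n) p).source ∩ extChartAt (𝓡 n) p ⁻¹' A) := by
  have h := (continuousOn_iff_continuous_domRestrict.1
    (continuousOn_extChartAt (I := 𝓡 n) p)).measurable hA
  have h2 := (isOpen_extChartAt_source (I := 𝓡 n) p).measurableSet.subtype_image h
  convert h2 using 1
  ext z
  simp [and_comm]

theorem aemeasurable_extChartAt_symm (p : M) {f : EuclideanSpace ℝ (Fin n) → ℝ≥0∞} :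
    AEMeasurable (extChartAt (𝓡 n) p).symm
      ((volume.restrict (extChartAt (𝓡 n) p).target).withDensity f) :=
  ((continuousOn_extChartAt_symm p).aemeasurable
    (isOpen_extChartAt_target p).measurableSet).mono_ac (withDensity_absolutelyContinuous _ _)

theorem chartVolume_apply (p : M) {A : Set M} (hA : MeasurableSet A) :
    chartVolume n p A = ∫⁻ y in chartImage n p A, ENNReal.ofReal √(metricMatrix n p y).det := by
  rw [chartVolume, Measure.map_apply_of_aemeasurable (aemeasurable_extChartAt_symm p) hA,
    withDensity_apply', Measure.restrict_restrict' (isOpen_extChartAt_target p).measurableSet,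
    inter_comm]
  rfl

theorem chartVolume_inter_source (p : M) {A : Set M} (hA : MeasurableSet A) :
    chartVolume n p (A ∩ (extChartAt (𝓡 n) p).source) = chartVolume n p A := by
  rw [chartVolume_apply p hA,
    chartVolume_apply p (hA.inter (isOpen_extChartAt_source p).measurableSet)]
  congr 2
  ext y
  simp only [chartImage, mem_inter_iff, mem_preimage]
  exact ⟨fun h => ⟨h.1, h.2.1⟩, fun h => ⟨h.1, h.2, (extChartAt (𝓡 n) p).map_target h.1⟩⟩

theorem chartVolume_eq_of_subset (p q : M) {A : Set M} (hA : MeasurableSet A)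
    (hp : A ⊆ (extChartAt (𝓡 n) p).source) (hq : A ⊆ (extChartAt (𝓡 n) q).source) :
    chartVolume n q A = chartVolume n p A := by
  set τ := fun z => extChartAt (𝓡 n) q ((extChartAt (𝓡 n) p).symm z) with hτ
  have him : chartImage n q A = τ '' chartImage n p A := by
    ext z
    constructor
    · intro hz
      refine ⟨extChartAt (𝓡 n) p ((extChartAt (𝓡 n) q).symm z),
        ⟨(extChartAt (𝓡 n) p).map_source (hp hz.2), ?_⟩, ?_⟩
      · rw [mem_preimage, (extChartAt (𝓡 n) p).left_inv (hp hz.2)]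
        exact hz.2
      · simp only [hτ, (extChartAt (𝓡 n) p).left_inv (hp hz.2)]
        exact (extChartAt (𝓡 n) q).right_inv hz.1
    · rintro ⟨z, hz, rfl⟩
      refine ⟨(extChartAt (𝓡 n) q).map_source (hq hz.2), ?_⟩
      rw [mem_preimage, (extChartAt (𝓡 n) q).left_inv (hq hz.2)]
      exact hz.2
  have hinj : InjOn τ (chartImage n p A) := by
    intro z hz z' hz' h
    exact (extChartAt (𝓡 n) p).symm.injOn hz.1 hz'.1
      ((extChartAt (𝓡 n) q).injOn (hq hz.2) (hq hz'.2) h)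
  rw [chartVolume_apply p hA, chartVolume_apply q hA, him,
    lintegral_image_eq_lintegral_abs_det_fderiv_mul _ (measurableSet_chartImage p hA)
      (fun z hz => (differentiableAt_coordChange hz.1 (hq hz.2)).hasFDerivAt.hasFDerivWithinAt) hinj]
  refine setLIntegral_congr_fun (measurableSet_chartImage p hA) fun z hz => ?_
  rw [metricMatrix_coordChange hz.1 (hq hz.2), ENNReal.ofReal_mul (abs_nonneg _)]

/-- On a chart domain, the Riemannian volume is given by the coordinate expression. -/
theorem riemannianVolume_restrict_source (p : M) :
    (riemannianVolume n M).restrict (extChartAt (𝓡 n) p).source = chartVolume n p := by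
  set S := (extChartAt (𝓡 n) p).source
  have hS : MeasurableSet S := (isOpen_extChartAt_source p).measurableSet
  have hle : riemannianVolume n M ≤ chartVolume n p + (riemannianVolume n M).restrict Sᶜ := by
    refine iSup_le fun q => Measure.le_intro fun A hA _ => ?_
    have h1 : chartVolume n q (A ∩ S) ≤ chartVolume n p A := by
      have hSq : MeasurableSet (extChartAt (𝓡 n) q).source :=
        (isOpen_extChartAt_source q).measurableSet
      rw [← chartVolume_inter_source q (hA.inter hS),
        chartVolume_eq_of_subset p q ((hA.inter hS).inter hSq)
          (inter_subset_left.trans inter_subset_right) inter_subset_right]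
      exact measure_mono (inter_subset_left.trans inter_subset_left)
    have h2 : chartVolume n q (A \ S) ≤ (riemannianVolume n M).restrict Sᶜ A := by
      rw [Measure.restrict_apply hA, ← sdiff_eq]
      exact le_iSup (fun q : M => chartVolume n q) q _
    rw [← measure_inter_add_sdiff A hS]
    exact add_le_add h1 h2
  refine le_antisymm ?_ ?_
  · refine Measure.le_intro fun A hA _ => ?_
    rw [Measure.restrict_apply hA]
    refine (hle _).trans ?_
    rw [Measure.add_apply, chartVolume_inter_source p hA, Measure.restrict_apply (hA.inter hS)]
    simp [inter_assoc]
  · refine Measure.le_intro fun A hA _ => ?_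
    rw [Measure.restrict_apply hA, ← chartVolume_inter_source p hA]
    exact le_iSup (fun q : M => chartVolume n q) p _

theorem riemannianVolume_apply_of_subset (p : M) {A : Set M} (hA : MeasurableSet A)
    (hAp : A ⊆ (extChartAt (𝓡 n) p).source) :
    riemannianVolume n M A = ∫⁻ y in chartImage n p A, ENNReal.ofReal √(metricMatrix n p y).det := by
  rw [← chartVolume_apply p hA, ← riemannianVolume_restrict_source, Measure.restrict_apply hA,
    inter_eq_self_of_subset_left hAp]

/-- A set is null for the Riemannian volume if it is null in charts. -/
theorem riemannianVolume_eq_zero_of_chart (p : M) {A : Set M}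
    (hAp : A ⊆ (extChartAt (𝓡 n) p).source) (h : volume (chartImage n p A) = 0) :
    riemannianVolume n M A = 0 := by
  obtain ⟨B, hB, hBm, hB0⟩ := exists_measurable_superset_of_null h
  refine measure_mono_null (t := (extChartAt (𝓡 n) p).source ∩ extChartAt (𝓡 n) p ⁻¹' B)
    (fun x hx => ⟨hAp hx, hB ⟨(extChartAt (𝓡 n) p).map_source (hAp hx), ?_⟩⟩) ?_
  · rw [mem_preimage, (extChartAt (𝓡 n) p).left_inv (hAp hx)]
    exact hx
  · rw [riemannianVolume_apply_of_subset p (measurableSet_source_inter_preimage p hBm)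
      inter_subset_left]
    refine setLIntegral_measure_zero _ _ (measure_mono_null (fun y hy => ?_) hB0)
    have h1 := hy.2.2
    rwa [mem_preimage, (extChartAt (𝓡 n) p).right_inv hy.1] at h1

variable (n M) in
theorem exists_countable_charts [SecondCountableTopology M] :
    ∃ s : Set M, s.Countable ∧ ⋃ p ∈ s, (extChartAt (𝓡 n) p).source = univ :=
  TopologicalSpace.countable_cover_nhds fun p => extChartAt_source_mem_nhds (I := 𝓡 n) p

theorem ae_restrict_of_chart [SecondCountableTopology M] {U : Set M} (hU : MeasurableSet U)
    {P : M → Prop}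
    (h : ∀ p : M, ∀ᵐ y, y ∈ chartImage n p U → P ((extChartAt (𝓡 n) p).symm y)) :
    ∀ᵐ x ∂(riemannianVolume n M).restrict U, P x := by
  rw [ae_restrict_iff' hU, ae_iff]
  obtain ⟨s, hs, hsu⟩ := exists_countable_charts n M
  have h1 : {x | ¬ (x ∈ U → P x)} ⊆
      ⋃ p ∈ s, ({x | ¬ (x ∈ U → P x)} ∩ (extChartAt (𝓡 n) p).source) := by
    rw [← inter_iUnion₂, hsu, inter_univ]
  refine measure_mono_null h1 ((measure_biUnion_null_iff hs).2 fun p _ => ?_)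
  refine riemannianVolume_eq_zero_of_chart p inter_subset_right
    (measure_mono_null (fun y hy => ?_) (h p))
  simp only [chartImage, mem_inter_iff, mem_preimage, mem_ofPred_eq, mem_compl_iff,
    Classical.not_imp] at hy ⊢
  exact ⟨⟨hy.1, hy.2.1.1⟩, hy.2.1.2⟩

theorem aemeasurable_restrict_inter_source {U : Set M} (hU : MeasurableSet U) (p : M)
    {β : Type*} [MeasurableSpace β] {f : M → β}
    (h : AEMeasurable (fun y => f ((extChartAt (𝓡 n) p).symm y))
      (volume.restrict (chartImage n p U))) :
    AEMeasurable f ((riemannianVolume n M).restrict (U ∩ (extChartAt (𝓡 n) p).source)) := by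
  set S := (extChartAt (𝓡 n) p).source
  have hS : MeasurableSet S := (isOpen_extChartAt_source p).measurableSet
  have hφ : AEMeasurable (extChartAt (𝓡 n) p) ((riemannianVolume n M).restrict (U ∩ S)) :=
    ((continuousOn_extChartAt p).aemeasurable hS).mono_measure
      (Measure.restrict_mono inter_subset_right le_rfl)
  have hac : ((riemannianVolume n M).restrict (U ∩ S)).map (extChartAt (𝓡 n) p)
      ≪ volume.restrict (chartImage n p U) := by
    refine Measure.AbsolutelyContinuous.mk fun A hA h0 => ?_
    rw [Measure.map_apply_of_aemeasurable hφ hA, Measure.restrict_apply' (hU.inter hS)]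
    rw [Measure.restrict_apply hA] at h0
    refine riemannianVolume_eq_zero_of_chart p (fun x hx => hx.2.2)
      (measure_mono_null (fun y hy => ?_) h0)
    have h1 : extChartAt (𝓡 n) p ((extChartAt (𝓡 n) p).symm y) ∈ A := hy.2.1
    rw [(extChartAt (𝓡 n) p).right_inv hy.1] at h1
    exact ⟨h1, hy.1, hy.2.2.1⟩
  refine ((h.mono_ac hac).comp_aemeasurable hφ).congr ?_
  filter_upwards [ae_restrict_mem (hU.inter hS)] with x hx
  simp only [Function.comp, (extChartAt (𝓡 n) p).left_inv hx.2]

theorem aemeasurable_restrict_of_chart [SecondCountableTopology M] {U : Set M}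
    (hU : MeasurableSet U) {β : Type*} [MeasurableSpace β] {f : M → β}
    (h : ∀ p : M, AEMeasurable (fun y => f ((extChartAt (𝓡 n) p).symm y))
      (volume.restrict (chartImage n p U))) :
    AEMeasurable f ((riemannianVolume n M).restrict U) := by
  obtain ⟨s, hs, hsu⟩ := exists_countable_charts n M
  have := hs.to_subtype
  have hU' : U = ⋃ p : s, U ∩ (extChartAt (𝓡 n) (p : M)).source := by
    rw [← inter_iUnion, iUnion_subtype, hsu, inter_univ]
  rw [hU']
  exact AEMeasurable.iUnion fun p => aemeasurable_restrict_inter_source hU p (h p)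

end

/-- A function of class `C¹` on an open set is locally Lipschitz. -/
theorem _root_.ContDiffOn.locallyLipschitzOn_of_isOpen {E F : Type*} [NormedAddCommGroup E]
    [NormedSpace ℝ E] [NormedAddCommGroup F] [NormedSpace ℝ F] {f : E → F} {s : Set E}
    (hf : ContDiffOn ℝ 1 f s) (hs : IsOpen s) : LocallyLipschitzOn s f := by
  intro x hx
  obtain ⟨K, t, ht, h⟩ := (hf.contDiffAt (hs.mem_nhds hx)).exists_lipschitzOnWith
  exact ⟨K, t, mem_nhdsWithin_of_mem_nhds ht, h⟩

section

variable {n : ℕ} {M : Type*} [EMetricSpace M] [ChartedSpace (EuclideanSpace ℝ (Fin n)) M]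
  [IsManifold (𝓡 n) ∞ M]
  [RiemannianBundle (fun x : M => TangentSpace (𝓡 n) x)]
  {p q : M} {y : EuclideanSpace ℝ (Fin n)} {U : Set M} {f u : M → ℝ}

theorem inner_grad (f : M → ℝ) (x : M) (w : TangentSpace (𝓡 n) x) :
    inner ℝ (grad n f x) w = mfderiv (𝓡 n) 𝓘(ℝ, ℝ) f x w := by
  have : CompleteSpace (TangentSpace (𝓡 n) x) := FiniteDimensional.complete ℝ _
  exact InnerProductSpace.toDual_symm_apply

theorem mdifferentiableAt_of_chart (hy : y ∈ (extChartAt (𝓡 n) p).target)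
    (h : DifferentiableAt ℝ (fun z => f ((extChartAt (𝓡 n) p).symm z)) y) :
    MDifferentiableAt (𝓡 n) 𝓘(ℝ, ℝ) f ((extChartAt (𝓡 n) p).symm y) := by
  have hx := (extChartAt (𝓡 n) p).map_target hy
  have h1 : MDifferentiableAt (𝓡 n) 𝓘(ℝ, ℝ) (fun z => f ((extChartAt (𝓡 n) p).symm z))
      (extChartAt (𝓡 n) p ((extChartAt (𝓡 n) p).symm y)) := by
    rw [(extChartAt (𝓡 n) p).right_inv hy]
    exact h.mdifferentiableAt
  have h2 := h1.comp ((extChartAt (𝓡 n) p).symm y) (mdifferentiableAt_extChartAt (I := 𝓡 n) (x := p)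
    (by rwa [extChartAt_source] at hx))
  refine h2.congr_of_eventuallyEq ?_
  filter_upwards [(isOpen_extChartAt_source (I := 𝓡 n) p).mem_nhds hx] with z hz
  simp only [Function.comp, (extChartAt (𝓡 n) p).left_inv hz]

theorem inner_grad_coordVec (hy : y ∈ (extChartAt (𝓡 n) p).target)
    (h : MDifferentiableAt (𝓡 n) 𝓘(ℝ, ℝ) f ((extChartAt (𝓡 n) p).symm y))
    (v : EuclideanSpace ℝ (Fin n)) :
    inner ℝ (grad n f ((extChartAt (𝓡 n) p).symm y)) (coordVec n p v y)
      = fderiv ℝ (fun z => f ((extChartAt (𝓡 n) p).symm z)) y v := by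
  rw [inner_grad]
  have h1 := mfderiv_comp y h (mdifferentiableAt_extChartAt_symm hy)
  rw [mfderiv_eq_fderiv] at h1
  exact (congrArg (fun L : EuclideanSpace ℝ (Fin n) →L[ℝ] ℝ => L v) h1).symm

theorem contDiffOn_chart {k : ℕ∞ω} (hk : k ≤ (∞ : ℕ∞ω)) (h : ContMDiffOn (𝓡 n) 𝓘(ℝ, ℝ) k f U) (p : M) :
    ContDiffOn ℝ k (fun y => f ((extChartAt (𝓡 n) p).symm y)) (chartImage n p U) :=
  (h.comp (((contMDiffOn_extChartAt_symm (I := 𝓡 n) (n := ∞) p).of_le hk).mono inter_subset_left)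
    fun _ hy => hy.2).contDiffOn

theorem continuousOn_chart (h : ContinuousOn f U) (p : M) :
    ContinuousOn (fun y => f ((extChartAt (𝓡 n) p).symm y)) (chartImage n p U) :=
  h.comp ((continuousOn_extChartAt_symm p).mono inter_subset_left) fun _ hy => hy.2

theorem continuousOn_of_chart (hU : IsOpen U)
    (h : ∀ p : M, ContinuousOn (fun y => f ((extChartAt (𝓡 n) p).symm y)) (chartImage n p U)) :
    ContinuousOn f U := by
  intro x hx
  refine ContinuousAt.continuousWithinAt ?_
  have hx' : extChartAt (𝓡 n) x x ∈ chartImage n x U :=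
    ⟨mem_extChartAt_target x, by simpa using hx⟩
  have h1 := ((h x).continuousAt ((isOpen_chartImage x hU).mem_nhds hx')).comp
    (continuousAt_extChartAt (I := 𝓡 n) x)
  refine h1.congr ?_
  filter_upwards [extChartAt_source_mem_nhds (I := 𝓡 n) x] with z hz
  simp only [Function.comp, (extChartAt (𝓡 n) x).left_inv hz]

variable [IsContMDiffRiemannianBundle (𝓡 n) ∞ (EuclideanSpace ℝ (Fin n))
      (fun x : M => TangentSpace (𝓡 n) x)]

/-- The components of the gradient of a function of class `C²` are of class `C¹`. -/
theorem contDiffOn_inner_grad (hU : IsOpen U) (hu : ContMDiffOn (𝓡 n) 𝓘(ℝ, ℝ) 2 u U) (p : M)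
    (v : EuclideanSpace ℝ (Fin n)) :
    ContDiffOn ℝ 1 (fun y => (inner ℝ (grad n u ((extChartAt (𝓡 n) p).symm y))
      (coordVec n p v y) : ℝ)) (chartImage n p U) := by
  have h2' : (2 : ℕ∞ω) ≤ (∞ : ℕ∞ω) := by norm_cast
  have h1 := contDiffOn_chart h2' hu p
  have ho := isOpen_chartImage (n := n) p hU
  have h2 : ContDiffOn ℝ 1 (fun y => fderiv ℝ (fun z => u ((extChartAt (𝓡 n) p).symm z)) y v)
      (chartImage n p U) :=
    (h1.fderiv_of_isOpen ho (m := 1) (by norm_num)).clm_apply contDiffOn_const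
  refine h2.congr fun y hy => inner_grad_coordVec hy.1 ?_ v
  exact (hu.contMDiffAt (hU.mem_nhds hy.2)).mdifferentiableAt (by simp)

theorem contDiffOn_slope (hU : IsOpen U) (hu : ContMDiffOn (𝓡 n) 𝓘(ℝ, ℝ) 2 u U) (p : M) :
    ContDiffOn ℝ 1 (fun y => slope n u ((extChartAt (𝓡 n) p).symm y)) (chartImage n p U) := by
  refine ContDiffOn.sqrt ?_ fun y _ => by positivity
  refine contDiffOn_const.add ?_
  have h1 : ContDiffOn ℝ 1 (fun y => ∑ i, ∑ j, (metricMatrix n p y)⁻¹ i j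
      * inner ℝ (grad n u ((extChartAt (𝓡 n) p).symm y)) (coordVec n p (EuclideanSpace.single i 1) y)
      * inner ℝ (grad n u ((extChartAt (𝓡 n) p).symm y))
        (coordVec n p (EuclideanSpace.single j 1) y)) (chartImage n p U) :=
    ContDiffOn.sum fun i _ => ContDiffOn.sum fun j _ =>
      ((((contDiffOn_metricMatrix_inv p i j).of_le (by simp)).mono inter_subset_left).mul
        (contDiffOn_inner_grad hU hu p _)).mul (contDiffOn_inner_grad hU hu p _)
  refine h1.congr fun y hy => ?_
  rw [← real_inner_self_eq_norm_sq, inner_eq_sum hy.1]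

theorem mdifferentiableAt_slope (hU : IsOpen U) (hu : ContMDiffOn (𝓡 n) 𝓘(ℝ, ℝ) 2 u U)
    (hy : y ∈ chartImage n p U) :
    MDifferentiableAt (𝓡 n) 𝓘(ℝ, ℝ) (slope n u) ((extChartAt (𝓡 n) p).symm y) :=
  mdifferentiableAt_of_chart hy.1 (((contDiffOn_slope hU hu p).contDiffAt
    ((isOpen_chartImage p hU).mem_nhds hy)).differentiableAt (by simp))

/-- The inverse of a chart is locally Lipschitz. -/
theorem exists_edist_chart_symm_le [IsRiemannianManifold (𝓡 n) M]
    (hy : y ∈ (extChartAt (𝓡 n) p).target) :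
    ∃ C : ℝ≥0, ∃ r > 0, ∀ z ∈ Metric.ball y r, ∀ z' ∈ Metric.ball y r,
      edist ((extChartAt (𝓡 n) p).symm z) ((extChartAt (𝓡 n) p).symm z') ≤ C * edist z z' := by
  have ho := isOpen_extChartAt_target (I := 𝓡 n) p
  set B : EuclideanSpace ℝ (Fin n) → ℝ := fun z => ∑ i, ∑ j, |metricMatrix n p z i j| with hB
  have hBc : ContinuousAt B y := by
    refine ContinuousOn.continuousAt (s := (extChartAt (𝓡 n) p).target) ?_ (ho.mem_nhds hy)
    exact continuousOn_finsetSum _ fun i _ => continuousOn_finsetSum _ fun j _ =>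
      (contDiffOn_inner_coordVec p _ _).continuousOn.abs
  have hle (z v : EuclideanSpace ℝ (Fin n)) : ‖coordVec n p v z‖ ^ 2 ≤ B z * ‖v‖ ^ 2 := by
    rw [← real_inner_self_eq_norm_sq, inner_coordVec]
    simp only [dotProduct, Matrix.mulVec, Finset.mul_sum, hB, Finset.sum_mul]
    refine Finset.sum_le_sum fun i _ => Finset.sum_le_sum fun j _ => ?_
    have hi : |v i| ≤ ‖v‖ := PiLp.norm_apply_le v i
    have hj : |v j| ≤ ‖v‖ := PiLp.norm_apply_le v j
    calc _ ≤ |v i * (metricMatrix n p z i j * v j)| := le_abs_self _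
      _ = |v i| * (|metricMatrix n p z i j| * |v j|) := by rw [abs_mul, abs_mul]
      _ ≤ ‖v‖ * (|metricMatrix n p z i j| * ‖v‖) := by gcongr
      _ = _ := by ring
  have hev : ∀ᶠ z in 𝓝 y, z ∈ (extChartAt (𝓡 n) p).target ∧ B z < B y + 1 :=
    Filter.Eventually.and (ho.mem_nhds hy : ∀ᶠ z in 𝓝 y, z ∈ (extChartAt (𝓡 n) p).target) (hBc.eventually (gt_mem_nhds (lt_add_one _)))
  obtain ⟨r, hr, hrb⟩ := Metric.eventually_nhds_iff_ball.1 hev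
  set C : ℝ≥0 := (√(B y + 1)).toNNReal with hC
  have hle' (z) (hz : z ∈ Metric.ball y r) (v : EuclideanSpace ℝ (Fin n)) :
      ‖coordVec n p v z‖ₑ ≤ C * ‖v‖ₑ := by
    have h1 : ‖coordVec n p v z‖ ≤ √(B y + 1) * ‖v‖ := by
      have h2 : ‖coordVec n p v z‖ ^ 2 ≤ (B y + 1) * ‖v‖ ^ 2 := by
        have := (hrb z hz).2.le
        exact (hle z v).trans (by gcongr)
      refine (Real.le_sqrt_of_sq_le h2).trans_eq ?_
      rw [Real.sqrt_mul' _ (by positivity), Real.sqrt_sq (norm_nonneg _)]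
    rw [← ofReal_norm, ← ofReal_norm, hC, ← ENNReal.ofReal, ← ENNReal.ofReal_mul (by positivity)]
    exact ENNReal.ofReal_le_ofReal h1
  refine ⟨C, r, hr, fun z hz z' hz' => ?_⟩
  set l : ℝ → EuclideanSpace ℝ (Fin n) := fun t => z + t • (z' - z) with hl
  have hlb (t : ℝ) (ht : t ∈ Icc (0 : ℝ) 1) : l t ∈ Metric.ball y r :=
    (convex_ball y r).add_smul_sub_mem hz hz' ht
  have hls : ContDiff ℝ ∞ l := contDiff_const.add (contDiff_id.smul contDiff_const)
  have hld (t : ℝ) : HasFDerivAt l ((ContinuousLinearMap.id ℝ ℝ).smulRight (z' - z)) t := by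
    have := ((hasFDerivAt_id (𝕜 := ℝ) t).smul_const (z' - z)).const_add z
    exact this
  have hγ : ContMDiffOn 𝓘(ℝ, ℝ) (𝓡 n) 1 ((extChartAt (𝓡 n) p).symm ∘ l) (Icc 0 1) :=
    ((contMDiffOn_extChartAt_symm (I := 𝓡 n) (n := ∞) p).of_le (by simp)).comp
      ((hls.of_le (by simp)).contMDiff.contMDiffOn) fun t ht => (hrb _ (hlb t ht)).1
  rw [IsRiemannianManifold.out (I := 𝓡 n)]
  refine (Manifold.riemannianEDist_le_pathELength hγ (by simp [hl]) (by simp [hl])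
    zero_le_one).trans ?_
  rw [Manifold.pathELength_eq_lintegral_mfderiv_Icc]
  have hb : ∀ t ∈ Icc (0 : ℝ) 1, ‖mfderiv 𝓘(ℝ, ℝ) (𝓡 n) ((extChartAt (𝓡 n) p).symm ∘ l) t 1‖ₑ
      ≤ C * ‖z' - z‖ₑ := by
    intro t ht
    have h1 := mfderiv_comp t (mdifferentiableAt_extChartAt_symm (hrb _ (hlb t ht)).1)
      (hld t).differentiableAt.mdifferentiableAt
    rw [mfderiv_eq_fderiv, (hld t).fderiv] at h1
    rw [h1]
    have h2 : (((mfderiv (𝓡 n) (𝓡 n) (extChartAt (𝓡 n) p).symm (l t)).comp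
      ((ContinuousLinearMap.id ℝ ℝ).smulRight (z' - z))) (1 : ℝ) :
        TangentSpace (𝓡 n) ((extChartAt (𝓡 n) p).symm (l t))) = coordVec n p (z' - z) (l t) := by
      change mfderiv (𝓡 n) (𝓡 n) (extChartAt (𝓡 n) p).symm (l t) ((1 : ℝ) • (z' - z)) = _
      rw [one_smul]
      rfl
    exact (congrArg (fun w : TangentSpace (𝓡 n) ((extChartAt (𝓡 n) p).symm (l t)) => ‖w‖ₑ) h2).trans_le
      (hle' _ (hlb t ht) _)
  refine (setLIntegral_mono' measurableSet_Icc hb).trans ?_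
  simp [edist_eq_enorm_sub, enorm_sub_rev]

theorem locallyLipschitzOn_chart [IsRiemannianManifold (𝓡 n) M] (hU : IsOpen U)
    (hf : LocallyLipschitzOn U f) (p : M) :
    LocallyLipschitzOn (chartImage n p U) fun y => f ((extChartAt (𝓡 n) p).symm y) := by
  intro y hy
  obtain ⟨C, r, hr, hC⟩ := exists_edist_chart_symm_le hy.1
  obtain ⟨K, t, ht, hK⟩ := hf hy.2
  rw [hU.nhdsWithin_eq hy.2] at ht
  have hcont : ContinuousAt (extChartAt (𝓡 n) p).symm y :=
    (continuousOn_extChartAt_symm p).continuousAt ((isOpen_extChartAt_target p).mem_nhds hy.1)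
  refine ⟨K * C, (extChartAt (𝓡 n) p).symm ⁻¹' t ∩ Metric.ball y r,
    mem_nhdsWithin_of_mem_nhds (inter_mem (hcont ht) (Metric.ball_mem_nhds y hr)), ?_⟩
  intro z hz z' hz'
  refine (hK hz.1 hz'.1).trans ?_
  rw [ENNReal.coe_mul, mul_assoc]
  gcongr
  exact hC z hz.2 z' hz'.2

end

theorem HasWeakDeriv.congr {E : Type*} [NormedAddCommGroup E] [NormedSpace ℝ E]
    [FiniteDimensional ℝ E] [MeasurableSpace E] [BorelSpace E] {μ : Measure E}
    [μ.IsAddHaarMeasure] {Ω : Set E} {f g f' g' : E → ℝ} {v : E} (hΩ : IsOpen Ω)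
    (h : HasWeakDeriv μ Ω f g v) (hf : ∀ y ∈ Ω, f' y = f y) (hg : ∀ y ∈ Ω, g' y = g y) :
    HasWeakDeriv μ Ω f' g' v :=
  hasWeakDeriv_of_locally fun K hK _ => ⟨f, g, h, by
    filter_upwards [hΩ.mem_nhdsSet.2 hK] with y hy using ⟨hf y hy, hg y hy⟩⟩

section

variable {n : ℕ} {M : Type*} [EMetricSpace M] [ChartedSpace (EuclideanSpace ℝ (Fin n)) M]
  [IsManifold (𝓡 n) ∞ M]
  [RiemannianBundle (fun x : M => TangentSpace (𝓡 n) x)]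
  {p q : M} {y : EuclideanSpace ℝ (Fin n)} {U : Set M} {f u : M → ℝ}
  {G : ∀ x : M, TangentSpace (𝓡 n) x}

theorem HasWeakGrad.hasWeakDeriv (h : HasWeakGrad n U f G) (p : M)
    (v : EuclideanSpace ℝ (Fin n)) :
    HasWeakDeriv volume (chartImage n p U) (fun y => f ((extChartAt (𝓡 n) p).symm y))
      (fun y => (inner ℝ (G ((extChartAt (𝓡 n) p).symm y)) (coordVec n p v y) : ℝ)) v :=
  ⟨h.locallyIntegrable p, h.locallyIntegrable_grad p v, h.integral_eq p v⟩

theorem hasWeakGrad_of_chart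
    (h : ∀ (p : M) (v : EuclideanSpace ℝ (Fin n)),
      HasWeakDeriv volume (chartImage n p U) (fun y => f ((extChartAt (𝓡 n) p).symm y))
      (fun y => (inner ℝ (G ((extChartAt (𝓡 n) p).symm y)) (coordVec n p v y) : ℝ)) v) :
    HasWeakGrad n U f G :=
  ⟨fun p => (h p 0).locallyIntegrableOn, fun p v => (h p v).locallyIntegrableOn_deriv,
    fun p v => (h p v).integral_eq⟩

/-- Product rule for a weakly differentiable function and a function of class `C¹`. -/
theorem HasWeakGrad.mul_contMDiffOn (hU : IsOpen U) (h : HasWeakGrad n U f G) {a : M → ℝ}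
    (ha : ContMDiffOn (𝓡 n) 𝓘(ℝ, ℝ) 1 a U) :
    HasWeakGrad n U (fun x => a x * f x) (fun x => a x • G x + f x • grad n a x) := by
  refine hasWeakGrad_of_chart fun p v => ?_
  have ho := isOpen_chartImage (n := n) p hU
  have ha' := contDiffOn_chart (by norm_cast) ha p
  refine ((h.hasWeakDeriv p v).mul_locallyLipschitzOn ho
    (ha'.locallyLipschitzOn_of_isOpen ho)).congr ho (fun _ _ => rfl) fun y hy => ?_
  rw [inner_add_left, real_inner_smul_left, real_inner_smul_left, inner_grad_coordVec hy.1
    ((ha.contMDiffAt (hU.mem_nhds hy.2)).mdifferentiableAt (by simp)),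
    ((ha'.contDiffAt (ho.mem_nhds hy)).differentiableAt (by simp)).lineDeriv_eq_fderiv, mul_comm (f _)]

variable [IsContMDiffRiemannianBundle (𝓡 n) ∞ (EuclideanSpace ℝ (Fin n))
      (fun x : M => TangentSpace (𝓡 n) x)]

theorem contDiffOn_sqrt_det (p : M) :
    ContDiffOn ℝ ∞ (fun y => √(metricMatrix n p y).det) (extChartAt (𝓡 n) p).target :=
  (contDiffOn_metricMatrix_det p).sqrt fun _ hy => (metricMatrix_posDef hy).det_pos.ne'

/-- The coordinate expression of a function with compact support in a chart. -/
theorem isTestFunction_chart (p : M) {ψ : EuclideanSpace ℝ (Fin n) → ℝ} (hψ : ContDiff ℝ ∞ ψ)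
    (hc : HasCompactSupport ψ) (hs : tsupport ψ ⊆ chartImage n p U) :
    IsTestFunction n (U ∩ (extChartAt (𝓡 n) p).source)
      ((extChartAt (𝓡 n) p).source.indicator fun x => ψ (extChartAt (𝓡 n) p x)) := by
  set S := (extChartAt (𝓡 n) p).source with hS
  set L := (extChartAt (𝓡 n) p).symm '' tsupport ψ with hL
  have hLc : IsCompact L := hc.isCompact.image_of_continuousOn
    ((continuousOn_extChartAt_symm p).mono fun y hy => (hs hy).1)
  have hLS : L ⊆ U ∩ S := by
    rintro _ ⟨y, hy, rfl⟩
    exact ⟨(hs hy).2, (extChartAt (𝓡 n) p).map_target (hs hy).1⟩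
  have h0 : ∀ x ∉ L, S.indicator (fun x => ψ (extChartAt (𝓡 n) p x)) x = 0 := by
    intro x hx
    by_cases hxS : x ∈ S
    · rw [indicator_of_mem hxS]
      by_contra hne
      exact hx ⟨_, subset_tsupport _ hne, (extChartAt (𝓡 n) p).left_inv hxS⟩
    · exact indicator_of_notMem hxS _
  have ht : tsupport (S.indicator fun x => ψ (extChartAt (𝓡 n) p x)) ⊆ L :=
    closure_minimal (fun x hx => by_contra fun hxL => hx (h0 x hxL)) hLc.isClosed
  refine ⟨fun x => ?_, HasCompactSupport.intro hLc h0, ht.trans hLS⟩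
  by_cases hx : x ∈ L
  · have hxS := (hLS hx).2
    refine ContMDiffAt.congr_of_eventuallyEq (f := fun x => ψ (extChartAt (𝓡 n) p x)) ?_ ?_
    · exact hψ.contMDiff.contMDiffAt.comp x (contMDiffAt_extChartAt'
      (by rwa [hS, extChartAt_source] at hxS))
    · filter_upwards [(isOpen_extChartAt_source (I := 𝓡 n) p).mem_nhds hxS] with z hz
      exact indicator_of_mem hz _
  · refine (contMDiffAt_const (c := (0 : ℝ))).congr_of_eventuallyEq ?_
    filter_upwards [hLc.isClosed.isOpen_compl.mem_nhds hx] with z hz using h0 z hz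

variable [MeasurableSpace M] [BorelSpace M]

theorem setIntegral_inter_source (hU : MeasurableSet U) (p : M) {F : M → ℝ}
    (hF : AEMeasurable (fun y => F ((extChartAt (𝓡 n) p).symm y))
      (volume.restrict (chartImage n p U))) :
    ∫ x in U ∩ (extChartAt (𝓡 n) p).source, F x ∂(riemannianVolume n M)
      = ∫ y in chartImage n p U, √(metricMatrix n p y).det * F ((extChartAt (𝓡 n) p).symm y) := by
  set S := (extChartAt (𝓡 n) p).source with hS
  have hSm : MeasurableSet S := (isOpen_extChartAt_source p).measurableSet
  have hTm : MeasurableSet (extChartAt (𝓡 n) p).target := (isOpen_extChartAt_target p).measurableSet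
  have hFm := (aemeasurable_restrict_inter_source hU p hF).aestronglyMeasurable
  have hr : (riemannianVolume n M).restrict (U ∩ S) = (chartVolume n p).restrict U := by
    rw [← riemannianVolume_restrict_source, Measure.restrict_restrict hU]
  rw [hr] at hFm ⊢
  rw [← integral_indicator hU, chartVolume, integral_map (aemeasurable_extChartAt_symm p)
    ((aestronglyMeasurable_indicator_iff hU).2 hFm), integral_withDensity_eq_integral_toReal_smul₀,
    ← integral_indicator hTm, ← integral_indicator (measurableSet_chartImage p hU)]
  · congr 1
    ext y
    by_cases hy : y ∈ (extChartAt (𝓡 n) p).target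
    · by_cases hyU : (extChartAt (𝓡 n) p).symm y ∈ U
      · rw [indicator_of_mem hy, indicator_of_mem hyU, indicator_of_mem (show y ∈ chartImage n p U from ⟨hy, hyU⟩),
          ENNReal.toReal_ofReal (Real.sqrt_nonneg _), smul_eq_mul]
      · rw [indicator_of_mem hy, indicator_of_notMem hyU, indicator_of_notMem fun h : y ∈ chartImage n p U => hyU h.2,
          smul_zero]
    · rw [indicator_of_notMem hy, indicator_of_notMem fun h : y ∈ chartImage n p U => hy h.1]
  · exact ((contDiffOn_sqrt_det p).continuousOn.aemeasurable hTm).ennreal_ofReal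
  · exact ae_of_all _ fun _ => ENNReal.ofReal_lt_top

theorem riemannianVolume_lt_top_of_isCompact {K : Set M} (hK : IsCompact K) :
    riemannianVolume n M K < ⊤ := by
  refine hK.measure_lt_top_of_nhdsWithin fun x _ => ?_
  have ho := isOpen_extChartAt_target (I := 𝓡 n) x
  obtain ⟨r, hr, hrb⟩ := Metric.nhds_basis_closedBall.mem_iff.1
    (ho.mem_nhds (mem_extChartAt_target (I := 𝓡 n) x))
  set B := Metric.closedBall (extChartAt (𝓡 n) x x) r
  refine ⟨(extChartAt (𝓡 n) x).source ∩ extChartAt (𝓡 n) x ⁻¹' B, mem_nhdsWithin_of_mem_nhds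
    (inter_mem (extChartAt_source_mem_nhds x)
      ((continuousAt_extChartAt x).preimage_mem_nhds (Metric.closedBall_mem_nhds _ hr))), ?_⟩
  rw [riemannianVolume_apply_of_subset x
    (measurableSet_source_inter_preimage x Metric.isClosed_closedBall.measurableSet) inter_subset_left]
  refine lt_of_le_of_lt (lintegral_mono_set (t := B) fun y hy => ?_) ?_
  · have h1 := hy.2.2
    rwa [mem_preimage, (extChartAt (𝓡 n) x).right_inv hy.1] at h1
  · exact (((contDiffOn_sqrt_det x).continuousOn.mono hrb).integrableOn_compact
      (isCompact_closedBall _ _)).lintegral_lt_top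

theorem riemannianVolume_singleton (hn : n ≠ 0) (x : M) : riemannianVolume n M {x} = 0 := by
  have : NeZero n := ⟨hn⟩
  have : Nonempty (Fin n) := ⟨0⟩
  refine riemannianVolume_eq_zero_of_chart x (by simp) ?_
  refine measure_mono_null (t := {extChartAt (𝓡 n) x x}) (fun y hy => ?_) (measure_singleton _)
  have h1 : (extChartAt (𝓡 n) x).symm y = x := hy.2
  have h2 := (extChartAt (𝓡 n) x).right_inv hy.1
  rwa [h1, eq_comm] at h2

theorem aemeasurable_inner [SecondCountableTopology M] (hU : IsOpen U)
    {V W : ∀ x : M, TangentSpace (𝓡 n) x}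
    (hV : ∀ p v, AEMeasurable (fun y => (inner ℝ (V ((extChartAt (𝓡 n) p).symm y))
      (coordVec n p v y) : ℝ)) (volume.restrict (chartImage n p U)))
    (hW : ∀ p v, AEMeasurable (fun y => (inner ℝ (W ((extChartAt (𝓡 n) p).symm y))
      (coordVec n p v y) : ℝ)) (volume.restrict (chartImage n p U))) :
    AEMeasurable (fun x => (inner ℝ (V x) (W x) : ℝ)) ((riemannianVolume n M).restrict U) := by
  refine aemeasurable_restrict_of_chart hU.measurableSet fun p => ?_
  have hm := measurableSet_chartImage (n := n) p hU.measurableSet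
  have h1 : AEMeasurable (fun y => ∑ i, ∑ j, (metricMatrix n p y)⁻¹ i j
      * inner ℝ (V ((extChartAt (𝓡 n) p).symm y)) (coordVec n p (EuclideanSpace.single i 1) y)
      * inner ℝ (W ((extChartAt (𝓡 n) p).symm y)) (coordVec n p (EuclideanSpace.single j 1) y))
      (volume.restrict (chartImage n p U)) :=
    Finset.aemeasurable_fun_sum _ fun i _ => Finset.aemeasurable_fun_sum _ fun j _ =>
      ((((contDiffOn_metricMatrix_inv p i j).continuousOn.mono inter_subset_left).aemeasurable
        hm).mul (hV p _)).mul (hW p _)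
  refine h1.congr ?_
  filter_upwards [ae_restrict_mem hm] with y hy
  rw [inner_eq_sum hy.1]

theorem aemeasurable_enorm [SecondCountableTopology M] (hU : IsOpen U)
    {V : ∀ x : M, TangentSpace (𝓡 n) x}
    (hV : ∀ p v, AEMeasurable (fun y => (inner ℝ (V ((extChartAt (𝓡 n) p).symm y))
      (coordVec n p v y) : ℝ)) (volume.restrict (chartImage n p U))) :
    AEMeasurable (fun x => ‖V x‖ₑ) ((riemannianVolume n M).restrict U) := by
  refine ((aemeasurable_inner hU hV hV).sqrt.ennreal_ofReal).congr (ae_of_all _ fun x => ?_)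
  simp only [real_inner_self_eq_norm_sq, Real.sqrt_sq (norm_nonneg _), ofReal_norm]

theorem HasWeakGrad.aemeasurable_inner_coordVec (h : HasWeakGrad n U f G) (p : M)
    (v : EuclideanSpace ℝ (Fin n)) :
    AEMeasurable (fun y => (inner ℝ (G ((extChartAt (𝓡 n) p).symm y))
      (coordVec n p v y) : ℝ)) (volume.restrict (chartImage n p U)) :=
  (h.locallyIntegrable_grad p v).aestronglyMeasurable.aemeasurable

theorem HasWeakGrad.aemeasurable [SecondCountableTopology M] (hU : IsOpen U)
    (h : HasWeakGrad n U f G) : AEMeasurable f ((riemannianVolume n M).restrict U) :=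
  aemeasurable_restrict_of_chart hU.measurableSet fun p =>
    (h.locallyIntegrable p).aestronglyMeasurable.aemeasurable

theorem aemeasurable_inner_grad_coordVec (hU : IsOpen U)
    (hu : ContMDiffOn (𝓡 n) 𝓘(ℝ, ℝ) 1 u U) (p : M) (v : EuclideanSpace ℝ (Fin n)) :
    AEMeasurable (fun y => (inner ℝ (grad n u ((extChartAt (𝓡 n) p).symm y))
      (coordVec n p v y) : ℝ)) (volume.restrict (chartImage n p U)) := by
  have h1 := contDiffOn_chart (by norm_cast) hu p
  have ho := isOpen_chartImage (n := n) p hU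
  have h2 : ContDiffOn ℝ 0 (fun y => fderiv ℝ (fun z => u ((extChartAt (𝓡 n) p).symm z)) y v)
      (chartImage n p U) :=
    (h1.fderiv_of_isOpen ho (m := 0) (by norm_num)).clm_apply contDiffOn_const
  refine (h2.continuousOn.congr fun y hy => inner_grad_coordVec hy.1 ?_ v).aemeasurable
    ho.measurableSet
  exact (hu.contMDiffAt (hU.mem_nhds hy.2)).mdifferentiableAt (by simp)

end

section

variable {n : ℕ} {M : Type*} [EMetricSpace M] [ChartedSpace (EuclideanSpace ℝ (Fin n)) M]
  [IsManifold (𝓡 n) ∞ M]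
  [RiemannianBundle (fun x : M => TangentSpace (𝓡 n) x)]
  {p q : M} {y : EuclideanSpace ℝ (Fin n)} {U : Set M} {f u : M → ℝ}
  {G H V : ∀ x : M, TangentSpace (𝓡 n) x}

theorem slope_pos (u : M → ℝ) (x : M) : 0 < slope n u x :=
  Real.sqrt_pos.2 (by positivity)

theorem grad_eq_zero_of_notMem_tsupport {x : M} (hx : x ∉ tsupport f) : grad n f x = 0 := by
  have h1 : f =ᶠ[𝓝 x] fun _ => (0 : ℝ) := notMem_tsupport_iff_eventuallyEq.1 hx
  have h2 : mfderiv (𝓡 n) 𝓘(ℝ, ℝ) f x = 0 := by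
    rw [h1.mfderiv_eq]
    exact mfderiv_const
  refine ext_inner_right ℝ fun w => ?_
  rw [inner_grad, h2, inner_zero_left]
  rfl

/-- The coefficient of `∂_j φ` in the coordinate expression of the minimal graph equation. -/
noncomputable def fluxCoeff (u : M → ℝ) (p : M) (j : Fin n) (y : EuclideanSpace ℝ (Fin n)) : ℝ :=
  √(metricMatrix n p y).det * ((∑ i, (metricMatrix n p y)⁻¹ i j
    * inner ℝ (grad n u ((extChartAt (𝓡 n) p).symm y))
      (coordVec n p (EuclideanSpace.single i 1) y)) / slope n u ((extChartAt (𝓡 n) p).symm y))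

variable [IsContMDiffRiemannianBundle (𝓡 n) ∞ (EuclideanSpace ℝ (Fin n))
      (fun x : M => TangentSpace (𝓡 n) x)]

theorem continuousOn_fluxCoeff (hU : IsOpen U) (hu : ContMDiffOn (𝓡 n) 𝓘(ℝ, ℝ) 2 u U) (p : M)
    (j : Fin n) : ContinuousOn (fluxCoeff u p j) (chartImage n p U) := by
  refine ((contDiffOn_sqrt_det p).continuousOn.mono inter_subset_left).mul
    (ContinuousOn.div ?_ (contDiffOn_slope hU hu p).continuousOn fun _ _ => (slope_pos _ _).ne')
  exact continuousOn_finsetSum _ fun i _ =>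
    ((contDiffOn_metricMatrix_inv p i j).continuousOn.mono inter_subset_left).mul
      (contDiffOn_inner_grad hU hu p _).continuousOn

variable [MeasurableSpace M] [BorelSpace M]

theorem integral_flux_chart (hU : IsOpen U) (hu : ContMDiffOn (𝓡 n) 𝓘(ℝ, ℝ) 2 u U) (p : M)
    (hV : ∀ x ∈ U, x ∉ (extChartAt (𝓡 n) p).source → V x = 0)
    (hVm : ∀ v, AEMeasurable (fun y => (inner ℝ (V ((extChartAt (𝓡 n) p).symm y))
      (coordVec n p v y) : ℝ)) (volume.restrict (chartImage n p U))) :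
    ∫ x in U, inner ℝ (grad n u x) (V x) / slope n u x ∂(riemannianVolume n M)
      = ∫ y in chartImage n p U, ∑ j, inner ℝ (V ((extChartAt (𝓡 n) p).symm y))
        (coordVec n p (EuclideanSpace.single j 1) y) * fluxCoeff u p j y := by
  have hm := measurableSet_chartImage (n := n) p hU.measurableSet
  have hSm : MeasurableSet (extChartAt (𝓡 n) p).source := (isOpen_extChartAt_source p).measurableSet
  have hpt : ∀ y ∈ chartImage n p U, √(metricMatrix n p y).det *
      (inner ℝ (grad n u ((extChartAt (𝓡 n) p).symm y)) (V ((extChartAt (𝓡 n) p).symm y))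
        / slope n u ((extChartAt (𝓡 n) p).symm y))
      = ∑ j, inner ℝ (V ((extChartAt (𝓡 n) p).symm y))
        (coordVec n p (EuclideanSpace.single j 1) y) * fluxCoeff u p j y := by
    intro y hy
    rw [inner_eq_sum hy.1, Finset.sum_comm, Finset.sum_div, Finset.mul_sum]
    refine Finset.sum_congr rfl fun j _ => ?_
    rw [fluxCoeff, ← Finset.sum_mul]
    ring
  have hmeas : AEMeasurable (fun y => ∑ j, inner ℝ (V ((extChartAt (𝓡 n) p).symm y))
        (coordVec n p (EuclideanSpace.single j 1) y) * fluxCoeff u p j y)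
      (volume.restrict (chartImage n p U)) :=
    Finset.aemeasurable_fun_sum _ fun j _ => (hVm _).mul
      ((continuousOn_fluxCoeff hU hu p j).aemeasurable hm)
  have hD : ContinuousOn (fun y => (√(metricMatrix n p y).det)⁻¹) (chartImage n p U) :=
    ((contDiffOn_sqrt_det p).continuousOn.mono inter_subset_left).inv₀ fun y hy =>
      (Real.sqrt_pos.2 (metricMatrix_posDef hy.1).det_pos).ne'
  rw [setIntegral_eq_of_subset_of_forall_sdiff_eq_zero hU.measurableSet
    (inter_subset_left (t := (extChartAt (𝓡 n) p).source))
    (fun x hx => by rw [hV x hx.1 fun h => hx.2 ⟨hx.1, h⟩, inner_zero_right, zero_div]),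
    setIntegral_inter_source hU.measurableSet]
  · exact setIntegral_congr_fun hm hpt
  · refine ((hD.aemeasurable hm).mul hmeas).congr ?_
    filter_upwards [ae_restrict_mem hm] with y hy
    rw [Pi.mul_apply, ← hpt y hy, inv_mul_cancel_left₀ (Real.sqrt_pos.2 (metricMatrix_posDef hy.1).det_pos).ne']

theorem IsMinimalGraphSolution.integral_chart_eq_zero (hU : IsOpen U)
    (hu : ContMDiffOn (𝓡 n) 𝓘(ℝ, ℝ) 2 u U) (hs : IsMinimalGraphSolution n U u) (p : M)
    {ψ : EuclideanSpace ℝ (Fin n) → ℝ} (hψ : ContDiff ℝ ∞ ψ)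
    (hc : HasCompactSupport ψ) (hψs : tsupport ψ ⊆ chartImage n p U) :
    ∫ y in chartImage n p U, ∑ j, fderiv ℝ ψ y (EuclideanSpace.single j 1) * fluxCoeff u p j y
      = 0 := by
  have ht := isTestFunction_chart p hψ hc hψs
  set φ := (extChartAt (𝓡 n) p).source.indicator fun x => ψ (extChartAt (𝓡 n) p x) with hφ
  have ho := isOpen_chartImage (n := n) p hU
  have hd : ∀ y ∈ chartImage n p U, ∀ v, inner ℝ (grad n φ ((extChartAt (𝓡 n) p).symm y))
      (coordVec n p v y) = fderiv ℝ ψ y v := by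
    intro y hy v
    rw [inner_grad_coordVec hy.1 (ht.contMDiff.mdifferentiableAt (by simp))]
    have h1 : (fun z => φ ((extChartAt (𝓡 n) p).symm z)) =ᶠ[𝓝 y] ψ := by
      filter_upwards [ho.mem_nhds hy] with z hz
      rw [hφ, indicator_of_mem ((extChartAt (𝓡 n) p).map_target hz.1),
        (extChartAt (𝓡 n) p).right_inv hz.1]
    rw [h1.fderiv_eq]
  have h1 := hs φ ⟨ht.contMDiff, ht.hasCompactSupport, ht.tsupport_subset.trans inter_subset_left⟩
  rw [integral_flux_chart hU hu p
    (fun x _ hx => grad_eq_zero_of_notMem_tsupport fun h => hx (ht.tsupport_subset h).2)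
    (fun v => aemeasurable_inner_grad_coordVec hU (ht.contMDiff.of_le (by simp)).contMDiffOn p v)]
    at h1
  rw [← h1]
  refine setIntegral_congr_fun ho.measurableSet fun y hy => ?_
  simp only [hd y hy]

theorem IsMinimalGraphSolution.integral_eq_zero_of_subset_source (hU : IsOpen U)
    (hu : ContMDiffOn (𝓡 n) 𝓘(ℝ, ℝ) 2 u U) (hs : IsMinimalGraphSolution n U u)
    (hf : HasWeakGrad n U f H) (p : M) {K : Set M} (hK : IsCompact K)
    (hKU : K ⊆ U ∩ (extChartAt (𝓡 n) p).source) (hfK : ∀ x ∉ K, f x = 0)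
    (hHK : ∀ x ∉ K, H x = 0) :
    ∫ x in U, inner ℝ (grad n u x) (H x) / slope n u x ∂(riemannianVolume n M) = 0 := by
  have ho := isOpen_chartImage (n := n) p hU
  set K₁ := extChartAt (𝓡 n) p '' K with hK₁
  have hK₁c : IsCompact K₁ := hK.image_of_continuousOn
    ((continuousOn_extChartAt p).mono fun x hx => (hKU hx).2)
  have hK₁Ω : K₁ ⊆ chartImage n p U := by
    rintro _ ⟨x, hx, rfl⟩
    refine ⟨(extChartAt (𝓡 n) p).map_source (hKU hx).2, ?_⟩
    rw [mem_preimage, (extChartAt (𝓡 n) p).left_inv (hKU hx).2]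
    exact (hKU hx).1
  have hmem : ∀ y ∈ chartImage n p U, y ∉ K₁ → (extChartAt (𝓡 n) p).symm y ∉ K :=
    fun y hy hyK h => hyK ⟨_, h, (extChartAt (𝓡 n) p).right_inv hy.1⟩
  set F := K₁.indicator fun y => f ((extChartAt (𝓡 n) p).symm y) with hF
  set g : EuclideanSpace ℝ (Fin n) → EuclideanSpace ℝ (Fin n) → ℝ := fun v => K₁.indicator fun y =>
    (inner ℝ (H ((extChartAt (𝓡 n) p).symm y)) (coordVec n p v y) : ℝ) with hg
  have hgΩ : ∀ v, ∀ y ∈ chartImage n p U, g v y =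
      inner ℝ (H ((extChartAt (𝓡 n) p).symm y)) (coordVec n p v y) := by
    intro v y hy
    by_cases hyK : y ∈ K₁
    · exact indicator_of_mem hyK _
    · rw [hg]
      beta_reduce
      rw [indicator_of_notMem hyK, hHK _ (hmem y hy hyK), inner_zero_left]
  have hw : ∀ v, HasWeakDeriv volume univ F (g v) v := by
    intro v
    refine ((hf.hasWeakDeriv p v).congr ho (fun y hy => ?_) (hgΩ v)).extend ho hK₁c hK₁Ω
      (fun y hy => indicator_of_notMem hy _) (fun y hy => indicator_of_notMem hy _)
    by_cases hyK : y ∈ K₁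
    · exact indicator_of_mem hyK _
    · rw [hF, indicator_of_notMem hyK, hfK _ (hmem y hy hyK)]
  have hint : ∀ {a : EuclideanSpace ℝ (Fin n) → ℝ}, LocallyIntegrableOn (K₁.indicator a) univ →
      Integrable (K₁.indicator a) := by
    intro a ha
    rw [← integrableOn_iff_integrable_of_support_subset (support_indicator_subset)]
    exact (locallyIntegrableOn_univ.1 ha).integrableOn_isCompact hK₁c
  have hFi : Integrable F := hint (hw 0).locallyIntegrableOn
  have hgi : ∀ v, Integrable (g v) := fun v => hint (hw v).locallyIntegrableOn_deriv
  have hFc : HasCompactSupport F := HasCompactSupport.intro hK₁c fun y hy => indicator_of_notMem hy _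
  have hFt : tsupport F ⊆ K₁ := closure_minimal support_indicator_subset hK₁c.isClosed
  obtain ⟨K', hK'c, hKK', hK'Ω⟩ := exists_compact_between hK₁c ho hK₁Ω
  have hb : ∀ j, ∃ C, ∀ y, ‖K'.indicator (fluxCoeff u p j) y‖ ≤ C := by
    intro j
    obtain ⟨C, hC⟩ := hK'c.exists_bound_of_continuousOn
      ((continuousOn_fluxCoeff hU hu p j).mono hK'Ω)
    refine ⟨max C 0, fun y => ?_⟩
    by_cases hy : y ∈ K'
    · rw [indicator_of_mem hy]
      exact (hC y hy).trans (le_max_left _ _)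
    · rw [indicator_of_notMem hy, norm_zero]
      exact le_max_right _ _
  choose C hC using hb
  have hbm : ∀ j, AEStronglyMeasurable (K'.indicator (fluxCoeff u p j)) :=
    fun j => (aestronglyMeasurable_indicator_iff hK'c.measurableSet).2
      (((continuousOn_fluxCoeff hU hu p j).mono hK'Ω).aestronglyMeasurable hK'c.measurableSet)
  have hsum : ∀ {c : Fin n → EuclideanSpace ℝ (Fin n) → ℝ}, (∀ j, Integrable (c j)) →
      (∀ j, ∀ y ∉ K', c j y = 0) →
      ∫ y in chartImage n p U, ∑ j, c j y * fluxCoeff u p j y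
        = ∑ j, ∫ y, c j y * K'.indicator (fluxCoeff u p j) y := by
    intro c hci hc0
    rw [← integral_finsetSum _ fun j _ => (hci j).mul_bdd (hbm j) (ae_of_all _ (hC j)),
      ← integral_indicator ho.measurableSet]
    congr 1
    ext y
    by_cases hy : y ∈ K'
    · rw [indicator_of_mem (hK'Ω hy)]
      simp only [indicator_of_mem hy]
    · simp only [hc0 _ y hy, zero_mul, Finset.sum_const_zero]
      simp [indicator, hc0 _ y hy]
  rw [integral_flux_chart hU hu p (fun x _ hx => hHK x fun h => hx (hKU h).2)
    (hf.aemeasurable_inner_coordVec p)]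
  have e1 : ∫ y in chartImage n p U, ∑ j, inner ℝ (H ((extChartAt (𝓡 n) p).symm y))
        (coordVec n p (EuclideanSpace.single j 1) y) * fluxCoeff u p j y
      = ∑ j, ∫ y, g (EuclideanSpace.single j 1) y * K'.indicator (fluxCoeff u p j) y := by
    rw [← hsum (fun j => hgi _)
      fun j y hy => indicator_of_notMem (fun h => hy (interior_subset (hKK' h))) _]
    refine setIntegral_congr_fun ho.measurableSet fun y hy => ?_
    simp only [hgΩ _ y hy]
  rw [e1]
  refine tendsto_nhds_unique (tendsto_finsetSum _ fun j _ =>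
    tendsto_integral_mul_of_tendsto_integral_norm_sub
      (fun k => integrable_mollify k (hgi (EuclideanSpace.single j 1))) (hgi _)
      (tendsto_integral_norm_mollify_sub (hgi _)) (hbm j) (hC j)) (tendsto_const_nhds.congr' ?_)
  filter_upwards [eventually_tsupport_mollify_subset (μ := volume) hFc isOpen_interior
    (hFt.trans hKK')] with k hk
  rw [← hsum (fun j => integrable_mollify k (hgi _))]
  · rw [← hs.integral_chart_eq_zero hU hu p (contDiff_mollify k hFi.locallyIntegrable)
      (hasCompactSupport_mollify k hFc) (hk.trans (interior_subset.trans hK'Ω))]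
    simp only [(hw _).fderiv_mollify]
  · intro j y hy
    rw [← (hw _).fderiv_mollify]
    have : fderiv ℝ (mollify volume k F) y = 0 := by
      by_contra h
      exact hy (interior_subset (hk (support_fderiv_subset ℝ h)))
    rw [this, zero_apply]

end

section

variable {n : ℕ} {M : Type*} [EMetricSpace M] [ChartedSpace (EuclideanSpace ℝ (Fin n)) M]
  [IsManifold (𝓡 n) ∞ M]
  [RiemannianBundle (fun x : M => TangentSpace (𝓡 n) x)]
  {U : Set M} {f u : M → ℝ} {G H V : ∀ x : M, TangentSpace (𝓡 n) x}

variable (n) in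
theorem exists_eq_chart_symm (x : M) :
    ∃ (p : M) (y : EuclideanSpace ℝ (Fin n)),
      y ∈ (extChartAt (𝓡 n) p).target ∧ (extChartAt (𝓡 n) p).symm y = x :=
  ⟨x, _, mem_extChartAt_target x, (extChartAt (𝓡 n) x).left_inv (mem_extChartAt_source x)⟩

theorem sum_grad_eq_zero {ι : Type*} [Fintype ι] {χ : ι → M → ℝ} {c : ℝ} {x : M}
    (hχ : ∀ i, MDifferentiable (𝓡 n) 𝓘(ℝ, ℝ) (χ i)) (h : ∀ᶠ z in 𝓝 x, ∑ i, χ i z = c) :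
    ∑ i, grad n (χ i) x = 0 := by
  obtain ⟨p, y, hy, rfl⟩ := exists_eq_chart_symm n x
  refine ext_inner_right ℝ fun V => ?_
  obtain ⟨v, rfl⟩ := exists_eq_coordVec hy V
  have hc : ContinuousAt (extChartAt (𝓡 n) p).symm y :=
    (continuousOn_extChartAt_symm p).continuousAt ((isOpen_extChartAt_target p).mem_nhds hy)
  have hd : ∀ i, DifferentiableAt ℝ (fun z => χ i ((extChartAt (𝓡 n) p).symm z)) y := fun i =>
    ((hχ i _).comp y (mdifferentiableAt_extChartAt_symm hy)).differentiableAt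
  have h1 : (fun z => ∑ i, χ i ((extChartAt (𝓡 n) p).symm z)) =ᶠ[𝓝 y] fun _ => c :=
    hc.eventually h
  have h2 := h1.fderiv_eq (𝕜 := ℝ)
  rw [fderiv_fun_sum fun i _ => hd i, fderiv_fun_const] at h2
  rw [sum_inner, inner_zero_left]
  simp only [inner_grad_coordVec hy (hχ _ _)]
  simpa using congrArg (fun L : EuclideanSpace ℝ (Fin n) →L[ℝ] ℝ => L v) h2

variable [IsContMDiffRiemannianBundle (𝓡 n) ∞ (EuclideanSpace ℝ (Fin n))
      (fun x : M => TangentSpace (𝓡 n) x)]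

theorem continuousOn_inner_grad_div_slope (hU : IsOpen U) (hu : ContMDiffOn (𝓡 n) 𝓘(ℝ, ℝ) 2 u U)
    {a : M → ℝ} (ha : ContMDiff (𝓡 n) 𝓘(ℝ, ℝ) ∞ a) :
    ContinuousOn (fun x => inner ℝ (grad n u x) (grad n a x) / slope n u x) U := by
  refine continuousOn_of_chart hU fun p => ContinuousOn.div ?_
    (contDiffOn_slope hU hu p).continuousOn fun _ _ => (slope_pos _ _).ne'
  have h1 : ContinuousOn (fun y => ∑ i, ∑ j, (metricMatrix n p y)⁻¹ i j
      * inner ℝ (grad n u ((extChartAt (𝓡 n) p).symm y)) (coordVec n p (EuclideanSpace.single i 1) y)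
      * inner ℝ (grad n a ((extChartAt (𝓡 n) p).symm y))
        (coordVec n p (EuclideanSpace.single j 1) y)) (chartImage n p U) :=
    continuousOn_finsetSum _ fun i _ => continuousOn_finsetSum _ fun j _ =>
      (((contDiffOn_metricMatrix_inv p i j).continuousOn.mono inter_subset_left).mul
        (contDiffOn_inner_grad hU hu p _).continuousOn).mul
        (contDiffOn_inner_grad hU (ha.of_le (by norm_cast)).contMDiffOn p _).continuousOn
  exact h1.congr fun y hy => inner_eq_sum hy.1 _ _

variable [MeasurableSpace M] [BorelSpace M] [SecondCountableTopology M]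

/-- A solution of the minimal graph equation can be tested with weakly differentiable functions of
compact support. -/
theorem IsMinimalGraphSolution.integral_eq_zero (hU : IsOpen U)
    (hu : ContMDiffOn (𝓡 n) 𝓘(ℝ, ℝ) 2 u U) (hs : IsMinimalGraphSolution n U u)
    (hf : HasWeakGrad n U f H) {K : Set M} (hK : IsCompact K)
    (hKU : K ⊆ U) (hfK : ∀ x ∉ K, f x = 0) (hHK : ∀ x ∉ K, H x = 0)
    (hfi : IntegrableOn f U (riemannianVolume n M))
    (hHi : IntegrableOn (fun x => inner ℝ (grad n u x) (H x) / slope n u x) U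
      (riemannianVolume n M)) :
    ∫ x in U, inner ℝ (grad n u x) (H x) / slope n u x ∂(riemannianVolume n M) = 0 := by
  have := ChartedSpace.locallyCompactSpace (EuclideanSpace ℝ (Fin n)) M
  obtain ⟨K', hK'c, hKK', hK'U⟩ := exists_compact_between hK hU hKU
  obtain ⟨t, -, ht⟩ := hK'c.elim_nhds_subcover (fun p => (extChartAt (𝓡 n) p).source)
    fun p _ => extChartAt_source_mem_nhds (I := 𝓡 n) p
  obtain ⟨χ, hχ⟩ := SmoothPartitionOfUnity.exists_isSubordinate (𝓡 n) hK'c.isClosed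
    (fun p : t => (extChartAt (𝓡 n) (p : M)).source) (fun p => isOpen_extChartAt_source _)
    (ht.trans (iUnion₂_subset fun p hp => subset_iUnion_of_subset ⟨p, hp⟩ subset_rfl))
  have hχs : ∀ i, ContMDiff (𝓡 n) 𝓘(ℝ, ℝ) ∞ (χ i) := fun i => (χ i).contMDiff
  have hsum1 : ∀ x ∈ K', ∑ i, χ i x = 1 := fun x hx => by
    rw [← finsum_eq_sum_of_fintype, χ.sum_eq_one hx]
  have hpart : ∀ i, ∫ x in U, inner ℝ (grad n u x) (χ i x • H x + f x • grad n (χ i) x)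
      / slope n u x ∂(riemannianVolume n M) = 0 := by
    intro i
    refine hs.integral_eq_zero_of_subset_source hU hu
      (hf.mul_contMDiffOn hU ((hχs i).of_le (by simp)).contMDiffOn) i
      (hK.inter_right (isClosed_tsupport (χ i)))
      (fun x hx => ⟨hKU hx.1, hχ i hx.2⟩) (fun x hx => ?_) (fun x hx => ?_)
    all_goals
      by_cases hxK : x ∈ K
      · have hxt : x ∉ tsupport (χ i) := fun h => hx ⟨hxK, h⟩
        simp [image_eq_zero_of_notMem_tsupport hxt, grad_eq_zero_of_notMem_tsupport hxt]
      · simp [hfK x hxK, hHK x hxK]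
  have hint : ∀ i, IntegrableOn (fun x => inner ℝ (grad n u x) (χ i x • H x + f x • grad n (χ i) x)
      / slope n u x) U (riemannianVolume n M) := by
    intro i
    have h1 : IntegrableOn (fun x => (inner ℝ (grad n u x) (H x) / slope n u x) * χ i x) U
        (riemannianVolume n M) :=
      Integrable.mul_bdd (c := 1) hHi ((hχs i).continuous.aestronglyMeasurable)
        (ae_of_all _ fun x => by
          rw [Real.norm_of_nonneg (χ.nonneg i x)]
          exact χ.le_one i x)
    have hco := continuousOn_inner_grad_div_slope hU hu (hχs i)
    obtain ⟨C, hC⟩ := hK.exists_bound_of_continuousOn (hco.mono hKU)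
    have h2 : IntegrableOn (fun x => f x * K.indicator (fun x =>
        inner ℝ (grad n u x) (grad n (χ i) x) / slope n u x) x) U (riemannianVolume n M) := by
      refine Integrable.mul_bdd (c := max C 0) hfi ?_ (ae_of_all _ fun x => ?_)
      · exact (hco.aestronglyMeasurable hU.measurableSet).indicator hK.measurableSet
      · by_cases hx : x ∈ K
        · rw [indicator_of_mem hx]
          exact (hC x hx).trans (le_max_left _ _)
        · rw [indicator_of_notMem hx, norm_zero]
          exact le_max_right _ _
    refine (h1.add h2).congr (ae_of_all _ fun x => ?_)
    by_cases hx : x ∈ K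
    · simp only [Pi.add_apply, indicator_of_mem hx, inner_add_right, real_inner_smul_right]
      ring
    · simp [hfK x hx, hHK x hx]
  have key : ∀ x, ∑ i, inner ℝ (grad n u x) (χ i x • H x + f x • grad n (χ i) x) / slope n u x
      = inner ℝ (grad n u x) (H x) / slope n u x := by
    intro x
    rw [← Finset.sum_div, ← inner_sum, Finset.sum_add_distrib, ← Finset.sum_smul,
      ← Finset.smul_sum]
    by_cases hx : x ∈ K
    · rw [hsum1 x (interior_subset (hKK' hx)), sum_grad_eq_zero (c := 1)
        (fun i => (hχs i).mdifferentiable (by simp)), one_smul, smul_zero, add_zero]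
      filter_upwards [isOpen_interior.mem_nhds (hKK' hx)] with z hz
      exact hsum1 z (interior_subset hz)
    · rw [hfK x hx, hHK x hx, smul_zero, zero_smul, add_zero]
  simp only [← key]
  rw [integral_finsetSum _ fun i _ => hint i]
  exact Finset.sum_eq_zero fun i _ => hpart i

end

theorem measurable_real_sign : Measurable Real.sign :=
  Measurable.ite measurableSet_Iio measurable_const
    (Measurable.ite measurableSet_Ioi measurable_const measurable_const)

theorem norm_real_sign_le_one (t : ℝ) : ‖Real.sign t‖ ≤ 1 := by
  rcases Real.sign_apply_eq t with h | h | h <;> simp [h]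

theorem _root_.MeasureTheory.LocallyIntegrableOn.mul_bdd {E : Type*} [TopologicalSpace E]
    [LocallyCompactSpace E] [MeasurableSpace E] [OpensMeasurableSpace E] {μ : Measure E} {Ω : Set E}
    {f b : E → ℝ} {C : ℝ} (hΩ : IsOpen Ω)
    (h : LocallyIntegrableOn f Ω μ) (hb : AEStronglyMeasurable b (μ.restrict Ω))
    (hC : ∀ y, ‖b y‖ ≤ C) : LocallyIntegrableOn (fun y => f y * b y) Ω μ := by
  rw [locallyIntegrableOn_iff hΩ.isLocallyClosed] at h ⊢
  exact fun K hK hKc => Integrable.mul_bdd (h K hK hKc)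
    (hb.mono_measure (Measure.restrict_mono hK le_rfl)) (ae_of_all _ hC)

section

variable {n : ℕ} {M : Type*} [EMetricSpace M] [ChartedSpace (EuclideanSpace ℝ (Fin n)) M]
  [IsManifold (𝓡 n) ∞ M]
  [RiemannianBundle (fun x : M => TangentSpace (𝓡 n) x)]
  {U : Set M} {f u : M → ℝ} {G H V : ∀ x : M, TangentSpace (𝓡 n) x}

theorem eq_of_inner_coordVec {p : M} {y : EuclideanSpace ℝ (Fin n)}
    (hy : y ∈ (extChartAt (𝓡 n) p).target)
    {V W : TangentSpace (𝓡 n) ((extChartAt (𝓡 n) p).symm y)}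
    (h : ∀ v, inner ℝ V (coordVec n p v y) = inner ℝ W (coordVec n p v y)) : V = W := by
  refine ext_inner_right ℝ fun X => ?_
  obtain ⟨v, rfl⟩ := exists_eq_coordVec hy X
  exact h v

theorem grad_comp {S : ℝ → ℝ} {x : M} (hS : DifferentiableAt ℝ S (f x))
    (hf : MDifferentiableAt (𝓡 n) 𝓘(ℝ, ℝ) f x) :
    grad n (fun z => S (f z)) x = deriv S (f x) • grad n f x := by
  obtain ⟨p, y, hy, rfl⟩ := exists_eq_chart_symm n x
  have hd : DifferentiableAt ℝ (fun z => f ((extChartAt (𝓡 n) p).symm z)) y :=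
    (hf.comp y (mdifferentiableAt_extChartAt_symm hy)).differentiableAt
  have hc := hS.hasDerivAt.comp_hasFDerivAt y hd.hasFDerivAt
  refine eq_of_inner_coordVec hy fun v => ?_
  rw [real_inner_smul_left, inner_grad_coordVec hy hf, inner_grad_coordVec hy
    (mdifferentiableAt_of_chart hy hc.differentiableAt)]
  exact congrArg (fun L : EuclideanSpace ℝ (Fin n) →L[ℝ] ℝ => L v) hc.fderiv

theorem HasWeakGrad.comp (hU : IsOpen U) (h : HasWeakGrad n U f G) {T κ : ℝ → ℝ}
    (hT : ∀ t, HasDerivAt T (κ t) t) (hκ : Continuous κ) {C : ℝ} (hC : ∀ t, ‖κ t‖ ≤ C) :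
    HasWeakGrad n U (fun x => T (f x)) (fun x => κ (f x) • G x) :=
  hasWeakGrad_of_chart fun p v =>
    ((h.hasWeakDeriv p v).comp (isOpen_chartImage p hU) hT hκ hC).congr (isOpen_chartImage p hU)
      (fun _ _ => rfl) fun _ _ => real_inner_smul_left _ _ _

/-- A weakly differentiable function that vanishes where `z < ε` may be multiplied by the sign of a
function all of whose zeros lie there, `z` being continuous away from a point. -/
theorem HasWeakGrad.sign_mul (hn : 2 ≤ n) (hU : IsOpen U) (h : HasWeakGrad n U f G)
    {w z : M → ℝ} {ε C : ℝ} {o : M} (hw : ContinuousOn w U) (hz : ContinuousOn z (U \ {o}))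
    (hwz : ∀ x ∈ U, w x = 0 → z x < ε) (hf : ∀ x ∈ U, z x < ε → f x = 0)
    (hG : ∀ x ∈ U, z x < ε → G x = 0) (hC : ∀ x ∈ U, ‖f x‖ ≤ C) :
    HasWeakGrad n U (fun x => Real.sign (w x) * f x) (fun x => Real.sign (w x) • G x) := by
  refine hasWeakGrad_of_chart fun p v => ?_
  have ho := isOpen_chartImage (n := n) p hU
  have hsub : chartImage n p U \ {extChartAt (𝓡 n) p o} ⊆ chartImage n p (U \ {o}) := by
    rintro y ⟨hy, hyo⟩
    refine ⟨hy.1, hy.2, fun h => hyo ?_⟩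
    rw [mem_singleton_iff] at h ⊢
    rw [← h, (extChartAt (𝓡 n) p).right_inv hy.1]
  have hsm : AEStronglyMeasurable (fun y => Real.sign (w ((extChartAt (𝓡 n) p).symm y)))
      (volume.restrict (chartImage n p U)) :=
    (measurable_real_sign.comp_aemeasurable
      ((continuousOn_chart hw p).aemeasurable ho.measurableSet)).aestronglyMeasurable
  refine HasWeakDeriv.of_sdiff_singleton (by simpa using hn) (c := extChartAt (𝓡 n) p o) (C := C)
    ?_ ?_ ?_ fun y hy => ?_
  · refine (((h.hasWeakDeriv p v).mono sdiff_subset).sign_mul (ho.sdiff isClosed_singleton)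
      ((continuousOn_chart hw p).mono sdiff_subset) ((continuousOn_chart hz p).mono hsub)
      (fun y hy => hwz _ hy.1.2) (fun y hy => hf _ hy.1.2) fun y hy hyz => ?_).congr
      (ho.sdiff isClosed_singleton) (fun _ _ => rfl) fun _ _ => real_inner_smul_left _ _ _
    rw [hG _ hy.1.2 hyz, inner_zero_left]
  · simpa only [mul_comm] using (h.locallyIntegrable p).mul_bdd ho hsm fun _ =>
      norm_real_sign_le_one _
  · simpa only [mul_comm, real_inner_smul_left] using (h.locallyIntegrable_grad p v).mul_bdd ho hsm
      fun _ => norm_real_sign_le_one _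
  · rw [norm_mul]
    exact (mul_le_of_le_one_left (norm_nonneg _) (norm_real_sign_le_one _)).trans (hC _ hy.2)

theorem norm_inner_grad_div_slope_le (u : M → ℝ) (x : M) (V : TangentSpace (𝓡 n) x) :
    ‖inner ℝ (grad n u x) V / slope n u x‖ ≤ ‖V‖ := by
  have h1 : ‖grad n u x‖ ≤ slope n u x :=
    Real.le_sqrt_of_sq_le (by linarith)
  rw [norm_div, Real.norm_of_nonneg (slope_pos u x).le, div_le_iff₀ (slope_pos u x), mul_comm]
  exact (norm_inner_le_norm _ _).trans (by gcongr)

variable [IsContMDiffRiemannianBundle (𝓡 n) ∞ (EuclideanSpace ℝ (Fin n))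
      (fun x : M => TangentSpace (𝓡 n) x)]
variable [MeasurableSpace M] [BorelSpace M] [SecondCountableTopology M]

theorem aemeasurable_flux (hU : IsOpen U) (hu : ContMDiffOn (𝓡 n) 𝓘(ℝ, ℝ) 2 u U)
    (hV : ∀ p v, AEMeasurable (fun y => (inner ℝ (V ((extChartAt (𝓡 n) p).symm y))
      (coordVec n p v y) : ℝ)) (volume.restrict (chartImage n p U))) :
    AEMeasurable (fun x => inner ℝ (grad n u x) (V x) / slope n u x)
      ((riemannianVolume n M).restrict U) :=
  (aemeasurable_inner hU (aemeasurable_inner_grad_coordVec hU (hu.of_le (by norm_cast))) hV).div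
    ((continuousOn_of_chart hU fun p => (contDiffOn_slope hU hu p).continuousOn).aemeasurable
      hU.measurableSet)

theorem integrableOn_flux_of_sq (hU : IsOpen U) (hUm : riemannianVolume n M U ≠ ⊤)
    (hu : ContMDiffOn (𝓡 n) 𝓘(ℝ, ℝ) 2 u U)
    (hV : ∀ p v, AEMeasurable (fun y => (inner ℝ (V ((extChartAt (𝓡 n) p).symm y))
      (coordVec n p v y) : ℝ)) (volume.restrict (chartImage n p U)))
    (hV2 : ∫⁻ x in U, ‖V x‖ₑ ^ 2 ∂(riemannianVolume n M) < ⊤) :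
    IntegrableOn (fun x => inner ℝ (grad n u x) (V x) / slope n u x) U (riemannianVolume n M) := by
  refine ⟨(aemeasurable_flux hU hu hV).aestronglyMeasurable, ?_⟩
  refine lt_of_le_of_lt (b := ∫⁻ x in U, (1 + ‖V x‖ₑ ^ 2) ∂(riemannianVolume n M))
    (lintegral_mono fun x => ?_) ?_
  · have h1 : ‖inner ℝ (grad n u x) (V x) / slope n u x‖ₑ ≤ ‖V x‖ₑ := by
      rw [← ofReal_norm, ← ofReal_norm]
      exact ENNReal.ofReal_le_ofReal (norm_inner_grad_div_slope_le u x (V x))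
    refine h1.trans ?_
    rcases le_total ‖V x‖ₑ 1 with h | h
    · exact h.trans le_self_add
    · exact (le_self_pow₀ h two_ne_zero).trans le_add_self
  · rw [lintegral_add_left measurable_const, setLIntegral_const, one_mul]
    exact ENNReal.add_lt_top.2 ⟨hUm.lt_top, hV2⟩

theorem IsTestFunction.integrableOn_flux {φ : M → ℝ} (hφ : IsTestFunction n U φ) (hU : IsOpen U)
    (hUm : riemannianVolume n M U ≠ ⊤) (hu : ContMDiffOn (𝓡 n) 𝓘(ℝ, ℝ) 2 u U) :
    IntegrableOn (fun x => inner ℝ (grad n u x) (grad n φ x) / slope n u x) U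
      (riemannianVolume n M) := by
  have hco := continuousOn_inner_grad_div_slope hU hu hφ.contMDiff
  obtain ⟨C, hC⟩ := hφ.hasCompactSupport.isCompact.exists_bound_of_continuousOn
    (hco.mono hφ.tsupport_subset)
  have : IsFiniteMeasure ((riemannianVolume n M).restrict U) := ⟨by
    rw [Measure.restrict_apply_univ]; exact hUm.lt_top⟩
  refine Integrable.of_bound (hco.aestronglyMeasurable hU.measurableSet) (max C 0)
    (ae_of_all _ fun x => ?_)
  by_cases hx : x ∈ tsupport φ
  · exact (hC x hx).trans (le_max_left _ _)
  · rw [grad_eq_zero_of_notMem_tsupport hx, inner_zero_right, zero_div, norm_zero]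
    exact le_max_right _ _

/-- The minimal graph equation tested with `sign w · S(φ) · T(f)`. -/
theorem IsMinimalGraphSolution.integral_sign_mul_eq_zero (hn : 2 ≤ n) (hU : IsOpen U)
    (hUm : riemannianVolume n M U ≠ ⊤)
    (hu : ContMDiffOn (𝓡 n) 𝓘(ℝ, ℝ) 2 u U) (hs : IsMinimalGraphSolution n U u) {w : M → ℝ} {o : M}
    (hw : ContinuousOn w U) (hfc : ContinuousOn f (U \ {o})) (hwf : ∀ x ∈ U, w x = 0 → f x = 0)
    (hf : HasW12Grad n U f G) {φ : M → ℝ} (hφ : IsTestFunction n U φ) {T κ S : ℝ → ℝ}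
    {CT Cκ CS CS' ε : ℝ} (hT : ∀ t, HasDerivAt T (κ t) t) (hκ : Continuous κ)
    (hCT : ∀ t, ‖T t‖ ≤ CT) (hCκ : ∀ t, ‖κ t‖ ≤ Cκ) (hε : 0 < ε) (hTε : ∀ t < ε, T t = 0)
    (hκε : ∀ t < ε, κ t = 0) (hS : ContDiff ℝ ∞ S) (hS0 : S 0 = 0) (hCS : ∀ t, ‖S t‖ ≤ CS)
    (hCS' : ∀ t, ‖deriv S t‖ ≤ CS') :
    ∫ x in U, Real.sign (w x) * (S (φ x) * κ (f x) * (inner ℝ (grad n u x) (G x) / slope n u x)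
      + T (f x) * deriv S (φ x) * (inner ℝ (grad n u x) (grad n φ x) / slope n u x))
      ∂(riemannianVolume n M) = 0 := by
  have : IsFiniteMeasure ((riemannianVolume n M).restrict U) := ⟨by
    rw [Measure.restrict_apply_univ]; exact hUm.lt_top⟩
  have hSφ : ContMDiff (𝓡 n) 𝓘(ℝ, ℝ) 1 fun x => S (φ x) :=
    (hS.contMDiff.comp hφ.contMDiff).of_le (by norm_cast)
  have hg : ∀ x, grad n (fun z => S (φ z)) x = deriv S (φ x) • grad n φ x := fun x =>
    grad_comp (hS.differentiable (by simp) _) (hφ.contMDiff.mdifferentiableAt (by simp))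
  have hb : ∀ x, ‖S (φ x) * T (f x)‖ ≤ CS * CT := fun x => by
    rw [norm_mul]
    exact mul_le_mul (hCS _) (hCT _) (norm_nonneg _) ((norm_nonneg _).trans (hCS 0))
  have h1 := ((hf.hasWeakGrad.comp hU hT hκ hCκ).mul_contMDiffOn hU hSφ.contMDiffOn).sign_mul hn hU
    (ε := ε) hw hfc (fun x hx h => by rwa [hwf x hx h])
    (fun x _ h => by rw [hTε _ h, mul_zero])
    (fun x _ h => by rw [hTε _ h, hκε _ h, zero_smul, zero_smul, smul_zero, add_zero])
    (fun x _ => hb x)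
  have hfm : AEMeasurable f ((riemannianVolume n M).restrict U) := hf.hasWeakGrad.aemeasurable hU
  have hTc : Continuous T := continuous_iff_continuousAt.2 fun t => (hT t).continuousAt
  have hS'c : Continuous (deriv S) := hS.continuous_deriv (by simp)
  have hφm : AEMeasurable φ ((riemannianVolume n M).restrict U) :=
    hφ.contMDiff.continuous.measurable.aemeasurable
  have hwm : AEMeasurable (fun x => Real.sign (w x)) ((riemannianVolume n M).restrict U) :=
    measurable_real_sign.comp_aemeasurable (hw.aemeasurable hU.measurableSet)
  have hPi := integrableOn_flux_of_sq hU hUm hu hf.hasWeakGrad.aemeasurable_inner_coordVec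
    hf.lintegral_grad_lt_top
  have hQi := hφ.integrableOn_flux hU hUm hu
  have heq : ∀ x, inner ℝ (grad n u x) (Real.sign (w x) • (S (φ x) • κ (f x) • G x
        + T (f x) • grad n (fun z => S (φ z)) x)) / slope n u x
      = Real.sign (w x) * (S (φ x) * κ (f x) * (inner ℝ (grad n u x) (G x) / slope n u x)
      + T (f x) * deriv S (φ x) * (inner ℝ (grad n u x) (grad n φ x) / slope n u x)) := by
    intro x
    rw [hg]
    simp only [inner_add_right, real_inner_smul_right]
    ring
  simp only [← heq]
  refine hs.integral_eq_zero hU hu h1 hφ.hasCompactSupport.isCompact hφ.tsupport_subset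
    (fun x hx => ?_) (fun x hx => ?_) ?_ ?_
  · rw [image_eq_zero_of_notMem_tsupport hx, hS0, zero_mul, mul_zero]
  · rw [hg, image_eq_zero_of_notMem_tsupport hx, hS0, grad_eq_zero_of_notMem_tsupport hx]
    simp
  · refine Integrable.of_bound (h1.aemeasurable hU).aestronglyMeasurable (CS * CT)
      (ae_of_all _ fun x => ?_)
    rw [norm_mul]
    exact (mul_le_of_le_one_left (norm_nonneg _) (norm_real_sign_le_one _)).trans (hb x)
  · refine IntegrableOn.congr_fun (s := U) (f := fun x => Real.sign (w x) *
      (S (φ x) * κ (f x) * (inner ℝ (grad n u x) (G x) / slope n u x)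
      + T (f x) * deriv S (φ x) * (inner ℝ (grad n u x) (grad n φ x) / slope n u x))) ?_
      (fun x _ => (heq x).symm) hU.measurableSet
    refine Integrable.bdd_mul (c := 1) (Integrable.add ?_ ?_) hwm.aestronglyMeasurable
      (ae_of_all _ fun x => norm_real_sign_le_one _)
    · refine Integrable.bdd_mul (c := CS * Cκ) hPi ((hS.continuous.measurable.comp_aemeasurable
        hφm).mul (hκ.measurable.comp_aemeasurable hfm)).aestronglyMeasurable
        (ae_of_all _ fun x => ?_)
      rw [norm_mul]
      exact mul_le_mul (hCS _) (hCκ _) (norm_nonneg _) ((norm_nonneg _).trans (hCS 0))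
    · refine Integrable.bdd_mul (c := CT * CS') hQi ((hTc.measurable.comp_aemeasurable
        hfm).mul (hS'c.measurable.comp_aemeasurable hφm)).aestronglyMeasurable
        (ae_of_all _ fun x => ?_)
      rw [norm_mul]
      exact mul_le_mul (hCT _) (hCS' _) (norm_nonneg _) ((norm_nonneg _).trans (hCT 0))

end

theorem integral_eq_zero_of_tendsto {α : Type*} [MeasurableSpace α] {μ : Measure α}
    {a b : ℕ → α → ℝ} {a' b' P : α → ℝ} {Q : ℕ → α → ℝ} {A B : ℝ}
    (ha : ∀ k, AEMeasurable (a k) μ) (hb : ∀ k, AEMeasurable (b k) μ)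
    (hA : ∀ k x, ‖a k x‖ ≤ A) (hB : ∀ k x, ‖b k x‖ ≤ B)
    (hat : ∀ᵐ x ∂μ, Tendsto (fun k => a k x) atTop (𝓝 (a' x)))
    (hbt : ∀ᵐ x ∂μ, Tendsto (fun k => b k x) atTop (𝓝 (b' x)))
    (hP : Integrable P μ) (hQ : ∀ k, Integrable (Q k) μ)
    (hQP : Tendsto (fun k => ∫ x, ‖Q k x - P x‖ ∂μ) atTop (𝓝 0))
    (h0 : ∀ k, ∫ x, (b k x * P x + a k x * Q k x) ∂μ = 0) :
    ∫ x, (b' x + a' x) * P x ∂μ = 0 := by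
  have h1 : Tendsto (fun k => ∫ x, (b k x + a k x) * P x ∂μ) atTop
      (𝓝 (∫ x, (b' x + a' x) * P x ∂μ)) := by
    refine tendsto_integral_of_dominated_convergence (fun x => (B + A) * ‖P x‖)
      (fun k => (((hb k).add (ha k)).aestronglyMeasurable.mul hP.aestronglyMeasurable))
      (hP.norm.const_mul _) (fun k => ae_of_all _ fun x => ?_) ?_
    · rw [norm_mul]
      exact mul_le_mul_of_nonneg_right ((norm_add_le _ _).trans (add_le_add (hB k x) (hA k x)))
        (norm_nonneg _)
    · filter_upwards [hat, hbt] with x hx hx'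
      exact (hx'.add hx).mul_const _
  refine tendsto_nhds_unique h1 (squeeze_zero_norm (a := fun k => A * ∫ x, ‖Q k x - P x‖ ∂μ)
    (fun k => ?_) (by simpa using hQP.const_mul A))
  have i1 : Integrable (fun x => b k x * P x) μ :=
    hP.bdd_mul (hb k).aestronglyMeasurable (ae_of_all _ (hB k))
  have i2 : Integrable (fun x => a k x * P x) μ :=
    hP.bdd_mul (ha k).aestronglyMeasurable (ae_of_all _ (hA k))
  have i3 : Integrable (fun x => a k x * Q k x) μ :=
    (hQ k).bdd_mul (ha k).aestronglyMeasurable (ae_of_all _ (hA k))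
  have h2 : ∫ x, (b k x + a k x) * P x ∂μ = - ∫ x, a k x * (Q k x - P x) ∂μ := by
    have h3 := h0 k
    rw [integral_add i1 i3] at h3
    simp only [add_mul, mul_sub]
    rw [integral_add i1 i2, integral_sub i3 i2]
    linarith
  rw [h2, norm_neg, ← integral_const_mul]
  refine norm_integral_le_of_norm_le (((hQ k).sub hP).norm.const_mul A) (ae_of_all _ fun x => ?_)
  rw [norm_mul]
  exact mul_le_mul_of_nonneg_right (hA k x) (norm_nonneg _)

theorem exists_seq_tendsto_ae_of_lintegral_sq {α : Type*} [MeasurableSpace α] {μ : Measure α}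
    {φ : ℕ → α → ℝ} {f : α → ℝ} (hφ : ∀ k, AEMeasurable (φ k) μ) (hf : AEMeasurable f μ)
    (h : Tendsto (fun k => ∫⁻ x, ‖φ k x - f x‖ₑ ^ 2 ∂μ) atTop (𝓝 0)) :
    ∃ ns : ℕ → ℕ, StrictMono ns ∧ ∀ᵐ x ∂μ, Tendsto (fun k => φ (ns k) x) atTop (𝓝 (f x)) := by
  refine (tendstoInMeasure_of_tendsto_eLpNorm (p := 2) two_ne_zero
    (fun k => (hφ k).aestronglyMeasurable) hf.aestronglyMeasurable ?_).exists_seq_tendsto_ae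
  have h1 := h.ennrpow_const (1 / 2 : ℝ)
  rw [ENNReal.zero_rpow_of_pos (by norm_num)] at h1
  refine h1.congr fun k => ?_
  rw [eLpNorm_eq_lintegral_rpow_enorm_toReal two_ne_zero ENNReal.ofNat_ne_top]
  simp

theorem tendsto_lintegral_of_sq {α : Type*} [MeasurableSpace α] {μ : Measure α} [IsFiniteMeasure μ]
    {F : ℕ → α → ℝ≥0∞} (hF : ∀ k, AEMeasurable (F k) μ)
    (h : Tendsto (fun k => ∫⁻ x, F k x ^ 2 ∂μ) atTop (𝓝 0)) :
    Tendsto (fun k => ∫⁻ x, F k x ∂μ) atTop (𝓝 0) := by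
  have h1 := ENNReal.Tendsto.mul_const (b := μ univ ^ (1 / 2 : ℝ)) (h.ennrpow_const (1 / 2 : ℝ))
    (Or.inr (ENNReal.rpow_ne_top_of_nonneg (by norm_num) (measure_ne_top μ univ)))
  rw [ENNReal.zero_rpow_of_pos (by norm_num), zero_mul] at h1
  refine tendsto_of_tendsto_of_tendsto_of_le_of_le tendsto_const_nhds h1 (fun _ => zero_le) fun k => ?_
  simpa using ENNReal.lintegral_mul_le_Lp_mul_Lq μ (p := 2) (q := 2) Real.HolderConjugate.two_two (hF k)
    (aemeasurable_const (b := 1))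

/-- A continuous function with values in `[0,1]`, equal to `1` on `[2/c, c]` and to `0` outside
`[1/c, c + 1]`. -/
noncomputable def plateau (c t : ℝ) : ℝ :=
  max 0 (min 1 (min (c * t - 1) (c + 1 - t)))

theorem continuous_plateau (c : ℝ) : Continuous (plateau c) := by
  unfold plateau
  fun_prop

theorem norm_plateau_le (c t : ℝ) : ‖plateau c t‖ ≤ 1 := by
  rw [plateau, Real.norm_of_nonneg (le_max_left _ _)]
  exact max_le zero_le_one (min_le_left _ _)

theorem plateau_eq_zero {c t : ℝ} (hc : 0 < c) (ht : t ≤ 1 / c) : plateau c t = 0 := by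
  refine max_eq_left ((min_le_right _ _).trans ((min_le_left _ _).trans ?_))
  rw [le_div_iff₀ hc] at ht
  linarith

theorem plateau_eq_zero_of_le {c t : ℝ} (ht : c + 1 ≤ t) : plateau c t = 0 :=
  max_eq_left ((min_le_right _ _).trans ((min_le_right _ _).trans (by linarith)))

theorem plateau_eq_one {c t : ℝ} (h1 : 2 ≤ c * t) (h2 : t ≤ c) : plateau c t = 1 := by
  rw [plateau, min_eq_left (le_min (by linarith) (by linarith)), max_eq_right zero_le_one]

theorem hasCompactSupport_plateau {c : ℝ} (hc : 0 < c) : HasCompactSupport (plateau c) := by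
  refine HasCompactSupport.intro (isCompact_Icc (a := 0) (b := c + 1)) fun t ht => ?_
  rcases lt_or_ge t 0 with h | h
  · exact plateau_eq_zero hc (h.le.trans (by positivity))
  · exact plateau_eq_zero_of_le (not_le.1 fun h' => ht ⟨h, h'⟩).le

theorem norm_integral_plateau_le {c : ℝ} (hc : 0 < c) (t : ℝ) :
    ‖∫ s in (0 : ℝ)..t, plateau c s‖ ≤ ∫ s, ‖plateau c s‖ := by
  have hi := ((continuous_plateau c).integrable_of_hasCompactSupport (μ := volume)
    (hasCompactSupport_plateau hc)).norm
  exact intervalIntegral.norm_integral_le_integral_norm_uIoc.trans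
    (setIntegral_le_integral hi (ae_of_all _ fun _ => norm_nonneg _))

theorem integral_plateau_eq_zero {c t : ℝ} (hc : 0 < c) (ht : t ≤ 1 / c) :
    ∫ s in (0 : ℝ)..t, plateau c s = 0 := by
  rw [intervalIntegral.integral_congr (g := fun _ => 0), intervalIntegral.integral_zero]
  intro s hs
  refine plateau_eq_zero hc ?_
  rcases le_total 0 t with h | h
  · rw [uIcc_of_le h] at hs
    exact hs.2.trans ht
  · rw [uIcc_of_ge h] at hs
    exact hs.2.trans (by positivity)

theorem exists_norm_deriv_smoothTransition_le :
    ∃ C, ∀ t, ‖deriv Real.smoothTransition t‖ ≤ C := by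
  have hc : HasCompactSupport (deriv Real.smoothTransition) := by
    refine HasCompactSupport.intro (isCompact_Icc (a := 0) (b := 1)) fun t ht => ?_
    rcases lt_or_ge t 0 with h | h
    · have : Real.smoothTransition =ᶠ[𝓝 t] fun _ => 0 := by
        filter_upwards [Iio_mem_nhds h] with s hs using Real.smoothTransition.zero_of_nonpos hs.le
      rw [this.deriv_eq, deriv_const]
    · have h' : 1 < t := not_le.1 fun h' => ht ⟨h, h'⟩
      have : Real.smoothTransition =ᶠ[𝓝 t] fun _ => 1 := by
        filter_upwards [Ioi_mem_nhds h'] with s hs using Real.smoothTransition.one_of_one_le hs.le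
      rw [this.deriv_eq, deriv_const]
  exact ((Real.smoothTransition.contDiff (n := 1)).continuous_deriv le_rfl).bounded_above_of_compact_support hc

section

variable {n : ℕ} {M : Type*} [EMetricSpace M] [ChartedSpace (EuclideanSpace ℝ (Fin n)) M]
  [IsManifold (𝓡 n) ∞ M]
  [RiemannianBundle (fun x : M => TangentSpace (𝓡 n) x)]
  {U : Set M} {f u : M → ℝ} {G H V : ∀ x : M, TangentSpace (𝓡 n) x}
variable [IsContMDiffRiemannianBundle (𝓡 n) ∞ (EuclideanSpace ℝ (Fin n))
      (fun x : M => TangentSpace (𝓡 n) x)]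
variable [MeasurableSpace M] [BorelSpace M] [SecondCountableTopology M]

theorem tendsto_integral_flux_sub (hU : IsOpen U) (hUm : riemannianVolume n M U ≠ ⊤)
    (hu : ContMDiffOn (𝓡 n) 𝓘(ℝ, ℝ) 2 u U) (hf : HasW12Grad n U f G)
    {φ : ℕ → M → ℝ} (hφ : ∀ k, IsTestFunction n U (φ k))
    (h : Tendsto (fun k => ∫⁻ x in U, ‖grad n (φ k) x - G x‖ₑ ^ 2 ∂(riemannianVolume n M))
      atTop (𝓝 0)) :
    Tendsto (fun k => ∫ x in U, ‖inner ℝ (grad n u x) (grad n (φ k) x) / slope n u x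
      - inner ℝ (grad n u x) (G x) / slope n u x‖ ∂(riemannianVolume n M)) atTop (𝓝 0) := by
  have : IsFiniteMeasure ((riemannianVolume n M).restrict U) := ⟨by
    rw [Measure.restrict_apply_univ]; exact hUm.lt_top⟩
  have hm : ∀ k, ∀ p v, AEMeasurable (fun y => (inner ℝ ((fun x => grad n (φ k) x - G x)
      ((extChartAt (𝓡 n) p).symm y)) (coordVec n p v y) : ℝ))
      (volume.restrict (chartImage n p U)) := by
    intro k p v
    simp only [inner_sub_left]
    exact (aemeasurable_inner_grad_coordVec hU
      ((hφ k).contMDiff.of_le (by norm_cast)).contMDiffOn p v).sub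
      (hf.hasWeakGrad.aemeasurable_inner_coordVec p v)
  have h1 := tendsto_lintegral_of_sq (fun k => aemeasurable_enorm hU (hm k)) h
  have h2 : Tendsto (fun k => ∫⁻ x in U, ‖inner ℝ (grad n u x) (grad n (φ k) x) / slope n u x
      - inner ℝ (grad n u x) (G x) / slope n u x‖ₑ ∂(riemannianVolume n M)) atTop (𝓝 0) := by
    refine tendsto_of_tendsto_of_tendsto_of_le_of_le tendsto_const_nhds h1 (fun _ => zero_le)
      fun k => lintegral_mono fun x => ?_
    rw [← ofReal_norm, ← ofReal_norm, ← sub_div, ← inner_sub_right]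
    exact ENNReal.ofReal_le_ofReal (norm_inner_grad_div_slope_le u x _)
  have h3 := (ENNReal.tendsto_toReal ENNReal.zero_ne_top).comp h2
  refine h3.congr fun k => ?_
  rw [Function.comp, integral_norm_eq_lintegral_enorm]
  exact ((hφ k).integrableOn_flux hU hUm hu).aestronglyMeasurable.sub
    (integrableOn_flux_of_sq hU hUm hu hf.hasWeakGrad.aemeasurable_inner_coordVec
    hf.lintegral_grad_lt_top).aestronglyMeasurable

theorem IsMinimalGraphSolution.integral_sign_deriv_eq_zero (hn : 2 ≤ n) (hU : IsOpen U)
    (hUm : riemannianVolume n M U ≠ ⊤)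
    (hu : ContMDiffOn (𝓡 n) 𝓘(ℝ, ℝ) 2 u U) (hs : IsMinimalGraphSolution n U u) {w : M → ℝ} {o : M}
    (hw : ContinuousOn w U) (hfc : ContinuousOn f (U \ {o})) (hwf : ∀ x ∈ U, w x = 0 → f x = 0)
    (hf : HasW12Grad n U f G) {φ : ℕ → M → ℝ} (hφ : ∀ k, IsTestFunction n U (φ k))
    (hφf : Tendsto (fun k => ∫⁻ x in U, ‖φ k x - f x‖ₑ ^ 2 ∂(riemannianVolume n M)) atTop (𝓝 0))
    (hφG : Tendsto (fun k => ∫⁻ x in U, ‖grad n (φ k) x - G x‖ₑ ^ 2 ∂(riemannianVolume n M))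
      atTop (𝓝 0)) {T κ S : ℝ → ℝ}
    {CT Cκ CS CS' ε : ℝ} (hT : ∀ t, HasDerivAt T (κ t) t) (hκ : Continuous κ)
    (hCT : ∀ t, ‖T t‖ ≤ CT) (hCκ : ∀ t, ‖κ t‖ ≤ Cκ) (hε : 0 < ε) (hTε : ∀ t < ε, T t = 0)
    (hκε : ∀ t < ε, κ t = 0) (hS : ContDiff ℝ ∞ S) (hS0 : S 0 = 0) (hCS : ∀ t, ‖S t‖ ≤ CS)
    (hCS' : ∀ t, ‖deriv S t‖ ≤ CS') :
    ∫ x in U, (Real.sign (w x) * (S (f x) * κ (f x)) + Real.sign (w x) * (T (f x) * deriv S (f x)))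
      * (inner ℝ (grad n u x) (G x) / slope n u x) ∂(riemannianVolume n M) = 0 := by
  have hfm : AEMeasurable f ((riemannianVolume n M).restrict U) := hf.hasWeakGrad.aemeasurable hU
  have hTc : Continuous T := continuous_iff_continuousAt.2 fun t => (hT t).continuousAt
  have hS'c : Continuous (deriv S) := hS.continuous_deriv (by simp)
  have hφm : ∀ k, AEMeasurable (φ k) ((riemannianVolume n M).restrict U) := fun k =>
    (hφ k).contMDiff.continuous.measurable.aemeasurable
  have hwm : AEMeasurable (fun x => Real.sign (w x)) ((riemannianVolume n M).restrict U) :=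
    measurable_real_sign.comp_aemeasurable (hw.aemeasurable hU.measurableSet)
  obtain ⟨ns, hns, hae⟩ := exists_seq_tendsto_ae_of_lintegral_sq hφm hfm hφf
  refine integral_eq_zero_of_tendsto
    (a := fun k x => Real.sign (w x) * (T (f x) * deriv S (φ (ns k) x)))
    (b := fun k x => Real.sign (w x) * (S (φ (ns k) x) * κ (f x))) (A := CT * CS') (B := CS * Cκ)
    (Q := fun k x => inner ℝ (grad n u x) (grad n (φ (ns k)) x) / slope n u x)
    (fun k => hwm.mul ((hTc.measurable.comp_aemeasurable hfm).mul
      (hS'c.measurable.comp_aemeasurable (hφm _))))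
    (fun k => hwm.mul ((hS.continuous.measurable.comp_aemeasurable (hφm _)).mul
      (hκ.measurable.comp_aemeasurable hfm))) (fun k x => ?_) (fun k x => ?_) ?_ ?_
    (integrableOn_flux_of_sq hU hUm hu hf.hasWeakGrad.aemeasurable_inner_coordVec
      hf.lintegral_grad_lt_top) (fun k => (hφ _).integrableOn_flux hU hUm hu)
    ((tendsto_integral_flux_sub hU hUm hu hf hφ hφG).comp hns.tendsto_atTop) fun k => ?_
  · rw [norm_mul, norm_mul]
    exact (mul_le_of_le_one_left (by positivity) (norm_real_sign_le_one _)).trans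
      (mul_le_mul (hCT _) (hCS' _) (norm_nonneg _) ((norm_nonneg _).trans (hCT 0)))
  · rw [norm_mul, norm_mul]
    exact (mul_le_of_le_one_left (by positivity) (norm_real_sign_le_one _)).trans
      (mul_le_mul (hCS _) (hCκ _) (norm_nonneg _) ((norm_nonneg _).trans (hCS 0)))
  · filter_upwards [hae] with x hx
    exact (((hS'c.tendsto _).comp hx).const_mul _).const_mul _
  · filter_upwards [hae] with x hx
    exact (((hS.continuous.tendsto _).comp hx).mul_const _).const_mul _
  · rw [← hs.integral_sign_mul_eq_zero hn hU hUm hu hw hfc hwf hf (hφ (ns k)) hT hκ hCT hCκ hε hTε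
      hκε hS hS0 hCS hCS']
    congr 1
    ext x
    ring

/-- The minimal graph equation tested with `sign w · f`, where `f ∈ W_0^{1,2}(U)`. -/
theorem IsMinimalGraphSolution.integral_sign_eq_zero (hn : 2 ≤ n) (hU : IsOpen U)
    (hUm : riemannianVolume n M U ≠ ⊤)
    (hu : ContMDiffOn (𝓡 n) 𝓘(ℝ, ℝ) 2 u U) (hs : IsMinimalGraphSolution n U u) {w : M → ℝ} {o : M}
    (hw : ContinuousOn w U) (hfc : ContinuousOn f (U \ {o})) (hwf : ∀ x ∈ U, w x = 0 → f x = 0)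
    (hf : HasW12Grad n U f G) {φ : ℕ → M → ℝ} (hφ : ∀ k, IsTestFunction n U (φ k))
    (hφf : Tendsto (fun k => ∫⁻ x in U, ‖φ k x - f x‖ₑ ^ 2 ∂(riemannianVolume n M)) atTop (𝓝 0))
    (hφG : Tendsto (fun k => ∫⁻ x in U, ‖grad n (φ k) x - G x‖ₑ ^ 2 ∂(riemannianVolume n M))
      atTop (𝓝 0)) :
    ∫ x in U, Real.sign (w x) * (Ioi 0).indicator (fun _ => 1) (f x)
      * (inner ℝ (grad n u x) (G x) / slope n u x) ∂(riemannianVolume n M) = 0 := by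
  have hfm : AEMeasurable f ((riemannianVolume n M).restrict U) := hf.hasWeakGrad.aemeasurable hU
  have hwm : AEMeasurable (fun x => Real.sign (w x)) ((riemannianVolume n M).restrict U) :=
    measurable_real_sign.comp_aemeasurable (hw.aemeasurable hU.measurableSet)
  have hPi := integrableOn_flux_of_sq hU hUm hu hf.hasWeakGrad.aemeasurable_inner_coordVec
    hf.lintegral_grad_lt_top
  obtain ⟨C, hC⟩ := exists_norm_deriv_smoothTransition_le
  have key : ∀ k : ℕ, ∫ x in U, Real.sign (w x) * plateau (k + 1) (f x)
      * (inner ℝ (grad n u x) (G x) / slope n u x) ∂(riemannianVolume n M) = 0 := by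
    intro k
    set c : ℝ := k + 1 with hc
    have hc0 : 0 < c := by positivity
    have hSd : ∀ t, HasDerivAt (fun t => Real.smoothTransition (c * t))
        (deriv Real.smoothTransition (c * t) * c) t := fun t =>
      ((Real.smoothTransition.contDiff (n := 1)).differentiable (by simp) _).hasDerivAt.comp t
        (by simpa using (hasDerivAt_id t).const_mul c)
    have hS' : ∀ t, deriv (fun t => Real.smoothTransition (c * t)) t
        = deriv Real.smoothTransition (c * t) * c := fun t => (hSd t).deriv
    rw [← hs.integral_sign_deriv_eq_zero hn hU hUm hu hw hfc hwf hf hφ hφf hφG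
      (T := fun t => ∫ s in (0 : ℝ)..t, plateau c s) (κ := plateau c)
      (S := fun t => Real.smoothTransition (c * t)) (ε := 1 / c) (CS := 1) (CS' := C * c)
      (fun t => ((continuous_plateau c).integral_hasStrictDerivAt 0 t).hasDerivAt)
      (continuous_plateau c) (norm_integral_plateau_le hc0) (norm_plateau_le c) (by positivity)
      (fun t ht => integral_plateau_eq_zero hc0 ht.le) (fun t ht => plateau_eq_zero hc0 ht.le)
      ((Real.smoothTransition.contDiff (n := ⊤)).comp (contDiff_const.mul contDiff_id)) ?_ ?_ ?_]
    · congr 1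
      ext x
      rcases le_or_gt (f x) (1 / c) with h | h
      · rw [plateau_eq_zero hc0 h, integral_plateau_eq_zero hc0 h]
        simp
      · have h1 : 1 < c * f x := by
          rw [div_lt_iff₀ hc0] at h
          linarith
        have h2 : deriv Real.smoothTransition (c * f x) = 0 := by
          have : Real.smoothTransition =ᶠ[𝓝 (c * f x)] fun _ => 1 := by
            filter_upwards [Ioi_mem_nhds h1] with s hs
              using Real.smoothTransition.one_of_one_le hs.le
          rw [this.deriv_eq, deriv_const]
        rw [hS', h2, Real.smoothTransition.one_of_one_le h1.le]
        ring
    · rw [mul_zero]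
      exact Real.smoothTransition.zero_of_nonpos le_rfl
    · intro t
      rw [Real.norm_of_nonneg (Real.smoothTransition.nonneg _)]
      exact Real.smoothTransition.le_one _
    · intro t
      rw [hS', norm_mul, Real.norm_of_nonneg hc0.le]
      exact mul_le_mul_of_nonneg_right (hC _) hc0.le
  refine tendsto_nhds_unique (tendsto_integral_of_dominated_convergence
    (F := fun (k : ℕ) x => Real.sign (w x) * plateau (k + 1) (f x)
      * (inner ℝ (grad n u x) (G x) / slope n u x))
    (fun x => ‖inner ℝ (grad n u x) (G x) / slope n u x‖) (fun k => ?_) hPi.norm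
    (fun k => ae_of_all _ fun x => ?_) (ae_of_all _ fun x => ?_))
    (by simp only [key]; exact tendsto_const_nhds)
  · exact (hwm.mul ((continuous_plateau _).measurable.comp_aemeasurable
      hfm)).aestronglyMeasurable.mul hPi.aestronglyMeasurable
  · rw [norm_mul, norm_mul]
    exact mul_le_of_le_one_left (norm_nonneg _) (mul_le_one₀ (norm_real_sign_le_one _)
      (norm_nonneg _) (norm_plateau_le _ _))
  · refine (Tendsto.const_mul _ ?_).mul_const _
    rcases le_or_gt (f x) 0 with h | h
    · rw [indicator_of_notMem (by simpa using h)]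
      refine tendsto_const_nhds.congr fun k => (plateau_eq_zero (by positivity) ?_).symm
      exact h.trans (by positivity)
    · rw [indicator_of_mem (by exact h)]
      refine tendsto_const_nhds.congr' ?_
      filter_upwards [(tendsto_natCast_atTop_atTop (R := ℝ)).eventually_ge_atTop (max (f x) (2 / f x))]
        with k hk
      refine (plateau_eq_one ?_ ?_).symm
      · have h1 := (le_max_right _ _).trans hk
        rw [div_le_iff₀ h] at h1
        nlinarith
      · have h1 := (le_max_left _ _).trans hk
        linarith

end

theorem _root_.LocallyLipschitzOn.mul_real {E : Type*} [PseudoMetricSpace E] {s : Set E}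
    {f g : E → ℝ} (hf : LocallyLipschitzOn s f) (hg : LocallyLipschitzOn s g) :
    LocallyLipschitzOn s fun x => f x * g x := by
  intro x hx
  obtain ⟨K, t, ht, hK⟩ := hf hx
  obtain ⟨L, r, hr, hL⟩ := hg hx
  have hfb : ∀ᶠ y in 𝓝[s] x, |f y| < |f x| + 1 :=
    (hf.continuousOn x hx).abs.eventually (gt_mem_nhds (lt_add_one _))
  have hgb : ∀ᶠ y in 𝓝[s] x, |g y| < |g x| + 1 :=
    (hg.continuousOn x hx).abs.eventually (gt_mem_nhds (lt_add_one _))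
  refine ⟨((|f x| + 1) * L + (|g x| + 1) * K).toNNReal,
    t ∩ r ∩ ({y | |f y| < |f x| + 1} ∩ {y | |g y| < |g x| + 1}),
    inter_mem (inter_mem ht hr) (inter_mem hfb hgb),
    LipschitzOnWith.of_dist_le_mul fun y hy z hz => ?_⟩
  rw [Real.coe_toNNReal _ (by positivity), Real.dist_eq]
  have h1 : f y * g y - f z * g z = f y * (g y - g z) + g z * (f y - f z) := by ring
  have h2 := hK.dist_le_mul y hy.1.1 z hz.1.1
  have h3 := hL.dist_le_mul y hy.1.2 z hz.1.2
  have h4 : |f y| ≤ |f x| + 1 := le_of_lt hy.2.1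
  have h5 : |g z| ≤ |g x| + 1 := le_of_lt hz.2.2
  rw [Real.dist_eq] at h2 h3
  rw [h1]
  refine (abs_add_le _ _).trans ?_
  rw [abs_mul, abs_mul, add_mul, mul_assoc, mul_assoc]
  gcongr

theorem strictMono_of_homeomorph (Ψ : ℝ≥0 ≃ₜ ℝ≥0) : StrictMono Ψ := by
  refine (Ψ.continuous.strictMono_of_inj Ψ.injective).resolve_right fun h => ?_
  obtain ⟨x, hx⟩ := Ψ.surjective (Ψ 0 + 1)
  have h1 : Ψ x ≤ Ψ 0 := h.antitone zero_le
  rw [hx] at h1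
  exact absurd h1 (not_le.2 (lt_add_of_pos_right _ one_pos))

theorem homeomorph_zero (Ψ : ℝ≥0 ≃ₜ ℝ≥0) : Ψ 0 = 0 := by
  obtain ⟨x, hx⟩ := Ψ.surjective 0
  exact le_antisymm (((strictMono_of_homeomorph Ψ).monotone zero_le).trans_eq hx) zero_le

theorem onReal_zero (Ψ : ℝ≥0 ≃ₜ ℝ≥0) : onReal Ψ 0 = 0 := by
  simp [onReal, homeomorph_zero]

theorem onReal_pos (Ψ : ℝ≥0 ≃ₜ ℝ≥0) {t : ℝ} (ht : 0 < t) : 0 < onReal Ψ t := by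
  have h1 : Ψ 0 < Ψ t.toNNReal := strictMono_of_homeomorph Ψ (Real.toNNReal_pos.2 ht)
  rw [homeomorph_zero] at h1
  exact h1

theorem continuous_onReal (Ψ : ℝ≥0 ≃ₜ ℝ≥0) : Continuous (onReal Ψ) :=
  NNReal.continuous_coe.comp (Ψ.continuous.comp continuous_real_toNNReal)

theorem deriv_onReal_nonneg (Ψ : ℝ≥0 ≃ₜ ℝ≥0) (t : ℝ) : 0 ≤ deriv (onReal Ψ) t :=
  Monotone.deriv_nonneg fun _ _ h =>
    NNReal.coe_le_coe.2 ((strictMono_of_homeomorph Ψ).monotone (Real.toNNReal_mono h))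

theorem measurable_derivAt (Ψ : ℝ≥0 ≃ₜ ℝ≥0) (d₀ : ℝ≥0∞) : Measurable (derivAt Ψ d₀) :=
  Measurable.ite (measurableSet_singleton 0) measurable_const (measurable_deriv _).ennreal_ofReal

theorem measurable_sqDivDeriv (Ψ : ℝ≥0 ≃ₜ ℝ≥0) (d₀ : ℝ≥0∞) : Measurable (sqDivDeriv Ψ d₀) :=
  ((continuous_onReal Ψ).measurable.ennreal_ofReal.pow_const 2).div (measurable_derivAt Ψ d₀)

/-- A function that agrees with `t ↦ Ψ(|t| / ν)` for `a < |t| < b`, of class `C¹` on the line and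
with bounded derivative. -/
theorem exists_eq_onReal_abs (Ψ : ℝ≥0 ≃ₜ ℝ≥0) (hΨ : ContDiffOn ℝ ∞ (onReal Ψ) (Ioi 0)) {ν a b : ℝ}
    (hν : 0 < ν) (ha : 0 < a) :
    ∃ T κ : ℝ → ℝ, ∃ C, (∀ t, HasDerivAt T (κ t) t) ∧ Continuous κ ∧ (∀ t, ‖κ t‖ ≤ C) ∧
      ∀ t, a < |t| → |t| < b → T t = onReal Ψ (|t| / ν) ∧
        κ t = deriv (onReal Ψ) (|t| / ν) * (Real.sign t / ν) := by
  have hK : IsCompact {t : ℝ | a ≤ |t| ∧ |t| ≤ b} := by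
    refine (isCompact_Icc (a := -b) (b := b)).of_isClosed_subset
      ((isClosed_le continuous_const continuous_abs).inter
        (isClosed_le continuous_abs continuous_const)) fun t ht => abs_le.1 ht.2
  obtain ⟨χ, hχ, hχc, hχs, hχ1⟩ := exists_contDiff_cutoff hK (isOpen_compl_singleton (x := (0 : ℝ)))
    (fun t ht h => by
      rw [mem_singleton_iff] at h
      have h1 : a ≤ |t| := ht.1
      rw [h, abs_zero] at h1
      linarith)
  set T : ℝ → ℝ := fun t => χ t * onReal Ψ (|t| / ν) with hT
  have hat : ∀ t ≠ 0, ContDiffAt ℝ ∞ (fun t : ℝ => onReal Ψ (|t| / ν)) t := by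
    intro t ht
    have h1 : 0 < |t| / ν := div_pos (abs_pos.2 ht) hν
    exact ContDiffAt.comp (g := onReal Ψ) t (hΨ.contDiffAt (Ioi_mem_nhds h1))
      ((contDiffAt_abs ht).div_const ν)
  have hTd : ContDiff ℝ 1 T := by
    rw [contDiff_iff_contDiffAt]
    intro t
    by_cases ht : t = 0
    · have h0 : t ∉ tsupport χ := fun h => hχs h ht
      refine (contDiffAt_const (c := (0 : ℝ))).congr_of_eventuallyEq ?_
      filter_upwards [notMem_tsupport_iff_eventuallyEq.1 h0] with s hs
      simp only [hT, hs, Pi.zero_apply, zero_mul]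
    · exact (hχ.contDiffAt.mul (hat t ht)).of_le (by norm_cast)
  have hTc : HasCompactSupport T := hχc.mul_right
  have hTc' : Continuous (deriv T) := hTd.continuous_deriv le_rfl
  obtain ⟨C, hC⟩ := hTc'.bounded_above_of_compact_support hTc.deriv
  refine ⟨T, deriv T, C, fun t => (hTd.differentiable (by simp) t).hasDerivAt, hTc', hC,
    fun t hat' htb => ?_⟩
  have hmem : t ∈ {t : ℝ | a ≤ |t| ∧ |t| ≤ b} := ⟨hat'.le, htb.le⟩
  have hev : ∀ᶠ s in 𝓝 t, χ s = 1 := hχ1.filter_mono (nhds_le_nhdsSet hmem)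
  have hTe : T =ᶠ[𝓝 t] fun s => onReal Ψ (|s| / ν) := by
    filter_upwards [hev] with s hs
    simp only [hT, hs, one_mul]
  have ht0 : t ≠ 0 := abs_pos.1 (ha.trans hat')
  refine ⟨hTe.eq_of_nhds, ?_⟩
  rw [hTe.deriv_eq]
  have h1 : 0 < |t| / ν := div_pos (abs_pos.2 ht0) hν
  have h2 : HasDerivAt (fun s : ℝ => |s| / ν) (Real.sign t / ν) t := by
    have h3 : HasDerivAt (fun s : ℝ => |s|) (Real.sign t) t := by
      rcases lt_or_gt_of_ne ht0 with h | h
      · rw [Real.sign_of_neg h]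
        exact hasDerivAt_abs_neg h
      · rw [Real.sign_of_pos h]
        exact hasDerivAt_abs_pos h
    exact h3.div_const ν
  have h4 : HasDerivAt (onReal Ψ) (deriv (onReal Ψ) (|t| / ν)) (|t| / ν) :=
    ((hΨ.contDiffAt (Ioi_mem_nhds h1)).differentiableAt (by simp)).hasDerivAt
  exact (h4.comp t h2).deriv

section

variable {n : ℕ} {M : Type*} [EMetricSpace M] [ChartedSpace (EuclideanSpace ℝ (Fin n)) M]
  [IsManifold (𝓡 n) ∞ M]
  [RiemannianBundle (fun x : M => TangentSpace (𝓡 n) x)]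
  {U : Set M} {f u θ η : M → ℝ} {G Gθ : ∀ x : M, TangentSpace (𝓡 n) x} {o : M}

theorem hasWeakGrad_of_contMDiffOn (hU : IsOpen U) (hf : ContMDiffOn (𝓡 n) 𝓘(ℝ, ℝ) 1 f U) :
    HasWeakGrad n U f (grad n f) := by
  refine hasWeakGrad_of_chart fun p v => ?_
  have ho := isOpen_chartImage (n := n) p hU
  have hf' := contDiffOn_chart (by norm_cast) hf p
  refine (HasWeakDeriv.of_locallyLipschitzOn ho
    (hf'.locallyLipschitzOn_of_isOpen ho)).congr ho (fun _ _ => rfl) fun y hy => ?_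
  rw [inner_grad_coordVec hy.1
    ((hf.contMDiffAt (hU.mem_nhds hy.2)).mdifferentiableAt (by simp)),
    ((hf'.contDiffAt (ho.mem_nhds hy)).differentiableAt (by simp)).lineDeriv_eq_fderiv]

theorem HasWeakGrad.sub (hU : IsOpen U) {g : M → ℝ} {H : ∀ x : M, TangentSpace (𝓡 n) x}
    (hf : HasWeakGrad n U f G) (hg : HasWeakGrad n U g H) :
    HasWeakGrad n U (fun x => f x - g x) (fun x => G x - H x) :=
  hasWeakGrad_of_chart fun p v =>
    have ho := isOpen_chartImage (n := n) p hU
    ((hf.hasWeakDeriv p v).add ((hg.hasWeakDeriv p v).const_mul ho (-1))).congr ho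
      (fun _ _ => by ring) fun _ _ => by rw [inner_sub_left]; ring

theorem eq_of_inner_coordVec_single {p : M} {y : EuclideanSpace ℝ (Fin n)}
    (hy : y ∈ (extChartAt (𝓡 n) p).target)
    {V W : TangentSpace (𝓡 n) ((extChartAt (𝓡 n) p).symm y)}
    (h : ∀ i, inner ℝ V (coordVec n p (EuclideanSpace.single i 1) y)
      = inner ℝ W (coordVec n p (EuclideanSpace.single i 1) y)) : V = W := by
  refine eq_of_inner_coordVec hy fun v => ?_
  rw [eq_sum_single v, coordVec_sum, inner_sum, inner_sum]
  simp only [real_inner_smul_right, h]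

variable [MeasurableSpace M] [BorelSpace M] [SecondCountableTopology M]
variable [IsContMDiffRiemannianBundle (𝓡 n) ∞ (EuclideanSpace ℝ (Fin n))
      (fun x : M => TangentSpace (𝓡 n) x)]

theorem HasWeakGrad.ae_eq_zero (hU : IsOpen U) (h : HasWeakGrad n U f G) :
    ∀ᵐ x ∂(riemannianVolume n M).restrict U, f x = 0 → G x = 0 := by
  refine ae_restrict_of_chart hU.measurableSet fun p => ?_
  have h1 : ∀ i : Fin n, _ := fun i =>
    (h.hasWeakDeriv p (EuclideanSpace.single i 1)).ae_eq_zero (isOpen_chartImage p hU)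
  filter_upwards [ae_all_iff.2 h1] with y hy hyU hf
  exact eq_of_inner_coordVec_single hyU.1 fun i => by rw [hy i hyU hf, inner_zero_left]

/-- The weak gradient of `η² Ψ(|w| / ν) W` where `w ≠ 0`. -/
theorem ae_weakGrad_eq [IsRiemannianManifold (𝓡 n) M] (Ψ : ℝ≥0 ≃ₜ ℝ≥0)
    (hΨ : ContDiffOn ℝ ∞ (onReal Ψ) (Ioi 0)) (hU : IsOpen U) {ν : ℝ} (hν : 0 < ν)
    (hu : ContMDiffOn (𝓡 n) 𝓘(ℝ, ℝ) 2 u U)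
    (hη : LocallyLipschitzOn (U \ {o}) η) {w : M → ℝ} {Gw : ∀ x : M, TangentSpace (𝓡 n) x}
    (hw : HasWeakGrad n U w Gw) (hwc : ContinuousOn w U)
    (hG : HasWeakGrad n U (fun x => η x ^ 2 * onReal Ψ (|w x| / ν) * slope n u x) G) :
    ∀ᵐ x ∂(riemannianVolume n M).restrict (U \ {o}), w x ≠ 0 →
      G x = (η x ^ 2 * slope n u x * (deriv (onReal Ψ) (|w x| / ν) * (Real.sign (w x) / ν))) • Gw x
        + (onReal Ψ (|w x| / ν) * (2 * η x * slope n u x)) • grad n η x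
        + (onReal Ψ (|w x| / ν) * η x ^ 2) • grad n (slope n u) x := by
  have hU' : IsOpen (U \ {o}) := hU.sdiff isClosed_singleton
  refine ae_restrict_of_chart hU'.measurableSet fun p => ?_
  have ho := isOpen_chartImage (n := n) p hU
  have ho' := isOpen_chartImage (n := n) p hU'
  have hsub : chartImage n p (U \ {o}) ⊆ chartImage n p U := fun y hy => ⟨hy.1, hy.2.1⟩
  have hηl := locallyLipschitzOn_chart (n := n) hU' hη p
  have hWd := (contDiffOn_slope hU hu p).mono hsub
  have hWl := hWd.locallyLipschitzOn_of_isOpen ho'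
  have hmul : LocallyLipschitzOn (chartImage n p (U \ {o}))
      fun y => η ((extChartAt (𝓡 n) p).symm y) ^ 2 * slope n u ((extChartAt (𝓡 n) p).symm y) := by
    simp only [pow_two]
    exact (hηl.mul_real hηl).mul_real hWl
  have hwc' := (continuousOn_chart hwc p).mono hsub
  have key : ∀ (m : ℕ) (i : Fin n), ∀ᵐ y, y ∈ chartImage n p (U \ {o}) →
      1 / ((m : ℝ) + 1) < |w ((extChartAt (𝓡 n) p).symm y)| →
      |w ((extChartAt (𝓡 n) p).symm y)| < m + 1 →
      inner ℝ (G ((extChartAt (𝓡 n) p).symm y)) (coordVec n p (EuclideanSpace.single i 1) y) =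
      η ((extChartAt (𝓡 n) p).symm y) ^ 2 * slope n u ((extChartAt (𝓡 n) p).symm y)
        * (deriv (onReal Ψ) (|w ((extChartAt (𝓡 n) p).symm y)| / ν)
          * (Real.sign (w ((extChartAt (𝓡 n) p).symm y)) / ν)
          * inner ℝ (Gw ((extChartAt (𝓡 n) p).symm y))
            (coordVec n p (EuclideanSpace.single i 1) y))
        + lineDeriv ℝ (fun y => η ((extChartAt (𝓡 n) p).symm y) ^ 2
          * slope n u ((extChartAt (𝓡 n) p).symm y)) y (EuclideanSpace.single i 1)
          * onReal Ψ (|w ((extChartAt (𝓡 n) p).symm y)| / ν) := by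
    intro m i
    obtain ⟨T, κ, C, hT, hκ, hC, hTκ⟩ := exists_eq_onReal_abs Ψ hΨ (a := 1 / ((m : ℝ) + 1))
      (b := m + 1) hν (by positivity)
    have hom : IsOpen (chartImage n p (U \ {o}) ∩ (fun y => |w ((extChartAt (𝓡 n) p).symm y)|) ⁻¹'
        Ioo (1 / ((m : ℝ) + 1)) (m + 1)) := hwc'.abs.isOpen_inter_preimage ho' isOpen_Ioo
    have h1 := ((((hw.hasWeakDeriv p (EuclideanSpace.single i 1)).comp ho hT hκ hC).mono
      hsub).mul_locallyLipschitzOn ho' hmul).mono (inter_subset_left (t := (fun y =>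
        |w ((extChartAt (𝓡 n) p).symm y)|) ⁻¹' Ioo (1 / ((m : ℝ) + 1)) (m + 1)))
    have h2 := ((hG.hasWeakDeriv p (EuclideanSpace.single i 1)).mono
      (inter_subset_left.trans hsub)).ae_eq hom (h1.congr hom (fun y hy => ?_) fun _ _ => rfl)
    · filter_upwards [h2] with y hy hyU h3 h4
      rw [hy ⟨hyU, h3, h4⟩, (hTκ _ h3 h4).1, (hTκ _ h3 h4).2]
    · rw [(hTκ _ hy.2.1 hy.2.2).1]
      ring
  filter_upwards [ae_all_iff.2 fun m => ae_all_iff.2 (key m),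
    ae_differentiableAt_of_locallyLipschitzOn ho' hηl] with y hy hyd hyU hw0
  obtain ⟨m, hm⟩ := exists_nat_gt (max |w ((extChartAt (𝓡 n) p).symm y)|
    (1 / |w ((extChartAt (𝓡 n) p).symm y)|))
  have hw1 := abs_pos.2 hw0
  have hm1 : |w ((extChartAt (𝓡 n) p).symm y)| < m + 1 := by
    linarith [(le_max_left _ _).trans_lt hm]
  have hm2 : 1 / ((m : ℝ) + 1) < |w ((extChartAt (𝓡 n) p).symm y)| := by
    rw [div_lt_comm₀ (by positivity) hw1]
    linarith [(le_max_right _ _).trans_lt hm]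
  have hηd := (hyd hyU).hasFDerivAt
  have hWd' := ((hWd.contDiffAt (ho'.mem_nhds hyU)).differentiableAt (by simp)).hasFDerivAt
  have hηm := mdifferentiableAt_of_chart hyU.1 (hyd hyU)
  have hWm := mdifferentiableAt_slope hU hu (hsub hyU)
  refine eq_of_inner_coordVec_single hyU.1 fun i => ?_
  rw [hy m i hyU hm2 hm1]
  have hd := (hηd.pow 2).mul hWd'
  have hd' := hd.hasLineDerivAt (EuclideanSpace.single i 1)
  rw [HasLineDerivAt.lineDeriv (f := fun y => η ((extChartAt (𝓡 n) p).symm y) ^ 2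
          * slope n u ((extChartAt (𝓡 n) p).symm y)) hd']
  simp only [inner_add_left, real_inner_smul_left, inner_grad_coordVec hyU.1 hηm,
    inner_grad_coordVec hyU.1 hWm]
  simp
  ring

end

section Young

variable {E : Type*} [NormedAddCommGroup E] [InnerProductSpace ℝ E]

theorem caccioppoli_young {η D ψ ν s : ℝ} (hν : 0 < ν) (hD : 0 < D) (hs : s ^ 2 = 1) (a t e l : E) :
    η ^ 2 * D * ‖a‖ ^ 2 ≤ 2 * ν * (η ^ 2 * D / ν * inner ℝ a (a - t)
        + s * (2 * η * ψ) * inner ℝ a e + s * (η ^ 2 * ψ) * inner ℝ a l)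
      + (4 * (η ^ 2 * D * ‖t‖ ^ 2) + (8 * ν ^ 2 * (ψ ^ 2 / D * ‖e‖ ^ 2)
      + 4 * ν ^ 2 * (η ^ 2 * (ψ ^ 2 / D) * ‖l‖ ^ 2))) := by
  have h1 : 0 ≤ η ^ 2 * D * ‖(1 / 2 : ℝ) • a - (2 : ℝ) • t‖ ^ 2 := by positivity
  have h2 : 0 ≤ 1 / (2 * D) * ‖(η * D) • a + (4 * ν * s * ψ) • e‖ ^ 2 := by positivity
  have h3 : 0 ≤ η ^ 2 / (4 * D) * ‖D • a + (4 * ν * s * ψ) • l‖ ^ 2 := by positivity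
  rw [norm_sub_sq_real, norm_smul, norm_smul, real_inner_smul_left, real_inner_smul_right,
    mul_pow, mul_pow, Real.norm_eq_abs, Real.norm_eq_abs, sq_abs, sq_abs] at h1
  rw [norm_add_sq_real, norm_smul, norm_smul, real_inner_smul_left, real_inner_smul_right,
    mul_pow, mul_pow, Real.norm_eq_abs, Real.norm_eq_abs, sq_abs, sq_abs] at h2 h3
  rw [inner_sub_right, real_inner_self_eq_norm_sq]
  have e2 : 1 / (2 * D) * ((η * D) ^ 2 * ‖a‖ ^ 2 + 2 * (η * D * (4 * ν * s * ψ * inner ℝ a e))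
      + (4 * ν * s * ψ) ^ 2 * ‖e‖ ^ 2) = η ^ 2 * D * ‖a‖ ^ 2 / 2
      + 4 * ν * s * η * ψ * inner ℝ a e + s ^ 2 * (8 * ν ^ 2 * (ψ ^ 2 / D * ‖e‖ ^ 2)) := by
    field_simp
    ring
  have e3 : η ^ 2 / (4 * D) * (D ^ 2 * ‖a‖ ^ 2 + 2 * (D * (4 * ν * s * ψ * inner ℝ a l))
      + (4 * ν * s * ψ) ^ 2 * ‖l‖ ^ 2) = η ^ 2 * D * ‖a‖ ^ 2 / 4
      + 2 * ν * s * η ^ 2 * ψ * inner ℝ a l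
      + s ^ 2 * (4 * ν ^ 2 * (η ^ 2 * (ψ ^ 2 / D) * ‖l‖ ^ 2)) := by
    field_simp
  have e4 : 2 * ν * (η ^ 2 * D / ν * (‖a‖ ^ 2 - inner ℝ a t)
        + s * (2 * η * ψ) * inner ℝ a e + s * (η ^ 2 * ψ) * inner ℝ a l)
      = 2 * (η ^ 2 * D * (‖a‖ ^ 2 - inner ℝ a t)) + 4 * ν * s * η * ψ * inner ℝ a e
      + 2 * ν * s * η ^ 2 * ψ * inner ℝ a l := by
    field_simp
    ring
  rw [e2, hs] at h2
  rw [e3, hs] at h3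
  rw [e4]
  nlinarith

theorem ofReal_add_ofReal_neg_le {X Y R : ℝ} (hX : 0 ≤ X) (hR : 0 ≤ R) (h : X ≤ Y + R) :
    ENNReal.ofReal X + ENNReal.ofReal (-Y) ≤ ENNReal.ofReal Y + ENNReal.ofReal R := by
  rcases le_total 0 Y with hY | hY
  · rw [ENNReal.ofReal_of_nonpos (neg_nonpos.2 hY), add_zero, ← ENNReal.ofReal_add hY hR]
    exact ENNReal.ofReal_le_ofReal h
  · rw [ENNReal.ofReal_of_nonpos hY, zero_add, ← ENNReal.ofReal_add hX (neg_nonneg.2 hY)]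
    exact ENNReal.ofReal_le_ofReal (by linarith)

theorem caccioppoli_young_ennreal {η D ψ ν s : ℝ} (hν : 0 < ν) (hD : 0 ≤ D) (hψ : 0 < ψ)
    (hs : s ^ 2 = 1) (a t e l : E) {N : ℝ} (hN : N = η ^ 2 * D / ν * inner ℝ a (a - t)
        + s * (2 * η * ψ) * inner ℝ a e + s * (η ^ 2 * ψ) * inner ℝ a l) :
    ENNReal.ofReal (η ^ 2) * ENNReal.ofReal D * ‖a‖ₑ ^ 2 + ENNReal.ofReal (-(2 * ν * N))
      ≤ ENNReal.ofReal (2 * ν * N)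
      + (4 * (ENNReal.ofReal (η ^ 2) * ENNReal.ofReal D * ‖t‖ₑ ^ 2)
      + (8 * ENNReal.ofReal (ν ^ 2) * (ENNReal.ofReal ψ ^ 2 / ENNReal.ofReal D * ‖e‖ₑ ^ 2)
      + 4 * ENNReal.ofReal (ν ^ 2) * (ENNReal.ofReal (η ^ 2)
        * (ENNReal.ofReal ψ ^ 2 / ENNReal.ofReal D) * ‖l‖ₑ ^ 2))) := by
  have hν2 : ENNReal.ofReal (ν ^ 2) ≠ 0 := by
    rw [Ne, ENNReal.ofReal_eq_zero, not_le]
    positivity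
  rcases hD.eq_or_lt with rfl | hD
  · have hψ0 : ENNReal.ofReal ψ ^ 2 ≠ 0 := pow_ne_zero 2 (by
      rw [Ne, ENNReal.ofReal_eq_zero, not_le]
      exact hψ)
    simp only [ENNReal.ofReal_zero, mul_zero, zero_mul, zero_add, ENNReal.div_zero hψ0, zero_div]
      at hN ⊢
    by_cases he : e = 0
    · by_cases hl : l = 0 ∨ η = 0
      · have hN0 : N = 0 := by
          rcases hl with rfl | rfl <;> simp [hN, he]
        simp [hN0]
      · push Not at hl
        have h1 : ENNReal.ofReal (η ^ 2) ≠ 0 := by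
          rw [Ne, ENNReal.ofReal_eq_zero, not_le]
          have := hl.2
          positivity
        have h2 : ‖l‖ₑ ^ 2 ≠ 0 := pow_ne_zero 2 (by simpa using hl.1)
        have h3 : 4 * ENNReal.ofReal (ν ^ 2) * (ENNReal.ofReal (η ^ 2) * ⊤ * ‖l‖ₑ ^ 2) = ⊤ := by
          rw [ENNReal.mul_top h1, ENNReal.top_mul h2, ENNReal.mul_top (mul_ne_zero (by norm_num) hν2)]
        rw [h3]
        simp
    · have h2 : ‖e‖ₑ ^ 2 ≠ 0 := pow_ne_zero 2 (by simpa using he)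
      have h3 : 8 * ENNReal.ofReal (ν ^ 2) * (⊤ * ‖e‖ₑ ^ 2) = ⊤ := by
        rw [ENNReal.top_mul h2, ENNReal.mul_top (mul_ne_zero (by norm_num) hν2)]
      rw [h3]
      simp
  · have h4 : (4 : ℝ≥0∞) = ENNReal.ofReal 4 := by simp
    have h8 : (8 : ℝ≥0∞) = ENNReal.ofReal 8 := by simp
    have hn : ∀ v : E, ‖v‖ₑ ^ 2 = ENNReal.ofReal (‖v‖ ^ 2) := fun v => by
      rw [← ofReal_norm, ENNReal.ofReal_pow (norm_nonneg _)]
    have hq : ENNReal.ofReal ψ ^ 2 / ENNReal.ofReal D = ENNReal.ofReal (ψ ^ 2 / D) := by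
      rw [ENNReal.ofReal_div_of_pos hD, ENNReal.ofReal_pow hψ.le]
    rw [hq, hn, hn, hn, hn, h4, h8]
    have key := ofReal_add_ofReal_neg_le (by positivity) (by positivity)
      (caccioppoli_young (η := η) (ψ := ψ) hν hD hs a t e l)
    rw [← hN] at key
    refine (le_of_eq ?_).trans (key.trans (le_of_eq ?_))
    · rw [ENNReal.ofReal_mul (by positivity), ENNReal.ofReal_mul (by positivity)]
    · rw [ENNReal.ofReal_add (by positivity) (by positivity),
        ENNReal.ofReal_add (by positivity) (by positivity),
        ENNReal.ofReal_mul (p := 4) (by positivity),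
        ENNReal.ofReal_mul (p := η ^ 2 * D) (by positivity), ENNReal.ofReal_mul (p := η ^ 2) (by positivity),
        ENNReal.ofReal_mul (p := 8 * ν ^ 2) (by positivity), ENNReal.ofReal_mul (p := 8) (by positivity),
        ENNReal.ofReal_mul (p := ψ ^ 2 / D) (by positivity),
        ENNReal.ofReal_mul (p := 4 * ν ^ 2) (by positivity), ENNReal.ofReal_mul (p := 4) (by positivity),
        ENNReal.ofReal_mul (p := η ^ 2 * (ψ ^ 2 / D)) (by positivity),
        ENNReal.ofReal_mul (p := η ^ 2) (by positivity)]

end Young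

theorem lintegral_ofReal_neg_eq {α : Type*} [MeasurableSpace α] {μ : Measure α} {F : α → ℝ}
    (hF : Integrable F μ) (h0 : ∫ x, F x ∂μ = 0) :
    ∫⁻ x, ENNReal.ofReal (-F x) ∂μ = ∫⁻ x, ENNReal.ofReal (F x) ∂μ ∧
      ∫⁻ x, ENNReal.ofReal (F x) ∂μ ≠ ⊤ := by
  have h1 := hF.lintegral_lt_top
  have h2 := hF.neg.lintegral_lt_top
  rw [integral_eq_lintegral_pos_part_sub_lintegral_neg_part hF, sub_eq_zero] at h0
  exact ⟨((ENNReal.toReal_eq_toReal_iff' h1.ne h2.ne).1 h0).symm, h1.ne⟩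

section

variable {n : ℕ} {M : Type*} [EMetricSpace M] [ChartedSpace (EuclideanSpace ℝ (Fin n)) M]
  [IsManifold (𝓡 n) ∞ M]
  [RiemannianBundle (fun x : M => TangentSpace (𝓡 n) x)]
  {U : Set M} {f u θ η : M → ℝ} {G Gθ : ∀ x : M, TangentSpace (𝓡 n) x} {o : M}
  [MeasurableSpace M] [BorelSpace M] [SecondCountableTopology M]
  [IsContMDiffRiemannianBundle (𝓡 n) ∞ (EuclideanSpace ℝ (Fin n))
      (fun x : M => TangentSpace (𝓡 n) x)]

theorem grad_log_slope (hU : IsOpen U) (hu : ContMDiffOn (𝓡 n) 𝓘(ℝ, ℝ) 2 u U) {x : M}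
    (hx : x ∈ U) :
    grad n (fun z => Real.log (slope n u z)) x = (slope n u x)⁻¹ • grad n (slope n u) x := by
  obtain ⟨p, y, hy, rfl⟩ := exists_eq_chart_symm n x
  rw [grad_comp (Real.differentiableAt_log (slope_pos _ _).ne')
    (mdifferentiableAt_slope hU hu ⟨hy, hx⟩), Real.deriv_log]

theorem aemeasurable_enorm_grad_log_slope (hU : IsOpen U)
    (hu : ContMDiffOn (𝓡 n) 𝓘(ℝ, ℝ) 2 u U) :
    AEMeasurable (fun x => ‖grad n (fun z => Real.log (slope n u z)) x‖ₑ)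
      ((riemannianVolume n M).restrict U) := by
  refine aemeasurable_enorm hU fun p v => ?_
  have ho := isOpen_chartImage (n := n) p hU
  have h1 := contDiffOn_slope hU hu p
  have h2 : ContDiffOn ℝ 0 (fun y => fderiv ℝ (fun z => slope n u ((extChartAt (𝓡 n) p).symm z)) y v)
      (chartImage n p U) :=
    (h1.fderiv_of_isOpen ho (m := 0) (by norm_num)).clm_apply contDiffOn_const
  refine (((h1.continuousOn.inv₀ fun y _ => (slope_pos _ _).ne').mul h2.continuousOn).congr
    fun y hy => ?_).aemeasurable ho.measurableSet
  rw [grad_log_slope hU hu hy.2, real_inner_smul_left,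
    inner_grad_coordVec hy.1 (mdifferentiableAt_slope hU hu hy)]
  rfl

/-- The Caccioppoli-type inequality, with `|u - θ| / ν` written out. -/
theorem IsMinimalGraphSolution.caccioppoli [IsRiemannianManifold (𝓡 n) M] (hn : 2 ≤ n)
    (o : M) (Ψ : ℝ≥0 ≃ₜ ℝ≥0) (hΨ : ContDiffOn ℝ ∞ (onReal Ψ) (Ioi 0)) (d₀ : ℝ≥0∞)
    (hU : IsOpen U) (hUc : IsCompact (closure U)) (hη : LocallyLipschitzOn (U \ {o}) η)
    (hθ_cont : ContinuousOn θ U) (hθ : HasWeakGrad n U θ Gθ)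
    (hu_C2 : ContMDiffOn (𝓡 n) 𝓘(ℝ, ℝ) 2 u U) (hu_sol : IsMinimalGraphSolution n U u)
    {ν : ℝ} (hν : 0 < ν)
    (hW0 : MemW12Zero n U fun x => η x ^ 2 * onReal Ψ (|u x - θ x| / ν) * slope n u x) :
    ∫⁻ x in U, ENNReal.ofReal (η x ^ 2) * derivAt Ψ d₀ (|u x - θ x| / ν)
        * ‖grad n u x‖ₑ ^ 2 ∂(riemannianVolume n M)
      ≤ 4 * (∫⁻ x in U, ENNReal.ofReal (η x ^ 2) * derivAt Ψ d₀ (|u x - θ x| / ν)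
            * ‖Gθ x‖ₑ ^ 2 ∂(riemannianVolume n M))
        + 8 * ENNReal.ofReal (ν ^ 2) * (∫⁻ x in U, sqDivDeriv Ψ d₀ (|u x - θ x| / ν)
            * ‖grad n η x‖ₑ ^ 2 ∂(riemannianVolume n M))
        + 4 * ENNReal.ofReal (ν ^ 2) * (∫⁻ x in U, ENNReal.ofReal (η x ^ 2)
            * sqDivDeriv Ψ d₀ (|u x - θ x| / ν)
            * ‖grad n (fun z => Real.log (slope n u z)) x‖ₑ ^ 2 ∂(riemannianVolume n M)) := by
  obtain ⟨G, hG, φ, hφ, hφf, hφG⟩ := hW0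
  have hUm : riemannianVolume n M U ≠ ⊤ :=
    ((measure_mono subset_closure).trans_lt (riemannianVolume_lt_top_of_isCompact hUc)).ne
  have hw : HasWeakGrad n U (fun x => u x - θ x) (fun x => grad n u x - Gθ x) :=
    (hasWeakGrad_of_contMDiffOn hU (hu_C2.of_le (by norm_cast))).sub hU hθ
  have hwc : ContinuousOn (fun x => u x - θ x) U := hu_C2.continuousOn.sub hθ_cont
  have hslope : ContinuousOn (slope n u) U :=
    continuousOn_of_chart hU fun p => (contDiffOn_slope hU hu_C2 p).continuousOn
  have hhc : ContinuousOn (fun x => |u x - θ x| / ν) U := hwc.abs.div_const ν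
  have hfc : ContinuousOn (fun x => η x ^ 2 * onReal Ψ (|u x - θ x| / ν) * slope n u x)
      (U \ {o}) :=
    ((hη.continuousOn.pow 2).mul ((continuous_onReal Ψ).comp_continuousOn
      (hhc.mono sdiff_subset))).mul (hslope.mono sdiff_subset)
  have h0 := hu_sol.integral_sign_eq_zero hn hU hUm hu_C2 hwc hfc
    (fun x _ hx => by rw [hx, abs_zero, zero_div, onReal_zero, mul_zero, zero_mul]) hG hφ hφf hφG
  set μ := (riemannianVolume n M).restrict U with hμ
  set F : M → ℝ := fun x => Real.sign (u x - θ x) * (Ioi 0).indicator (fun _ => 1)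
    (η x ^ 2 * onReal Ψ (|u x - θ x| / ν) * slope n u x)
      * (inner ℝ (grad n u x) (G x) / slope n u x) with hF
  have hFi : Integrable F μ := by
    refine (integrableOn_flux_of_sq hU hUm hu_C2 hG.hasWeakGrad.aemeasurable_inner_coordVec
      hG.lintegral_grad_lt_top).bdd_mul (c := 1) ?_ (ae_of_all _ fun x => ?_)
    · exact ((measurable_real_sign.comp_aemeasurable (hwc.aemeasurable hU.measurableSet)).mul
        ((measurable_const.indicator measurableSet_Ioi).comp_aemeasurable
          (hG.hasWeakGrad.aemeasurable hU))).aestronglyMeasurable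
    · rw [norm_mul]
      refine mul_le_one₀ (norm_real_sign_le_one _) (norm_nonneg _) ?_
      exact (norm_indicator_le_norm_self _ _).trans (by simp)
  have hFi' : Integrable (fun x => 2 * ν * F x) μ := hFi.const_mul _
  obtain ⟨hneg, hfin⟩ := lintegral_ofReal_neg_eq hFi' (by rw [integral_const_mul, h0, mul_zero])
  have hae : (U \ {o} : Set M) =ᵐ[riemannianVolume n M] U :=
    sdiff_null_ae_eq_self (riemannianVolume_singleton (by omega) o)
  have hη_meas : AEMeasurable η μ := by
    rw [hμ, ← Measure.restrict_congr_set hae]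
    exact hη.continuousOn.aemeasurable (hU.sdiff isClosed_singleton).measurableSet
  have hformula := ae_weakGrad_eq Ψ hΨ hU hν hu_C2 hη hw hwc hG.hasWeakGrad
  rw [Measure.restrict_congr_set hae] at hformula
  have hpt : ∀ᵐ x ∂μ, ENNReal.ofReal (η x ^ 2) * derivAt Ψ d₀ (|u x - θ x| / ν) * ‖grad n u x‖ₑ ^ 2
      + ENNReal.ofReal (-(2 * ν * F x)) ≤ ENNReal.ofReal (2 * ν * F x)
      + (4 * (ENNReal.ofReal (η x ^ 2) * derivAt Ψ d₀ (|u x - θ x| / ν) * ‖Gθ x‖ₑ ^ 2)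
      + (8 * ENNReal.ofReal (ν ^ 2) * (sqDivDeriv Ψ d₀ (|u x - θ x| / ν) * ‖grad n η x‖ₑ ^ 2)
      + 4 * ENNReal.ofReal (ν ^ 2) * (ENNReal.ofReal (η x ^ 2)
        * sqDivDeriv Ψ d₀ (|u x - θ x| / ν)
        * ‖grad n (fun z => Real.log (slope n u z)) x‖ₑ ^ 2))) := by
    filter_upwards [hformula, hw.ae_eq_zero hU, ae_restrict_mem hU.measurableSet] with x hx1 hx2 hxU
    by_cases hwx : u x - θ x = 0
    · have hF0 : F x = 0 := by simp [hF, hwx]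
      rw [hF0, mul_zero, neg_zero, ENNReal.ofReal_zero, add_zero, zero_add,
        sub_eq_zero.1 (hx2 hwx)]
      refine le_trans ?_ le_self_add
      exact le_mul_of_one_le_left zero_le (by norm_num)
    · have hpos : 0 < |u x - θ x| / ν := div_pos (abs_pos.2 hwx) hν
      rw [sqDivDeriv, derivAt, if_neg hpos.ne']
      have hs : Real.sign (u x - θ x) ^ 2 = 1 := by
        rcases Real.sign_apply_eq_of_ne_zero _ hwx with h | h <;> simp [h]
      refine caccioppoli_young_ennreal hν (deriv_onReal_nonneg Ψ _) (onReal_pos Ψ hpos) hs _ _ _ _ ?_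
      have hW := slope_pos (n := n) u x
      rw [grad_log_slope hU hu_C2 hxU]
      by_cases hη0 : η x = 0
      · simp [hF, hη0]
      · have hfx : 0 < η x ^ 2 * onReal Ψ (|u x - θ x| / ν) * slope n u x := by
          have := onReal_pos Ψ hpos
          positivity
        rw [hF]
        beta_reduce
        rw [indicator_of_mem (by exact hfx), hx1 hwx]
        simp only [inner_add_right, real_inner_smul_right]
        field_simp
        linear_combination (η x * deriv (onReal Ψ) (|u x - θ x| / ν)
          * inner ℝ (grad n u x) (grad n u x - Gθ x) * slope n u x) * hs
  have hA : AEMeasurable (fun x => 4 * (ENNReal.ofReal (η x ^ 2)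
      * derivAt Ψ d₀ (|u x - θ x| / ν) * ‖Gθ x‖ₑ ^ 2)) μ :=
    (((hη_meas.pow_const 2).ennreal_ofReal.mul ((measurable_derivAt Ψ d₀).comp_aemeasurable
      (hhc.aemeasurable hU.measurableSet))).mul ((aemeasurable_enorm hU
        hθ.aemeasurable_inner_coordVec).pow_const 2)).const_mul _
  have hC : AEMeasurable (fun x => 4 * ENNReal.ofReal (ν ^ 2) * (ENNReal.ofReal (η x ^ 2)
        * sqDivDeriv Ψ d₀ (|u x - θ x| / ν)
        * ‖grad n (fun z => Real.log (slope n u z)) x‖ₑ ^ 2)) μ :=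
    (((hη_meas.pow_const 2).ennreal_ofReal.mul ((measurable_sqDivDeriv Ψ d₀).comp_aemeasurable
      (hhc.aemeasurable hU.measurableSet))).mul ((aemeasurable_enorm_grad_log_slope hU
        hu_C2).pow_const 2)).const_mul _
  have hint := lintegral_mono_ae hpt
  have hFm : AEMeasurable (fun x => 2 * ν * F x) μ := hFi'.aestronglyMeasurable.aemeasurable
  have hFn : AEMeasurable (fun x => -(2 * ν * F x)) μ := hFm.neg
  rw [lintegral_add_right' _ hFn.ennreal_ofReal, hneg, lintegral_add_left' hFm.ennreal_ofReal,
    lintegral_add_left' hA, lintegral_add_right' _ hC, add_comm,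
    ENNReal.add_le_add_iff_left hfin] at hint
  have hν' : ENNReal.ofReal (ν ^ 2) ≠ ⊤ := ENNReal.ofReal_ne_top
  rw [lintegral_const_mul' _ _ (by norm_num),
    lintegral_const_mul' _ _ (ENNReal.mul_ne_top (by norm_num) hν'),
    lintegral_const_mul' _ _ (ENNReal.mul_ne_top (by norm_num) hν'), ← add_assoc] at hint
  exact hint

end

end MinimalGraph

theorem lemma4p1 (n : ℕ) (hn : 2 ≤ n)
    {M : Type*} [EMetricSpace M] [SecondCountableTopology M]
    [MeasurableSpace M] [BorelSpace M]
    [ChartedSpace (EuclideanSpace ℝ (Fin n)) M] [IsManifold (𝓡 n) ∞ M]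
    [RiemannianBundle (fun x : M => TangentSpace (𝓡 n) x)]
    [IsContMDiffRiemannianBundle (𝓡 n) ∞ (EuclideanSpace ℝ (Fin n))
      (fun x : M => TangentSpace (𝓡 n) x)]
    [IsRiemannianManifold (𝓡 n) M]
    (o : M)
    (Ψ : ℝ≥0 ≃ₜ ℝ≥0) (hΨ : ContDiffOn ℝ ∞ (MinimalGraph.onReal Ψ) (Ioi 0))
    (d₀ : ℝ≥0∞)
    (U : Set M) (hU : IsOpen U) (hUc : IsCompact (closure U))
    (η : M → ℝ) (hη_nonneg : ∀ x ∈ U \ {o}, 0 ≤ η x)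
    (hη : LocallyLipschitzOn (U \ {o}) η)
    (θ u : M → ℝ) (Gθ : ∀ x : M, TangentSpace (𝓡 n) x)
    (hθ_cont : ContinuousOn θ U)
    (hθ_bdd : MemLp θ ∞ ((MinimalGraph.riemannianVolume n M).restrict U))
    (hθ : MinimalGraph.HasW12Grad n U θ Gθ)
    (hu_bdd : MemLp u ⊤ ((MinimalGraph.riemannianVolume n M).restrict U))
    (hu : MinimalGraph.MemW12 n U u)
    (hu_C2 : ContMDiffOn (𝓡 n) 𝓘(ℝ, ℝ) 2 u U)
    (hu_sol : MinimalGraph.IsMinimalGraphSolution n U u)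
    (ν : ℝ) (hν : 0 < ν)
    (h : M → ℝ) (hh : ∀ x, h x = |u x - θ x| / ν)
    (hW0 : MinimalGraph.MemW12Zero n U
      (fun x => η x ^ 2 * MinimalGraph.onReal Ψ (h x) * MinimalGraph.slope n u x)) :
    ∫⁻ x in U, ENNReal.ofReal (η x ^ 2) * MinimalGraph.derivAt Ψ d₀ (h x)
        * ‖MinimalGraph.grad n u x‖ₑ ^ 2 ∂(MinimalGraph.riemannianVolume n M)
      ≤ 4 * (∫⁻ x in U, ENNReal.ofReal (η x ^ 2) * MinimalGraph.derivAt Ψ d₀ (h x)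
            * ‖Gθ x‖ₑ ^ 2 ∂(MinimalGraph.riemannianVolume n M))
        + 8 * ENNReal.ofReal (ν ^ 2) * (∫⁻ x in U, MinimalGraph.sqDivDeriv Ψ d₀ (h x)
            * ‖MinimalGraph.grad n η x‖ₑ ^ 2 ∂(MinimalGraph.riemannianVolume n M))
        + 4 * ENNReal.ofReal (ν ^ 2) * (∫⁻ x in U, ENNReal.ofReal (η x ^ 2)
            * MinimalGraph.sqDivDeriv Ψ d₀ (h x)
            * ‖MinimalGraph.grad n (fun z => Real.log (MinimalGraph.slope n u z)) x‖ₑ ^ 2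
            ∂(MinimalGraph.riemannianVolume n M)) := by
  obtain rfl : h = fun x => |u x - θ x| / ν := funext hh
  exact hu_sol.caccioppoli hn o Ψ hΨ d₀ hU hUc hη hθ_cont hθ.hasWeakGrad hu_C2 hν hW0
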